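/- **Proposition ($L^2$ generalized unnormalized Kantorovich formulation).** Let $\Omega\subset\mathbb R^d$ be a compact convex set with nonempty interior, let $\alpha>0$, and let $\mu_0,\mu_1\in L^1(\Omega)$ be nonnegative. Define $UW_2(\mu_0,\mu_1)\ge 0$ by $$UW_2(\mu_0,\mu_1)^2=\inf_{(v,\mu,f)}\left\{\int_0^1\!\!\int_\Omega\|v(t,x)\|^2\mu(t,x)\,dx\,dt+\frac1\alpha\int_0^1\!\!\int_\Omega|f(t,x)|^2\,dx\,dt\right\},$$ where the infimum is over all triples consisting of Borel maps $v:[0,1]\times\Omega\to\mathbb R^d$ and $f:[0,1]\times\Omega\to\mathbb R$ and a continuous path of densities $\mu:[0,1]\times\Omega\to\mathbb R$ (that is, each $\mu(t,\cdot)$ is in $L^1(\Omega)$ and is nonnegative almost everywhere, $t\mapsto\mu(t,\cdot)\in L^1(\Omega)$ is continuous on $[0,1]$, and $\mu$ is continuous on $(0,1)\times\Omega$) such that $\mu(0,\cdot)=\mu_0$ and $\mu(1,\cdot)=\mu_1$ almost everywhere and $$\partial_t\mu+\nabla\cdot(\mu v)=f\quad\text{on }[0,1]\times\Omega,\qquad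 \mu v\cdot n=0\ \text{ on }[0,1]\times\partial\Omega,$$ in the weak sense: $\mu v$ and $f$ are integrable on $[0,1]\times\Omega$, and for every $\varphi\in C^1([0,1]\times\Omega)$ $$\int_\Omega\varphi(1,x)\mu(1,x)\,dx-\int_\Omega\varphi(0,x)\mu(0,x)\,dx=\int_0^1\!\!\int_\Omega\bigl(\mu\,\partial_t\varphi+\mu\,v\cdot\nabla\varphi+f\varphi\bigr)\,dx\,dt .$$ Then $UW_2(\mu_0,\mu_1)$ is finite and $$\frac12UW_2(\mu_0,\mu_1)^2=\sup_\Phi\left\{\int_\Omega\bigl(\Phi(1,x)\mu_1(x)-\Phi(0,x)\mu_0(x)\bigr)dx-\frac\alpha2\int_0^1\!\!\int_\Omega\Phi(t,x)^2\,dx\,dt\right\},$$ where the supremum is over all $\Phi\in C^1([0,1]\times\Omega)$ satisfying, for all $(t,x)\in[0,1]\times\Omega$, $$\partial_t\Phi(t,x)+\tfrac12\|\nabla\Phi(t,x)\|^2\le 0 .$$ Here $C^1([0,1]\times\Omega)$ denotes functions that are continuously differentiable up to the boundary. -/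

import Mathlib

open Set Filter Topology MeasureTheory
open scoped ENNReal RealInnerProductSpace

noncomputable section

namespace UnnormalizedOT

/-- The space-time cylinder `[0,1] × Ω`. -/
def cylinder {d : ℕ} (Ω : Set (EuclideanSpace ℝ (Fin d))) :
    Set (ℝ × EuclideanSpace ℝ (Fin d)) :=
  Icc (0 : ℝ) 1 ×ˢ Ω

/-- `μ` is (a representative of) an unnormalized density on `Ω`: `μ ∈ L¹(Ω)`, `μ ≥ 0`. -/
def IsDensity {d : ℕ} (Ω : Set (EuclideanSpace ℝ (Fin d)))
    (μ : EuclideanSpace ℝ (Fin d) → ℝ) : Prop :=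
  IntegrableOn μ Ω ∧ ∀ᵐ x ∂(volume.restrict Ω), 0 ≤ μ x

/-- The time derivative `∂ₜφ(t,x)` of a function on `[0,1] × Ω` (one-sided at `t = 0, 1`). -/
def dt {d : ℕ} (φ : ℝ → EuclideanSpace ℝ (Fin d) → ℝ) (t : ℝ)
    (x : EuclideanSpace ℝ (Fin d)) : ℝ :=
  derivWithin (fun s => φ s x) (Icc (0 : ℝ) 1) t

/-- The spatial gradient `∇φ(t,x)` of a function on `[0,1] × Ω` (taken within `Ω`). -/
def gradX {d : ℕ} (Ω : Set (EuclideanSpace ℝ (Fin d)))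
    (φ : ℝ → EuclideanSpace ℝ (Fin d) → ℝ) (t : ℝ)
    (x : EuclideanSpace ℝ (Fin d)) : EuclideanSpace ℝ (Fin d) :=
  gradientWithin (φ t) Ω x

/-- `φ ∈ C¹([0,1] × Ω)`, up to the boundary. -/
def IsC1 {d : ℕ} (Ω : Set (EuclideanSpace ℝ (Fin d)))
    (φ : ℝ → EuclideanSpace ℝ (Fin d) → ℝ) : Prop :=
  ContDiffOn ℝ 1 (Function.uncurry φ) (cylinder Ω)

/-- A continuous path of unnormalized densities: a continuous curve `[0,1] → L¹(Ω)` of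
nonnegative densities, which is a jointly continuous function of `(t,x)` for `0 < t < 1`
(the densities at times `0` and `1` are arbitrary elements of `L¹(Ω)`). -/
structure IsDensityPath {d : ℕ} (Ω : Set (EuclideanSpace ℝ (Fin d)))
    (μ : ℝ → EuclideanSpace ℝ (Fin d) → ℝ) : Prop where
  density : ∀ t ∈ Icc (0 : ℝ) 1, IsDensity Ω (μ t)
  continuousOn : ContinuousOn (Function.uncurry μ) (Ioo (0 : ℝ) 1 ×ˢ Ω)
  continuous_L1 : ∀ t ∈ Icc (0 : ℝ) 1,
    Tendsto (fun s => eLpNorm (μ s - μ t) 1 (volume.restrict Ω)) (𝓝[Icc (0 : ℝ) 1] t) (𝓝 0)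

/-- The unnormalized continuity equation `∂ₜμ + ∇·(μ v) = f` on `[0,1] × Ω` with zero flux
`μ v · n = 0` on `[0,1] × ∂Ω`, in the weak form obtained by testing with functions in
`C¹([0,1] × Ω)` that need not vanish on the boundary. -/
structure ContinuityEq {d : ℕ} (Ω : Set (EuclideanSpace ℝ (Fin d)))
    (v : ℝ → EuclideanSpace ℝ (Fin d) → EuclideanSpace ℝ (Fin d))
    (μ f : ℝ → EuclideanSpace ℝ (Fin d) → ℝ) : Prop where
  integrable_flux : IntegrableOn (fun z : ℝ × EuclideanSpace ℝ (Fin d) =>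
    μ z.1 z.2 • v z.1 z.2) (cylinder Ω)
  integrable_source : IntegrableOn (fun z : ℝ × EuclideanSpace ℝ (Fin d) => f z.1 z.2)
    (cylinder Ω)
  weak : ∀ φ : ℝ → EuclideanSpace ℝ (Fin d) → ℝ, IsC1 Ω φ →
    (∫ x in Ω, φ 1 x * μ 1 x) - (∫ x in Ω, φ 0 x * μ 0 x) =
      ∫ z in cylinder Ω, (dt φ z.1 z.2 * μ z.1 z.2
        + ⟪gradX Ω φ z.1 z.2, μ z.1 z.2 • v z.1 z.2⟫ + φ z.1 z.2 * f z.1 z.2)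

/-- The triples `(v, μ, f)` over which the infimum defining `UW₂(μ₀, μ₁)` is taken. -/
structure Admissible {d : ℕ} (Ω : Set (EuclideanSpace ℝ (Fin d)))
    (μ₀ μ₁ : EuclideanSpace ℝ (Fin d) → ℝ)
    (v : ℝ → EuclideanSpace ℝ (Fin d) → EuclideanSpace ℝ (Fin d))
    (μ f : ℝ → EuclideanSpace ℝ (Fin d) → ℝ) : Prop where
  measurable_velocity : Measurable (Function.uncurry v)
  measurable_source : Measurable (Function.uncurry f)
  path : IsDensityPath Ω μ
  continuityEq : ContinuityEq Ω v μ f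
  initial : μ 0 =ᵐ[volume.restrict Ω] μ₀
  terminal : μ 1 =ᵐ[volume.restrict Ω] μ₁

/-- `∫₀¹∫_Ω ‖v‖² μ dx dt + (1/α) ∫₀¹∫_Ω |f|² dx dt`, possibly `∞`. -/
def cost {d : ℕ} (α : ℝ) (Ω : Set (EuclideanSpace ℝ (Fin d)))
    (v : ℝ → EuclideanSpace ℝ (Fin d) → EuclideanSpace ℝ (Fin d))
    (μ f : ℝ → EuclideanSpace ℝ (Fin d) → ℝ) : ℝ≥0∞ :=
  (∫⁻ z in cylinder Ω, ENNReal.ofReal (‖v z.1 z.2‖ ^ 2 * μ z.1 z.2))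
    + ENNReal.ofReal (1 / α) * ∫⁻ z in cylinder Ω, ENNReal.ofReal (|f z.1 z.2| ^ 2)

/-- The infimum of the cost, as an extended number: `UW₂(μ₀, μ₁)²`. -/
def UW2sq {d : ℕ} (α : ℝ) (Ω : Set (EuclideanSpace ℝ (Fin d)))
    (μ₀ μ₁ : EuclideanSpace ℝ (Fin d) → ℝ) : ℝ≥0∞ :=
  sInf {c | ∃ v μ f, Admissible Ω μ₀ μ₁ v μ f ∧ c = cost α Ω v μ f}

/-- The `L²` generalized unnormalized Wasserstein distance `UW₂(μ₀, μ₁)`. -/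
def UW2 {d : ℕ} (α : ℝ) (Ω : Set (EuclideanSpace ℝ (Fin d)))
    (μ₀ μ₁ : EuclideanSpace ℝ (Fin d) → ℝ) : ℝ :=
  Real.sqrt (UW2sq α Ω μ₀ μ₁).toReal

/-- `Φ ∈ C¹([0,1] × Ω)` with `∂ₜΦ + ½ ‖∇Φ‖² ≤ 0` on `[0,1] × Ω`. -/
def IsHJSubsolution {d : ℕ} (Ω : Set (EuclideanSpace ℝ (Fin d)))
    (Φ : ℝ → EuclideanSpace ℝ (Fin d) → ℝ) : Prop :=
  IsC1 Ω Φ ∧ ∀ t ∈ Icc (0 : ℝ) 1, ∀ x ∈ Ω, dt Φ t x + 1 / 2 * ‖gradX Ω Φ t x‖ ^ 2 ≤ 0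

/-- The Kantorovich functional
`∫_Ω (Φ(1,x) μ₁(x) - Φ(0,x) μ₀(x)) dx - (α/2) ∫₀¹∫_Ω Φ² dx dt`. -/
def dualValue {d : ℕ} (α : ℝ) (Ω : Set (EuclideanSpace ℝ (Fin d)))
    (μ₀ μ₁ : EuclideanSpace ℝ (Fin d) → ℝ)
    (Φ : ℝ → EuclideanSpace ℝ (Fin d) → ℝ) : ℝ :=
  (∫ x in Ω, (Φ 1 x * μ₁ x - Φ 0 x * μ₀ x))
    - α / 2 * ∫ z in cylinder Ω, Φ z.1 z.2 ^ 2

end UnnormalizedOT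

end

noncomputable section

namespace UnnormalizedOT

/-! Weak duality is the easy half: test the weak continuity equation with a subsolution `Φ`,
multiply the Hamilton-Jacobi inequality by `μ ≥ 0`, and apply Young's inequality to `⟪∇Φ, v⟫ μ` and
to `Φ f` (`dualValue_le_half_cost`).

For the converse, let `D` bound every dual value. On the jets `(∂ₜφ, ∇φ, φ)` of `C¹` functions, the
endpoint pairing `∫ φ(1) μ₁ - ∫ φ(0) μ₀` is a linear functional which is at most `D + α/2 ∫ c²` on
triples `(a, b, c)` with `a + ½ ‖b‖² ≤ 0`. A Hahn-Banach argument extends it, keeping this bound, to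
a continuous functional `L` on all continuous triples (`exists_dual_functional`). Morally `L` is a
triple of measures `(μ, m, f)` solving the continuity equation with total cost at most `2D`.
Admissible paths need continuous densities, so `L` must be regularized without leaving the class of
solutions.

The regularization is dual to an averaging of test functions. Replace `φ` at `z'` by the expectation
of `φ((1 - s) z' + ξ)`, where the noise `ξ` lies in `s` times the cylinder; convexity keeps the
point in the cylinder, so no boundary flux appears. Applying `L` to the kernel of this averaging
produces continuous `(μ, m, f)` (`exists_represents`). Jensen's inequality preserves the bound on
`L`, up to the factor `(1 - s)⁻¹ ^ (d + 1)`, and choosing near-optimal test triples turns it into a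
cost bound (`Represents.lintegral_energy_le`).

The price is paid at the endpoints: the regularized density vanishes at times `0` and `1`, while
`μ₀` and `μ₁` reappear, smeared, as sources close to these times. A boundary layer repairs this.
Particles leave `μ₀`, move in straight lines to random points at scale `s`, and are absorbed at
exactly the smeared source; near time `1` the same is done in reverse (`exists_boundary_layer`).
Speeds are bounded and the motion lasts a time `O(s)`, so the kinetic energy is `O(s)`. In the sum
of the two solutions the extra sources cancel, leaving the source `f` alone, and the energies add by
subadditivity of `‖m‖² / μ` (`EnergyBound.add`). Letting `s → 0` gives `UW₂² ≤ 2D`. The boundary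
layer by itself already has finite cost, which proves finiteness. -/

/-- Euclidean space `ℝ^d`. -/
abbrev Euc (d : ℕ) := EuclideanSpace ℝ (Fin d)

/-! ### Calculus and integrability on the space-time cylinder. -/

section Cylinder

variable {d : ℕ} {Ω : Set (Euc d)}

theorem isCompact_cylinder (h : IsCompact Ω) : IsCompact (cylinder Ω) := isCompact_Icc.prod h

theorem convex_cylinder (h : Convex ℝ Ω) : Convex ℝ (cylinder Ω) := (convex_Icc 0 1).prod h

theorem measurableSet_cylinder (h : IsCompact Ω) : MeasurableSet (cylinder Ω) :=
  (isCompact_cylinder h).measurableSet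

theorem uniqueDiffOn_cylinder (h : Convex ℝ Ω) (hi : (interior Ω).Nonempty) :
    UniqueDiffOn ℝ (cylinder Ω) :=
  (uniqueDiffOn_Icc one_pos).prod (uniqueDiffOn_convex h hi)

theorem volume_restrict_cylinder :
    (volume : Measure (ℝ × Euc d)).restrict (cylinder Ω) =
      (volume.restrict (Icc (0 : ℝ) 1)).prod (volume.restrict Ω) := by
  rw [Measure.prod_restrict, cylinder, Measure.volume_eq_prod]

theorem volume_restrict_cylinder_Ioo :
    (volume : Measure (ℝ × Euc d)).restrict (cylinder Ω) =
      (volume : Measure (ℝ × Euc d)).restrict (Ioo (0 : ℝ) 1 ×ˢ Ω) := by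
  rw [volume_restrict_cylinder, Measure.volume_eq_prod, ← Measure.prod_restrict,
    restrict_Ioo_eq_restrict_Icc]

/-- Restrictions of the full derivative of a function on the cylinder to the coordinate
directions. -/
theorem hasDerivWithinAt_dt {φ : ℝ → Euc d → ℝ} {D : ℝ × Euc d →L[ℝ] ℝ} {t : ℝ} {x : Euc d}
    (hx : x ∈ Ω) (h : HasFDerivWithinAt (Function.uncurry φ) D (cylinder Ω) (t, x)) :
    HasDerivWithinAt (fun s => φ s x) (D (1, 0)) (Icc 0 1) t := by
  have h1 : HasDerivWithinAt (fun s : ℝ => (s, x)) (1, 0) (Icc (0 : ℝ) 1) t :=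
    (hasDerivWithinAt_id t _).prodMk (hasDerivWithinAt_const t _ x)
  have hm : MapsTo (fun s : ℝ => (s, x)) (Icc (0 : ℝ) 1) (cylinder Ω) := fun s hs => ⟨hs, hx⟩
  exact h.comp_hasDerivWithinAt t h1 hm

theorem hasFDerivWithinAt_space {φ : ℝ → Euc d → ℝ} {D : ℝ × Euc d →L[ℝ] ℝ} {t : ℝ} {x : Euc d}
    (ht : t ∈ Icc (0 : ℝ) 1)
    (h : HasFDerivWithinAt (Function.uncurry φ) D (cylinder Ω) (t, x)) :
    HasFDerivWithinAt (φ t) (D ∘L (ContinuousLinearMap.inr ℝ ℝ (Euc d))) Ω x := by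
  have h1 : HasFDerivWithinAt (fun y : Euc d => (t, y)) (ContinuousLinearMap.inr ℝ ℝ (Euc d)) Ω x :=
    (hasFDerivAt_prodMk_right t x).hasFDerivWithinAt
  exact h.comp x h1 (fun s hs => ⟨ht, hs⟩)

theorem dt_eq {φ : ℝ → Euc d → ℝ} {D : ℝ × Euc d →L[ℝ] ℝ} {t : ℝ} {x : Euc d}
    (ht : t ∈ Icc (0 : ℝ) 1) (hx : x ∈ Ω)
    (h : HasFDerivWithinAt (Function.uncurry φ) D (cylinder Ω) (t, x)) :
    dt φ t x = D (1, 0) :=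
  (hasDerivWithinAt_dt hx h).derivWithin (uniqueDiffOn_Icc one_pos t ht)

theorem gradX_eq (hc : Convex ℝ Ω) (hi : (interior Ω).Nonempty)
    {φ : ℝ → Euc d → ℝ} {D : ℝ × Euc d →L[ℝ] ℝ} {t : ℝ} {x : Euc d}
    (ht : t ∈ Icc (0 : ℝ) 1) (hx : x ∈ Ω)
    (h : HasFDerivWithinAt (Function.uncurry φ) D (cylinder Ω) (t, x)) :
    gradX Ω φ t x = (InnerProductSpace.toDual ℝ (Euc d)).symm
      (D ∘L (ContinuousLinearMap.inr ℝ ℝ (Euc d))) := by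
  rw [gradX, gradientWithin, (hasFDerivWithinAt_space ht h).fderivWithin
    (uniqueDiffOn_convex hc hi x hx)]

theorem inner_gradX_eq (hc : Convex ℝ Ω) (hi : (interior Ω).Nonempty)
    {φ : ℝ → Euc d → ℝ} {D : ℝ × Euc d →L[ℝ] ℝ} {t : ℝ} {x : Euc d}
    (ht : t ∈ Icc (0 : ℝ) 1) (hx : x ∈ Ω)
    (h : HasFDerivWithinAt (Function.uncurry φ) D (cylinder Ω) (t, x)) (w : Euc d) :
    ⟪gradX Ω φ t x, w⟫ = D (0, w) := by
  rw [gradX_eq hc hi ht hx h, InnerProductSpace.toDual_symm_apply]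
  simp

theorem IsC1.hasFDerivWithinAt {φ : ℝ → Euc d → ℝ} (h : IsC1 Ω φ) {z : ℝ × Euc d}
    (hz : z ∈ cylinder Ω) :
    HasFDerivWithinAt (Function.uncurry φ) (fderivWithin ℝ (Function.uncurry φ) (cylinder Ω) z)
      (cylinder Ω) z :=
  (h.differentiableOn (by norm_num) z hz).hasFDerivWithinAt

theorem IsC1.continuousOn_fderivWithin (hc : Convex ℝ Ω) (hi : (interior Ω).Nonempty)
    {φ : ℝ → Euc d → ℝ} (h : IsC1 Ω φ) :
    ContinuousOn (fderivWithin ℝ (Function.uncurry φ) (cylinder Ω)) (cylinder Ω) :=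
  ContDiffOn.continuousOn_fderivWithin h (uniqueDiffOn_cylinder hc hi) le_rfl

theorem IsC1.continuousOn {φ : ℝ → Euc d → ℝ} (h : IsC1 Ω φ) :
    ContinuousOn (fun z : ℝ × Euc d => φ z.1 z.2) (cylinder Ω) :=
  ContDiffOn.continuousOn h

theorem IsC1.continuousOn_dt (hc : Convex ℝ Ω) (hi : (interior Ω).Nonempty)
    {φ : ℝ → Euc d → ℝ} (h : IsC1 Ω φ) :
    ContinuousOn (fun z : ℝ × Euc d => dt φ z.1 z.2) (cylinder Ω) := by
  refine ContinuousOn.congr (f := fun z => fderivWithin ℝ (Function.uncurry φ) (cylinder Ω) z (1, 0))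
    ((h.continuousOn_fderivWithin hc hi).clm_apply continuousOn_const) ?_
  rintro ⟨t, x⟩ hz
  exact dt_eq hz.1 hz.2 (h.hasFDerivWithinAt hz)

theorem IsC1.continuousOn_gradX (hc : Convex ℝ Ω) (hi : (interior Ω).Nonempty)
    {φ : ℝ → Euc d → ℝ} (h : IsC1 Ω φ) :
    ContinuousOn (fun z : ℝ × Euc d => gradX Ω φ z.1 z.2) (cylinder Ω) := by
  refine ContinuousOn.congr (f := fun z => (InnerProductSpace.toDual ℝ (Euc d)).symm
      (fderivWithin ℝ (Function.uncurry φ) (cylinder Ω) z ∘L (ContinuousLinearMap.inr ℝ ℝ (Euc d))))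
    ((LinearIsometryEquiv.continuous _).comp_continuousOn
      ((h.continuousOn_fderivWithin hc hi).clm_comp continuousOn_const)) ?_
  rintro ⟨t, x⟩ hz
  exact gradX_eq hc hi hz.1 hz.2 (h.hasFDerivWithinAt hz)

theorem IsC1.slice {φ : ℝ → Euc d → ℝ} (h : IsC1 Ω φ) {t : ℝ} (ht : t ∈ Icc (0 : ℝ) 1) :
    ContinuousOn (φ t) Ω :=
  h.continuousOn.comp (f := fun x : Euc d => (t, x)) (by fun_prop) (fun x hx => ⟨ht, hx⟩)

theorem IsC1.hasDerivWithinAt_comp (hc : Convex ℝ Ω) (hi : (interior Ω).Nonempty)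
    {φ : ℝ → Euc d → ℝ} (h : IsC1 Ω φ) {γ : ℝ → Euc d} {γ' : Euc d} {t : ℝ}
    (ht : t ∈ Icc (0 : ℝ) 1) (hγ : HasDerivWithinAt γ γ' (Icc 0 1) t)
    (hm : ∀ s ∈ Icc (0 : ℝ) 1, γ s ∈ Ω) :
    HasDerivWithinAt (fun s => φ s (γ s)) (dt φ t (γ t) + ⟪gradX Ω φ t (γ t), γ'⟫)
      (Icc 0 1) t := by
  have hz : (t, γ t) ∈ cylinder Ω := ⟨ht, hm t ht⟩
  have h0 := h.hasFDerivWithinAt hz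
  have h1 := h0.comp_hasDerivWithinAt (f := fun s => (s, γ s)) t
    ((hasDerivWithinAt_id t _).prodMk hγ) (fun s hs => ⟨hs, hm s hs⟩)
  refine h1.congr_deriv ?_
  rw [dt_eq hz.1 hz.2 h0, inner_gradX_eq hc hi hz.1 hz.2 h0, ← map_add]
  simp

theorem integrableOn_inner {X : Type*} [TopologicalSpace X] [T2Space X] [MeasurableSpace X]
    [OpensMeasurableSpace X] [SecondCountableTopology X] {K : Set X} {ν : Measure X}
    (hK : IsCompact K) {g m : X → Euc d}
    (hg : ContinuousOn g K) (hm : IntegrableOn m K ν) :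
    IntegrableOn (fun x => ⟪g x, m x⟫) K ν := by
  obtain ⟨C, hC⟩ := hK.exists_bound_of_continuousOn hg
  refine (hm.norm.const_mul C).mono'
    ((hg.aestronglyMeasurable hK.measurableSet).inner hm.aestronglyMeasurable) ?_
  filter_upwards [ae_restrict_mem hK.measurableSet] with x hx
  exact (abs_real_inner_le_norm _ _).trans
    (mul_le_mul_of_nonneg_right (hC x hx) (norm_nonneg _))

theorem integrableOn_weak_integrand (hΩ : IsCompact Ω) (hc : Convex ℝ Ω)
    (hi : (interior Ω).Nonempty) {φ : ℝ → Euc d → ℝ} (h : IsC1 Ω φ)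
    {μ f : ℝ × Euc d → ℝ} {m : ℝ × Euc d → Euc d} (hμ : IntegrableOn μ (cylinder Ω))
    (hm : IntegrableOn m (cylinder Ω)) (hf : IntegrableOn f (cylinder Ω)) :
    IntegrableOn (fun z : ℝ × Euc d => dt φ z.1 z.2 * μ z + ⟪gradX Ω φ z.1 z.2, m z⟫
      + φ z.1 z.2 * f z) (cylinder Ω) := by
  have hK := isCompact_cylinder hΩ
  exact ((hμ.continuousOn_mul (h.continuousOn_dt hc hi) hK).add
    (integrableOn_inner hK (h.continuousOn_gradX hc hi) hm)).add
    (hf.continuousOn_mul h.continuousOn hK)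

theorem aestronglyMeasurable_of_continuousOn_Ioo (hΩ : IsCompact Ω) {F : Type*}
    [TopologicalSpace F] [TopologicalSpace.PseudoMetrizableSpace F] [SecondCountableTopology F]
    {g : ℝ × Euc d → F} (h : ContinuousOn g (Ioo (0 : ℝ) 1 ×ˢ Ω)) :
    AEStronglyMeasurable g (volume.restrict (cylinder Ω)) := by
  rw [volume_restrict_cylinder_Ioo]
  borelize F
  exact (h.aemeasurable (measurableSet_Ioo.prod hΩ.measurableSet)).aestronglyMeasurable

/-- A function on the cylinder with uniformly bounded `L¹` norms of its time slices is
integrable. -/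
theorem integrableOn_cylinder_of_slices {F : Type*} [NormedAddCommGroup F] {g : ℝ × Euc d → F}
    (hg : AEStronglyMeasurable g (volume.restrict (cylinder Ω)))
    (hs : ∀ t ∈ Icc (0 : ℝ) 1, IntegrableOn (fun x => g (t, x)) Ω) {C : ℝ}
    (hC : ∀ t ∈ Icc (0 : ℝ) 1, ∫ x in Ω, ‖g (t, x)‖ ≤ C) : IntegrableOn g (cylinder Ω) := by
  rw [IntegrableOn, volume_restrict_cylinder] at *
  rw [integrable_prod_iff hg]
  refine ⟨(ae_restrict_iff' measurableSet_Icc).2 (Eventually.of_forall hs), ?_⟩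
  refine Integrable.mono' (integrable_const C) hg.norm.integral_prod_right' ?_
  filter_upwards [ae_restrict_mem measurableSet_Icc] with t ht
  rw [Real.norm_of_nonneg (by positivity)]
  exact hC t ht

/-- Continuity into `L¹` makes the mass of the time slices continuous, hence bounded on the compact
interval; Fubini then applies. -/
theorem IsDensityPath.integrableOn (hΩ : IsCompact Ω) {μ : ℝ → Euc d → ℝ}
    (h : IsDensityPath Ω μ) : IntegrableOn (fun z : ℝ × Euc d => μ z.1 z.2) (cylinder Ω) := by
  have hN : ContinuousOn (fun t => ∫ x in Ω, ‖μ t x‖) (Icc (0 : ℝ) 1) := by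
    intro t ht
    have h1 := h.continuous_L1 t ht
    refine tendsto_iff_dist_tendsto_zero.2 ?_
    have h2 : Tendsto (fun s => (eLpNorm (μ s - μ t) 1 (volume.restrict Ω)).toReal)
        (𝓝[Icc (0 : ℝ) 1] t) (𝓝 0) :=
      (ENNReal.tendsto_toReal ENNReal.zero_ne_top).comp h1
    refine squeeze_zero' (Eventually.of_forall fun _ => dist_nonneg) ?_ h2
    filter_upwards [self_mem_nhdsWithin] with s hs
    have i1 := (h.density s hs).1
    have i2 := (h.density t ht).1
    rw [Real.dist_eq, ← integral_sub i1.norm i2.norm, eLpNorm_one_eq_lintegral_enorm,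
      ← integral_norm_eq_lintegral_enorm (i1.sub i2).aestronglyMeasurable]
    refine (abs_integral_le_integral_abs).trans ?_
    exact integral_mono (i1.norm.sub i2.norm).abs (i1.sub i2).norm
      fun x => abs_norm_sub_norm_le _ _
  obtain ⟨C, hC⟩ := isCompact_Icc.exists_bound_of_continuousOn hN
  refine integrableOn_cylinder_of_slices (C := C)
    (aestronglyMeasurable_of_continuousOn_Ioo hΩ h.continuousOn) (fun t ht => (h.density t ht).1)
    fun t ht => (le_abs_self _).trans (hC t ht)

theorem IsDensityPath.ae_nonneg (hΩ : IsCompact Ω) {μ : ℝ → Euc d → ℝ}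
    (h : IsDensityPath Ω μ) : ∀ᵐ z ∂(volume.restrict (cylinder Ω)), 0 ≤ μ z.1 z.2 := by
  have hm := aestronglyMeasurable_of_continuousOn_Ioo hΩ h.continuousOn
  rw [volume_restrict_cylinder] at *
  have h1 : ∀ᵐ z ∂((volume.restrict (Icc (0 : ℝ) 1)).prod (volume.restrict Ω)),
      0 ≤ hm.mk _ z := by
    -- Passing from almost every slice to almost every point needs a measurable set, hence the
    -- strongly measurable representative `hm.mk`.
    refine (Measure.ae_prod_iff_ae_ae (measurableSet_le measurable_const
      hm.stronglyMeasurable_mk.measurable)).2 ?_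
    filter_upwards [ae_restrict_mem measurableSet_Icc, Measure.ae_ae_of_ae_prod hm.ae_eq_mk]
      with t ht h2
    filter_upwards [(h.density t ht).2, h2] with x hx h3
    rwa [← h3]
  filter_upwards [h1, hm.ae_eq_mk] with z hz h2
  exact hz.trans_eq h2.symm

end Cylinder

/-! ### Weak duality. -/

section WeakDuality

variable {d : ℕ} {Ω : Set (Euc d)}

/-- After inserting the weak equation the inequality is pointwise: `⟪∇Φ, v⟫ ≤ ½‖∇Φ‖² + ½‖v‖²` and `Φ
f ≤ α/2 Φ² + f²/(2α)`, and the terms with `∂ₜΦ + ½‖∇Φ‖²` have a sign because `μ ≥ 0`. Finite cost is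
used to pass to real integrals. -/
theorem dualValue_le_half_cost (hΩ : IsCompact Ω) (hc : Convex ℝ Ω) (hi : (interior Ω).Nonempty)
    {α : ℝ} (hα : 0 < α) {μ₀ μ₁ : Euc d → ℝ} {v : ℝ → Euc d → Euc d} {μ f : ℝ → Euc d → ℝ}
    (h : Admissible Ω μ₀ μ₁ v μ f) (hcost : cost α Ω v μ f ≠ ⊤) {Φ : ℝ → Euc d → ℝ}
    (hΦ : IsHJSubsolution Ω Φ) :
    dualValue α Ω μ₀ μ₁ Φ ≤ 1 / 2 * (cost α Ω v μ f).toReal := by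
  have hK := isCompact_cylinder hΩ
  have hμ := h.path.integrableOn hΩ
  have hμ0 := h.path.ae_nonneg hΩ
  set ν := (volume : Measure (ℝ × Euc d)).restrict (cylinder Ω) with hν
  obtain ⟨hc1, hc2⟩ := ENNReal.add_ne_top.1 hcost
  have hαi : 0 < 1 / α := by positivity
  have hc3 : ∫⁻ z, ENNReal.ofReal (|f z.1 z.2| ^ 2) ∂ν ≠ ⊤ := by
    intro h'
    rw [h', ENNReal.mul_top (by simpa using hα)] at hc2
    exact hc2 rfl
  have hvm : AEStronglyMeasurable (fun z : ℝ × Euc d => ‖v z.1 z.2‖ ^ 2 * μ z.1 z.2) ν :=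
    (h.measurable_velocity.norm.pow_const 2).aestronglyMeasurable.mul hμ.aestronglyMeasurable
  have hfm : Measurable (fun z : ℝ × Euc d => |f z.1 z.2| ^ 2) :=
    (continuous_abs.measurable.comp h.measurable_source).pow_const 2
  have hv0 : 0 ≤ᵐ[ν] fun z : ℝ × Euc d => ‖v z.1 z.2‖ ^ 2 * μ z.1 z.2 := by
    filter_upwards [hμ0] with z hz using by positivity
  have hf0 : 0 ≤ᵐ[ν] fun z : ℝ × Euc d => |f z.1 z.2| ^ 2 :=
    Eventually.of_forall fun z => by positivity
  have iv : Integrable (fun z : ℝ × Euc d => ‖v z.1 z.2‖ ^ 2 * μ z.1 z.2) ν :=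
    ⟨hvm, by rw [hasFiniteIntegral_iff_ofReal hv0]; exact lt_top_iff_ne_top.2 hc1⟩
  have if2 : Integrable (fun z : ℝ × Euc d => |f z.1 z.2| ^ 2) ν :=
    ⟨hfm.aestronglyMeasurable, by
      rw [hasFiniteIntegral_iff_ofReal hf0]; exact lt_top_iff_ne_top.2 hc3⟩
  have hcr : (cost α Ω v μ f).toReal = (∫ z, ‖v z.1 z.2‖ ^ 2 * μ z.1 z.2 ∂ν)
      + 1 / α * ∫ z, |f z.1 z.2| ^ 2 ∂ν := by
    rw [cost, ENNReal.toReal_add hc1 hc2, ENNReal.toReal_mul, ENNReal.toReal_ofReal hαi.le,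
      integral_eq_lintegral_of_nonneg_ae hv0 hvm,
      integral_eq_lintegral_of_nonneg_ae hf0 hfm.aestronglyMeasurable]
  have d0 := h.path.density 0 (by simp)
  have d1 := h.path.density 1 (by simp)
  have e1 : ∫ x in Ω, (Φ 1 x * μ₁ x - Φ 0 x * μ₀ x) =
      (∫ x in Ω, Φ 1 x * μ 1 x) - ∫ x in Ω, Φ 0 x * μ 0 x := by
    rw [← integral_sub (d1.1.continuousOn_mul (hΦ.1.slice (by simp)) hΩ)
      (d0.1.continuousOn_mul (hΦ.1.slice (by simp)) hΩ)]
    refine integral_congr_ae ?_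
    filter_upwards [h.initial, h.terminal] with x h0 h1
    rw [h0, h1]
  rw [dualValue, e1, h.continuityEq.weak Φ hΦ.1, hcr, ← integral_const_mul, ← integral_const_mul]
  have iw := integrableOn_weak_integrand hΩ hc hi hΦ.1 hμ h.continuityEq.integrable_flux
    h.continuityEq.integrable_source
  have iΦ : Integrable (fun z : ℝ × Euc d => Φ z.1 z.2 ^ 2) ν :=
    (hΦ.1.continuousOn.pow 2).integrableOn_compact hK
  rw [← integral_sub iw (iΦ.const_mul _), ← integral_add iv (if2.const_mul _),
    ← integral_const_mul]
  refine integral_mono_ae (iw.sub (iΦ.const_mul _)) ((iv.add (if2.const_mul _)).const_mul _) ?_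
  filter_upwards [hμ0, ae_restrict_mem (measurableSet_cylinder hΩ)] with z hz hzc
  have hj := hΦ.2 z.1 hzc.1 z.2 hzc.2
  have h1 : ⟪gradX Ω Φ z.1 z.2, μ z.1 z.2 • v z.1 z.2⟫ ≤
      μ z.1 z.2 * (1 / 2 * ‖gradX Ω Φ z.1 z.2‖ ^ 2 + 1 / 2 * ‖v z.1 z.2‖ ^ 2) := by
    rw [real_inner_smul_right]
    refine mul_le_mul_of_nonneg_left ?_ hz
    have := real_inner_le_norm (gradX Ω Φ z.1 z.2) (v z.1 z.2)
    nlinarith [sq_nonneg (‖gradX Ω Φ z.1 z.2‖ - ‖v z.1 z.2‖)]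
  have h2 : Φ z.1 z.2 * f z.1 z.2 ≤ α / 2 * Φ z.1 z.2 ^ 2 + 1 / 2 * (1 / α * |f z.1 z.2| ^ 2) := by
    rw [sq_abs]
    have : α / 2 * Φ z.1 z.2 ^ 2 + 1 / 2 * (1 / α * f z.1 z.2 ^ 2) - Φ z.1 z.2 * f z.1 z.2
        = 1 / (2 * α) * (α * Φ z.1 z.2 - f z.1 z.2) ^ 2 := by field_simp; ring
    nlinarith [show 0 ≤ 1 / (2 * α) * (α * Φ z.1 z.2 - f z.1 z.2) ^ 2 by positivity]
  have h3 := mul_le_mul_of_nonneg_right hj hz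
  nlinarith

end WeakDuality

/-! ### Solutions in momentum variables: sums, time reversal and energy. -/

section Solutions

variable {d : ℕ} {Ω : Set (Euc d)}

/-- A distributional solution of `∂ₜμ + ∇·m = f` with zero flux, in density/momentum variables,
whose density and momentum are continuous for `0 < t < 1` and whose source is continuous. -/
structure MomentumSolution (Ω : Set (Euc d)) (μ : ℝ → Euc d → ℝ) (m : ℝ × Euc d → Euc d)
    (f : ℝ × Euc d → ℝ) : Prop where
  path : IsDensityPath Ω μ
  continuousOn_momentum : ContinuousOn m (Ioo (0 : ℝ) 1 ×ˢ Ω)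
  integrable_momentum : IntegrableOn m (cylinder Ω)
  continuous_source : Continuous f
  weak : ∀ φ : ℝ → Euc d → ℝ, IsC1 Ω φ →
    (∫ x in Ω, φ 1 x * μ 1 x) - (∫ x in Ω, φ 0 x * μ 0 x) =
      ∫ z in cylinder Ω, (dt φ z.1 z.2 * μ z.1 z.2
        + ⟪gradX Ω φ z.1 z.2, m z⟫ + φ z.1 z.2 * f z)

theorem IsDensityPath.add {μ ν : ℝ → Euc d → ℝ} (h : IsDensityPath Ω μ)
    (h' : IsDensityPath Ω ν) : IsDensityPath Ω (fun t x => μ t x + ν t x) where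
  density t ht := by
    refine ⟨(h.density t ht).1.add (h'.density t ht).1, ?_⟩
    filter_upwards [(h.density t ht).2, (h'.density t ht).2] with x h1 h2 using add_nonneg h1 h2
  continuousOn := h.continuousOn.add h'.continuousOn
  continuous_L1 t ht := by
    have := (h.continuous_L1 t ht).add (h'.continuous_L1 t ht)
    rw [add_zero] at this
    refine tendsto_of_tendsto_of_tendsto_of_le_of_le' tendsto_const_nhds this
      (Eventually.of_forall fun _ => zero_le) ?_
    filter_upwards [self_mem_nhdsWithin] with s hs
    have e : ((fun x => μ s x + ν s x) - fun x => μ t x + ν t x) = (μ s - μ t) + (ν s - ν t) := by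
      ext x; simp; ring
    rw [e]
    exact eLpNorm_add_le ((h.density s hs).1.sub (h.density t ht).1).aestronglyMeasurable
      ((h'.density s hs).1.sub (h'.density t ht).1).aestronglyMeasurable le_rfl

theorem MomentumSolution.add (hΩ : IsCompact Ω) (hc : Convex ℝ Ω) (hi : (interior Ω).Nonempty)
    {μ ν : ℝ → Euc d → ℝ} {m n : ℝ × Euc d → Euc d} {f g : ℝ × Euc d → ℝ}
    (h : MomentumSolution Ω μ m f) (h' : MomentumSolution Ω ν n g) :
    MomentumSolution Ω (fun t x => μ t x + ν t x) (fun z => m z + n z) (fun z => f z + g z) where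
  path := h.path.add h'.path
  continuousOn_momentum := h.continuousOn_momentum.add h'.continuousOn_momentum
  integrable_momentum := h.integrable_momentum.add h'.integrable_momentum
  continuous_source := h.continuous_source.add h'.continuous_source
  weak φ hφ := by
    have hK := isCompact_cylinder hΩ
    have i1 := integrableOn_weak_integrand hΩ hc hi hφ (h.path.integrableOn hΩ)
      h.integrable_momentum (h.continuous_source.continuousOn.integrableOn_compact hK)
    have i2 := integrableOn_weak_integrand hΩ hc hi hφ (h'.path.integrableOn hΩ)
      h'.integrable_momentum (h'.continuous_source.continuousOn.integrableOn_compact hK)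
    have h0 : (0 : ℝ) ∈ Icc (0 : ℝ) 1 := by simp
    have h1 : (1 : ℝ) ∈ Icc (0 : ℝ) 1 := by simp
    simp only [mul_add, inner_add_right]
    rw [integral_add ((h.path.density 1 h1).1.continuousOn_mul (hφ.slice h1) hΩ)
        ((h'.path.density 1 h1).1.continuousOn_mul (hφ.slice h1) hΩ),
      integral_add ((h.path.density 0 h0).1.continuousOn_mul (hφ.slice h0) hΩ)
        ((h'.path.density 0 h0).1.continuousOn_mul (hφ.slice h0) hΩ),
      add_sub_add_comm, h.weak φ hφ, h'.weak φ hφ, ← integral_add i1 i2]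
    refine integral_congr_ae (Eventually.of_forall fun z => ?_)
    dsimp only
    ring

theorem measurePreserving_timeReversal :
    MeasurePreserving (fun z : ℝ × Euc d => (1 - z.1, z.2))
      (volume.restrict (cylinder Ω)) (volume.restrict (cylinder Ω)) := by
  rw [volume_restrict_cylinder]
  have h1 : MeasurePreserving (fun t : ℝ => 1 - t) (volume.restrict (Icc (0 : ℝ) 1))
      (volume.restrict (Icc (0 : ℝ) 1)) := by
    have := (Measure.measurePreserving_sub_left (volume : Measure ℝ) 1).restrict_preimage
      (s := Icc (0 : ℝ) 1) measurableSet_Icc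
    simpa using this
  exact h1.prod (MeasurePreserving.id _)

/-- The homeomorphism `(t, x) ↦ (1 - t, x)`. -/
def timeReversal : (ℝ × Euc d) ≃ₜ (ℝ × Euc d) where
  toFun z := (1 - z.1, z.2)
  invFun z := (1 - z.1, z.2)
  left_inv z := by simp
  right_inv z := by simp
  continuous_toFun := by fun_prop
  continuous_invFun := by fun_prop

theorem one_sub_mem_Icc {t : ℝ} (h : t ∈ Icc (0 : ℝ) 1) : 1 - t ∈ Icc (0 : ℝ) 1 := by
  constructor <;> linarith [h.1, h.2]

theorem IsC1.timeReversal {φ : ℝ → Euc d → ℝ} (h : IsC1 Ω φ) : IsC1 Ω (fun t x => φ (1 - t) x) := by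
  have : ContDiff ℝ 1 (fun z : ℝ × Euc d => (1 - z.1, z.2)) := by fun_prop
  exact ContDiffOn.comp h this.contDiffOn (fun z hz => ⟨one_sub_mem_Icc hz.1, hz.2⟩)

theorem dt_timeReversal {φ : ℝ → Euc d → ℝ} (h : IsC1 Ω φ) {t : ℝ} {x : Euc d}
    (ht : t ∈ Icc (0 : ℝ) 1) (hx : x ∈ Ω) :
    dt (fun t x => φ (1 - t) x) t x = - dt φ (1 - t) x := by
  have h0 := hasDerivWithinAt_dt hx (h.hasFDerivWithinAt (z := (1 - t, x)) ⟨one_sub_mem_Icc ht, hx⟩)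
  rw [← dt_eq (one_sub_mem_Icc ht) hx
    (h.hasFDerivWithinAt (z := (1 - t, x)) ⟨one_sub_mem_Icc ht, hx⟩)] at h0
  have h1 : HasDerivWithinAt (fun s : ℝ => 1 - s) (-1) (Icc 0 1) t :=
    (hasDerivWithinAt_id t _).const_sub 1
  have h2 := h0.scomp t h1 (fun s hs => one_sub_mem_Icc hs)
  have h3 := h2.derivWithin (uniqueDiffOn_Icc one_pos t ht)
  simpa [dt, Function.comp_def] using h3

theorem MomentumSolution.timeReversal (hΩ : IsCompact Ω)
    {μ : ℝ → Euc d → ℝ} {m : ℝ × Euc d → Euc d} {f : ℝ × Euc d → ℝ}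
    (h : MomentumSolution Ω μ m f) :
    MomentumSolution Ω (fun t => μ (1 - t)) (fun z => - m (1 - z.1, z.2))
      (fun z => - f (1 - z.1, z.2)) where
  path :=
    { density := fun t ht => h.path.density _ (one_sub_mem_Icc ht)
      continuousOn := h.path.continuousOn.comp (f := fun z : ℝ × Euc d => (1 - z.1, z.2))
        (by fun_prop) (fun z hz => ⟨⟨by linarith [hz.1.2], by linarith [hz.1.1]⟩, hz.2⟩)
      continuous_L1 := fun t ht => by
        refine (h.path.continuous_L1 _ (one_sub_mem_Icc ht)).comp
          (tendsto_nhdsWithin_of_tendsto_nhds_of_eventually_within _ ?_ ?_)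
        · exact (Continuous.tendsto (by fun_prop) t).mono_left nhdsWithin_le_nhds
        · filter_upwards [self_mem_nhdsWithin] with s hs using one_sub_mem_Icc hs }
  continuousOn_momentum := (h.continuousOn_momentum.comp
    (f := fun z : ℝ × Euc d => (1 - z.1, z.2)) (by fun_prop)
      (fun z hz => ⟨⟨by linarith [hz.1.2], by linarith [hz.1.1]⟩, hz.2⟩)).neg
  integrable_momentum :=
    ((measurePreserving_timeReversal.integrable_comp
      h.integrable_momentum.aestronglyMeasurable).2 h.integrable_momentum).neg
  continuous_source := (h.continuous_source.comp (by fun_prop)).neg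
  weak φ hφ := by
    have h1 := h.weak _ hφ.timeReversal
    have e : MeasurableEmbedding (fun z : ℝ × Euc d => (1 - z.1, z.2)) :=
      (UnnormalizedOT.timeReversal (d := d)).measurableEmbedding
    have h2 := measurePreserving_timeReversal (Ω := Ω).integral_comp e
      (fun z => dt (fun t x => φ (1 - t) x) z.1 z.2 * μ z.1 z.2
        + ⟪gradX Ω (fun t x => φ (1 - t) x) z.1 z.2, m z⟫ + φ (1 - z.1) z.2 * f z)
    rw [← h2] at h1
    simp only [sub_self, sub_zero] at h1 ⊢
    rw [← neg_sub, h1, ← integral_neg]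
    refine setIntegral_congr_fun (measurableSet_cylinder hΩ) fun z hz => ?_
    rw [dt_timeReversal hφ (one_sub_mem_Icc hz.1) hz.2]
    simp only [gradX, sub_sub_cancel, inner_neg_right]
    ring

/-- `e` bounds the kinetic energy density `‖m‖² / μ` on the cylinder for `0 < t < 1`. -/
structure EnergyBound (Ω : Set (Euc d)) (μ : ℝ → Euc d → ℝ) (m : ℝ × Euc d → Euc d)
    (e : ℝ × Euc d → ℝ) : Prop where
  density_nonneg : ∀ z ∈ Ioo (0 : ℝ) 1 ×ˢ Ω, 0 ≤ μ z.1 z.2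
  nonneg : ∀ z ∈ Ioo (0 : ℝ) 1 ×ˢ Ω, 0 ≤ e z
  sq_le : ∀ z ∈ Ioo (0 : ℝ) 1 ×ˢ Ω, ‖m z‖ ^ 2 ≤ μ z.1 z.2 * e z

/-- This is the subadditivity of `(μ, m) ↦ ‖m‖² / μ`, which is convex and homogeneous of degree one.
Writing the bound as a product avoids division where the density vanishes. -/
theorem EnergyBound.add {μ ν : ℝ → Euc d → ℝ} {m n : ℝ × Euc d → Euc d} {e e' : ℝ × Euc d → ℝ}
    (h : EnergyBound Ω μ m e) (h' : EnergyBound Ω ν n e') :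
    EnergyBound Ω (fun t x => μ t x + ν t x) (fun z => m z + n z) (fun z => e z + e' z) where
  density_nonneg z hz := add_nonneg (h.density_nonneg z hz) (h'.density_nonneg z hz)
  nonneg z hz := add_nonneg (h.nonneg z hz) (h'.nonneg z hz)
  sq_le z hz := by
    have a1 := h.density_nonneg z hz
    have a2 := h'.density_nonneg z hz
    have b1 := h.nonneg z hz
    have b2 := h'.nonneg z hz
    have c1 := h.sq_le z hz
    have c2 := h'.sq_le z hz
    have h3 : ‖m z + n z‖ ^ 2 ≤ (‖m z‖ + ‖n z‖) ^ 2 :=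
      pow_le_pow_left₀ (norm_nonneg _) (norm_add_le _ _) 2
    -- The cross term: `‖m‖² ‖n‖² ≤ (μ e')(ν e)`, followed by the arithmetic-geometric mean
    -- inequality.
    have h4 : 2 * (‖m z‖ * ‖n z‖) ≤ μ z.1 z.2 * e' z + ν z.1 z.2 * e z := by
      refine abs_le_of_sq_le_sq' ?_ (by positivity) |>.2
      have : (‖m z‖ * ‖n z‖) ^ 2 ≤ (μ z.1 z.2 * e z) * (ν z.1 z.2 * e' z) := by
        rw [mul_pow]; exact mul_le_mul c1 c2 (by positivity) (by positivity)
      nlinarith [sq_nonneg (μ z.1 z.2 * e' z - ν z.1 z.2 * e z)]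
    nlinarith

theorem EnergyBound.timeReversal {μ : ℝ → Euc d → ℝ} {m : ℝ × Euc d → Euc d}
    {e : ℝ × Euc d → ℝ} (h : EnergyBound Ω μ m e) :
    EnergyBound Ω (fun t => μ (1 - t)) (fun z => - m (1 - z.1, z.2))
      (fun z => e (1 - z.1, z.2)) := by
  have hm : ∀ z ∈ Ioo (0 : ℝ) 1 ×ˢ Ω, (1 - z.1, z.2) ∈ Ioo (0 : ℝ) 1 ×ˢ Ω := fun z hz =>
    ⟨⟨by linarith [hz.1.2], by linarith [hz.1.1]⟩, hz.2⟩
  exact ⟨fun z hz => h.density_nonneg _ (hm z hz), fun z hz => h.nonneg _ (hm z hz),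
    fun z hz => by simpa using h.sq_le _ (hm z hz)⟩

/-- The velocity is `m / μ`. Where `μ = 0` the energy bound forces `m = 0`, so the convention `0⁻¹ =
0` still gives `μ v = m`. -/
theorem MomentumSolution.UW2sq_le (hΩ : IsCompact Ω)
    {μ : ℝ → Euc d → ℝ} {m : ℝ × Euc d → Euc d} {f : ℝ × Euc d → ℝ} {e : ℝ × Euc d → ℝ}
    (h : MomentumSolution Ω μ m f) (he : EnergyBound Ω μ m e) (α : ℝ) {μ₀ μ₁ : Euc d → ℝ}
    (h0 : μ 0 =ᵐ[volume.restrict Ω] μ₀) (h1 : μ 1 =ᵐ[volume.restrict Ω] μ₁) :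
    UW2sq α Ω μ₀ μ₁ ≤ (∫⁻ z in cylinder Ω, ENNReal.ofReal (e z)) +
      ENNReal.ofReal (1 / α) * ∫⁻ z in cylinder Ω, ENNReal.ofReal (|f z| ^ 2) := by
  set I : Set (ℝ × Euc d) := Ioo (0 : ℝ) 1 ×ˢ Ω with hI
  have hIm : MeasurableSet I := measurableSet_Ioo.prod hΩ.measurableSet
  have hae : ∀ᵐ z ∂((volume : Measure (ℝ × Euc d)).restrict (cylinder Ω)), z ∈ I := by
    rw [volume_restrict_cylinder_Ioo]; exact ae_restrict_mem hIm
  -- The fields are only known to be continuous on `I`; cutting off by the indicator makes the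
  -- velocity Borel on the whole space.
  set V : ℝ × Euc d → Euc d := fun z =>
    (I.indicator (fun z => μ z.1 z.2) z)⁻¹ • I.indicator m z with hV
  have hVm : Measurable V := by
    classical
    have a1 : Measurable (I.indicator fun z => μ z.1 z.2) := by
      rw [← piecewise_eq_indicator]
      exact ContinuousOn.measurable_piecewise h.path.continuousOn continuousOn_const hIm
    have a2 : Measurable (I.indicator m) := by
      rw [← piecewise_eq_indicator]
      exact ContinuousOn.measurable_piecewise h.continuousOn_momentum continuousOn_const hIm
    exact a1.inv.smul a2
  have hμV : ∀ z ∈ I, μ z.1 z.2 • V z = m z := by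
    intro z hz
    simp only [hV, indicator_of_mem hz]
    by_cases hz0 : μ z.1 z.2 = 0
    · have := he.sq_le z hz
      rw [hz0, zero_mul] at this
      have : ‖m z‖ = 0 := by nlinarith [norm_nonneg (m z)]
      rw [norm_eq_zero.1 this, smul_zero, smul_zero]
    · rw [smul_inv_smul₀ hz0]
  have hVe : ∀ z ∈ I, ‖V z‖ ^ 2 * μ z.1 z.2 ≤ e z := by
    intro z hz
    rcases (he.density_nonneg z hz).eq_or_lt with hz0 | hz0
    · rw [← hz0, mul_zero]; exact he.nonneg z hz
    · have a := he.sq_le z hz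
      rw [← hμV z hz, norm_smul, mul_pow, Real.norm_of_nonneg hz0.le] at a
      refine le_of_mul_le_mul_left ?_ hz0
      nlinarith
  have hadm : Admissible Ω μ₀ μ₁ (fun t x => V (t, x)) μ (fun t x => f (t, x)) :=
    { measurable_velocity := hVm
      measurable_source := h.continuous_source.measurable
      path := h.path
      initial := h0
      terminal := h1
      continuityEq :=
        { integrable_flux := h.integrable_momentum.congr (by
            filter_upwards [hae] with z hz using (hμV z hz).symm)
          integrable_source :=
            h.continuous_source.continuousOn.integrableOn_compact (isCompact_cylinder hΩ)
          weak := fun φ hφ => by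
            rw [h.weak φ hφ]
            refine integral_congr_ae ?_
            filter_upwards [hae] with z hz
            rw [show (z.1, z.2) = z from rfl, hμV z hz] } }
  have hle : UW2sq α Ω μ₀ μ₁ ≤ cost α Ω (fun t x => V (t, x)) μ (fun t x => f (t, x)) :=
    sInf_le ⟨_, _, _, hadm, rfl⟩
  refine hle.trans ?_
  refine add_le_add (lintegral_mono_ae ?_) le_rfl
  filter_upwards [hae] with z hz
  exact ENNReal.ofReal_le_ofReal (hVe z hz)

end Solutions

/-! ### Smearing by contraction plus noise. -/

section Kernel

/-- A continuous probability density supported in `K`. -/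
structure IsBump {X : Type*} [TopologicalSpace X] [MeasureSpace X] (K : Set X) (η : X → ℝ) :
    Prop where
  continuous : Continuous η
  nonneg : ∀ x, 0 ≤ η x
  mem_of_ne_zero : ∀ x, η x ≠ 0 → x ∈ K
  integral_eq_one : ∫ x, η x = 1

theorem exists_isBump {X : Type*} [NormedAddCommGroup X] [InnerProductSpace ℝ X]
    [FiniteDimensional ℝ X] [MeasureSpace X] [BorelSpace X]
    [(volume : Measure X).IsAddHaarMeasure] {K : Set X} (hK : (interior K).Nonempty) :
    ∃ η, IsBump K η := by
  obtain ⟨c, hc⟩ := hK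
  obtain ⟨r, hr, hb⟩ := Metric.isOpen_iff.1 isOpen_interior c hc
  let b : ContDiffBump c := ⟨r / 2, r, by positivity, by linarith⟩
  refine ⟨b.normed volume, b.continuous_normed, b.nonneg_normed, fun x hx => ?_, b.integral_normed⟩
  have : x ∈ Function.support (b.normed volume) := hx
  rw [b.support_normed_eq] at this
  exact interior_subset (hb this)

theorem IsBump.integrable {X : Type*} [TopologicalSpace X] [MeasureSpace X] {K : Set X} {η : X → ℝ}
    (h : IsBump K η) : Integrable η := by
  by_contra h'
  have := h.integral_eq_one
  rw [integral_undef h'] at this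
  exact zero_ne_one this

theorem IsBump.eq_zero {X : Type*} [TopologicalSpace X] [MeasureSpace X] {K : Set X} {η : X → ℝ}
    (h : IsBump K η) {x : X} (hx : x ∉ K) : η x = 0 := by
  by_contra h'
  exact hx (h.mem_of_ne_zero x h')

theorem IsBump.exists_le {X : Type*} [TopologicalSpace X] [MeasureSpace X] {K : Set X} {η : X → ℝ}
    (h : IsBump K η) (hK : IsCompact K) : ∃ M, 0 ≤ M ∧ ∀ x, η x ≤ M := by
  obtain ⟨M, hM⟩ := hK.exists_bound_of_continuousOn h.continuous.continuousOn
  refine ⟨|M|, abs_nonneg _, fun x => ?_⟩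
  by_cases hx : x ∈ K
  · exact (le_abs_self _).trans ((hM x hx).trans (le_abs_self _))
  · rw [h.eq_zero hx]; exact abs_nonneg _

theorem IsBump.setIntegral_smul {X : Type*} [TopologicalSpace X] [MeasureSpace X]
    {K : Set X} {η : X → ℝ} {F : Type*} [NormedAddCommGroup F] [NormedSpace ℝ F]
    (h : IsBump K η) (g : X → F) :
    ∫ x in K, η x • g x = ∫ x, η x • g x :=
  setIntegral_eq_integral_of_forall_compl_eq_zero fun x hx => by simp [h.eq_zero hx]

theorem IsBump.setIntegral_mul {X : Type*} [TopologicalSpace X] [MeasureSpace X]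
    {K : Set X} {η : X → ℝ} (h : IsBump K η) (g : X → ℝ) :
    ∫ x in K, η x * g x = ∫ x, η x * g x := h.setIntegral_smul g

variable {d : ℕ} {Ω : Set (Euc d)} {η : Euc d → ℝ}

/-- The density at `x` of `(1 - σ) z + σ y` when `y` has density `η`. -/
def kern (η : Euc d → ℝ) (σ : ℝ) (z x : Euc d) : ℝ := σ⁻¹ ^ d * η (σ⁻¹ • (x - (1 - σ) • z))

theorem kern_nonneg (h : IsBump Ω η) {σ : ℝ} (hσ : 0 < σ) (z x : Euc d) : 0 ≤ kern η σ z x :=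
  mul_nonneg (by positivity) (h.nonneg _)

theorem exists_of_kern_ne_zero (h : IsBump Ω η) {σ : ℝ} (hσ : 0 < σ) {z x : Euc d}
    (hk : kern η σ z x ≠ 0) : ∃ y ∈ Ω, x = (1 - σ) • z + σ • y := by
  refine ⟨_, h.mem_of_ne_zero _ (right_ne_zero_of_mul hk), ?_⟩
  rw [smul_inv_smul₀ hσ.ne']; abel

theorem mem_of_kern_ne_zero (hc : Convex ℝ Ω) (h : IsBump Ω η) {σ : ℝ} (hσ : 0 < σ)
    (hσ1 : σ ≤ 1) {z x : Euc d} (hz : z ∈ Ω) (hk : kern η σ z x ≠ 0) : x ∈ Ω := by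
  obtain ⟨y, hy, rfl⟩ := exists_of_kern_ne_zero h hσ hk
  exact hc hz hy (by linarith) hσ.le (by ring)

theorem kern_le {M : ℝ} (hM : ∀ x, η x ≤ M) {σ : ℝ} (hσ : 0 < σ)
    (z x : Euc d) : kern η σ z x ≤ σ⁻¹ ^ d * M :=
  mul_le_mul_of_nonneg_left (hM _) (by positivity)

theorem continuousOn_kern (h : IsBump Ω η) :
    ContinuousOn (fun p : ℝ × Euc d × Euc d => kern η p.1 p.2.1 p.2.2) (Ioi 0 ×ˢ univ) := by
  have h1 : ContinuousOn (fun p : ℝ × Euc d × Euc d => p.1⁻¹) (Ioi 0 ×ˢ univ) :=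
    continuousOn_fst.inv₀ fun p hp => (ne_of_gt hp.1)
  exact (h1.pow d).mul (h.continuous.comp_continuousOn (h1.smul (by fun_prop)))

theorem continuous_kern (h : IsBump Ω η) (σ : ℝ) :
    Continuous (fun p : Euc d × Euc d => kern η σ p.1 p.2) := by
  have := h.continuous
  unfold kern
  fun_prop

theorem integral_kern_smul {F : Type*} [NormedAddCommGroup F] [NormedSpace ℝ F]
    (η : Euc d → ℝ) {σ : ℝ} (hσ : 0 < σ) (z : Euc d) (G : Euc d → F) :
    ∫ x, kern η σ z x • G x = ∫ y, η y • G ((1 - σ) • z + σ • y) := by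
  have h1 := Measure.integral_comp_smul (volume : Measure (Euc d))
    (fun x => kern η σ z ((1 - σ) • z + x) • G ((1 - σ) • z + x)) σ
  rw [integral_add_left_eq_self (fun x => kern η σ z x • G x)] at h1
  have h2 : ∀ y, kern η σ z ((1 - σ) • z + σ • y) = σ⁻¹ ^ d * η y := fun y => by
    simp [kern, inv_smul_smul₀ hσ.ne']
  simp only [h2, finrank_euclideanSpace, Fintype.card_fin, mul_smul] at h1
  rw [integral_smul, abs_of_pos (by positivity), ← inv_pow] at h1
  exact (smul_right_injective F (by positivity : σ⁻¹ ^ d ≠ 0) h1).symm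

theorem integral_kern (h : IsBump Ω η) {σ : ℝ} (hσ : 0 < σ) (z : Euc d) :
    ∫ x, kern η σ z x = 1 := by
  have := integral_kern_smul η hσ z (fun _ => (1 : ℝ))
  simpa [h.integral_eq_one] using this

/-- Substitute `z = (1 - σ)⁻¹ (x - σ y)`. The right side no longer contains `σ⁻¹` and stays regular
as `σ → 0`. The Jacobian differs from `1` because the map `z ↦ (1 - σ) z + σ y` contracts. -/
theorem integral_kern_left_smul {F : Type*} [NormedAddCommGroup F] [NormedSpace ℝ F]
    (η : Euc d → ℝ) {σ : ℝ} (hσ : 0 < σ) (hσ1 : σ < 1) (x : Euc d) (G : Euc d → F) :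
    ∫ z, kern η σ z x • G z =
      (1 - σ)⁻¹ ^ d • ∫ y, η y • G ((1 - σ)⁻¹ • (x - σ • y)) := by
  have h1' : 0 < 1 - σ := by linarith
  have h1 := Measure.integral_comp_smul (volume : Measure (Euc d))
    (fun w => kern η σ ((1 - σ)⁻¹ • x - w) x • G ((1 - σ)⁻¹ • x - w)) ((1 - σ)⁻¹ * σ)
  rw [integral_sub_left_eq_self (fun z => kern η σ z x • G z)] at h1
  have h3 : ∀ y : Euc d, (1 - σ)⁻¹ • x - ((1 - σ)⁻¹ * σ) • y = (1 - σ)⁻¹ • (x - σ • y) := fun y => by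
    rw [smul_sub, mul_smul]
  have h2 : ∀ y, kern η σ ((1 - σ)⁻¹ • (x - σ • y)) x = σ⁻¹ ^ d * η y := fun y => by
    simp [kern, inv_smul_smul₀ hσ.ne', smul_inv_smul₀ h1'.ne']
  simp only [h3, h2, finrank_euclideanSpace, Fintype.card_fin] at h1
  simp only [mul_smul] at h1
  rw [integral_smul, abs_of_pos (by positivity), mul_pow, mul_inv, ← inv_pow σ, mul_comm,
    mul_smul] at h1
  have h4 := smul_right_injective F (by positivity : σ⁻¹ ^ d ≠ 0) h1
  rw [h4, smul_smul, inv_pow, inv_inv, inv_mul_cancel₀ (by positivity), one_smul]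

theorem integral_kern_left (h : IsBump Ω η) {σ : ℝ} (hσ : 0 < σ) (hσ1 : σ < 1) (x : Euc d) :
    ∫ z, kern η σ z x = (1 - σ)⁻¹ ^ d := by
  have := integral_kern_left_smul η hσ hσ1 x (fun _ => (1 : ℝ))
  simpa [h.integral_eq_one] using this

theorem integrable_kern (h : IsBump Ω η) {σ : ℝ} (hσ : 0 < σ) (z : Euc d) :
    Integrable (kern η σ z) := by
  by_contra h'
  have := integral_kern h hσ z
  rw [integral_undef h'] at this
  exact zero_ne_one this

theorem lintegral_kern (h : IsBump Ω η) {σ : ℝ} (hσ : 0 < σ) (z : Euc d) :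
    ∫⁻ x, ‖kern η σ z x‖ₑ = 1 := by
  rw [← ofReal_integral_norm_eq_lintegral_enorm (integrable_kern h hσ z)]
  simp only [Real.norm_of_nonneg (kern_nonneg h hσ _ _), integral_kern h hσ, ENNReal.ofReal_one]

/-- Continuity of integrals depending on a parameter, with an integrable weight. -/
theorem continuousOn_integral_smul {P Y F : Type*} [TopologicalSpace P] [FirstCountableTopology P]
    [TopologicalSpace Y] [MeasurableSpace Y] [OpensMeasurableSpace Y] [T2Space Y]
    [SecondCountableTopology Y]
    [NormedAddCommGroup F] [NormedSpace ℝ F] {ν : Measure Y} {K : Set Y} (hK : IsCompact K)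
    {U : Set P} (hU : ∀ p ∈ U, ∃ N ∈ 𝓝[U] p, N ⊆ U ∧ IsCompact N) {h : Y → ℝ}
    (hh : IntegrableOn h K ν) {G : P → Y → F} (hG : ContinuousOn (Function.uncurry G) (U ×ˢ K)) :
    ContinuousOn (fun p => ∫ z in K, h z • G p z ∂ν) U := by
  intro p hp
  obtain ⟨N, hN, hNU, hNc⟩ := hU p hp
  obtain ⟨C, hC⟩ := (hNc.prod hK).exists_bound_of_continuousOn
    (hG.mono (prod_mono hNU Subset.rfl))
  have hs : ∀ q ∈ U, ContinuousOn (G q) K := fun q hq =>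
    hG.comp (f := fun z => (q, z)) (by fun_prop) (fun z hz => ⟨hq, hz⟩)
  refine continuousWithinAt_of_dominated (bound := fun z => |h z| * C) ?_ ?_ ?_ ?_
  · filter_upwards [self_mem_nhdsWithin] with q hq
    exact hh.aestronglyMeasurable.smul ((hs q hq).aestronglyMeasurable hK.measurableSet)
  · filter_upwards [hN] with q hq
    filter_upwards [ae_restrict_mem hK.measurableSet] with z hz
    rw [norm_smul]
    exact mul_le_mul_of_nonneg_left (hC (q, z) ⟨hq, hz⟩) (norm_nonneg _)
  · exact hh.abs.mul_const C
  · filter_upwards [ae_restrict_mem hK.measurableSet] with z hz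
    refine ContinuousWithinAt.const_smul ?_ _
    exact (hG (p, z) ⟨hp, hz⟩).comp (f := fun q => (q, z)) (by fun_prop) (fun q hq => ⟨hq, hz⟩)

theorem exists_compact_nhdsWithin_of_isOpen {P : Type*} [TopologicalSpace P]
    [LocallyCompactSpace P] {U : Set P} (hU : IsOpen U) (p : P) (hp : p ∈ U) :
    ∃ N ∈ 𝓝[U] p, N ⊆ U ∧ IsCompact N := by
  obtain ⟨N, hN, hNU, hc⟩ := local_compact_nhds (hU.mem_nhds hp)
  exact ⟨N, mem_nhdsWithin_of_mem_nhds hN, hNU, hc⟩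

theorem exists_compact_nhdsWithin_of_isCompact {P : Type*} [TopologicalSpace P]
    {U : Set P} (hU : IsCompact U) (p : P) (_ : p ∈ U) :
    ∃ N ∈ 𝓝[U] p, N ⊆ U ∧ IsCompact N :=
  ⟨U, self_mem_nhdsWithin, Subset.rfl, hU⟩

/-- Compactness of `Ω` upgrades joint continuity to uniform convergence of slices, and `Ω` has
finite volume. -/
theorem tendsto_eLpNorm_of_continuousOn (hΩ : IsCompact Ω) {g : ℝ → Euc d → ℝ} {U : Set ℝ}
    (hg : ContinuousOn (Function.uncurry g) (U ×ˢ Ω)) {t : ℝ} (ht : t ∈ U) :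
    Tendsto (fun s => eLpNorm (g s - g t) 1 (volume.restrict Ω)) (𝓝[U] t) (𝓝 0) := by
  rw [ENNReal.tendsto_nhds_zero]
  intro ε hε
  have hfin : volume Ω ≠ ⊤ := hΩ.measure_lt_top.ne
  obtain ⟨δ, hδ, hδε⟩ : ∃ δ : ℝ, 0 < δ ∧ volume Ω * ENNReal.ofReal δ ≤ ε := by
    rcases eq_or_ne ε ⊤ with rfl | hεt
    · exact ⟨1, one_pos, le_top⟩
    · refine ⟨(ε / (volume Ω + 1)).toReal, ENNReal.toReal_pos ?_ ?_, ?_⟩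
      · exact (ENNReal.div_pos hε.ne' (by simp [hfin])).ne'
      · exact ENNReal.div_ne_top hεt (by simp)
      · rw [ENNReal.ofReal_toReal (ENNReal.div_ne_top hεt (by simp))]
        calc volume Ω * (ε / (volume Ω + 1)) ≤ (volume Ω + 1) * (ε / (volume Ω + 1)) := by
              gcongr; exact le_self_add
          _ ≤ ε := ENNReal.mul_div_le
  obtain ⟨v, hv, hv'⟩ := hΩ.mem_uniformity_of_prod hg ht (Metric.dist_mem_uniformity hδ)
  filter_upwards [hv] with s hs
  refine (eLpNorm_le_of_ae_bound (C := δ) ?_).trans ?_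
  · filter_upwards [ae_restrict_mem hΩ.measurableSet] with x hx
    have := hv' s hs x hx
    simp only [mem_ofPred_eq, Real.dist_eq] at this
    exact this.le
  · simpa using hδε

/-- The density of `(1 - σ) z + σ y` when `z` has density `h` on `Ω` and `y` has density `η`. -/
def smear (Ω : Set (Euc d)) (η : Euc d → ℝ) (σ : ℝ) (h : Euc d → ℝ) (x : Euc d) : ℝ :=
  ∫ z in Ω, h z * kern η σ z x

theorem integrable_mul_kern (hη : IsBump Ω η) (hΩ : IsCompact Ω) {σ : ℝ} (hσ : 0 < σ)
    {ν : Measure (Euc d)} {h : Euc d → ℝ} (hh : Integrable h ν) (x : Euc d) :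
    Integrable (fun z => h z * kern η σ z x) ν := by
  obtain ⟨M, -, hM⟩ := hη.exists_le hΩ
  refine hh.mul_bdd (c := σ⁻¹ ^ d * M) ?_ (Eventually.of_forall fun z => ?_)
  · exact Continuous.aestronglyMeasurable ((continuous_kern hη σ).comp (by fun_prop : Continuous fun z => (z, x)))
  · rw [Real.norm_of_nonneg (kern_nonneg hη hσ _ _)]
    exact kern_le hM hσ _ _

/-- Smearing contracts `L¹` by Tonelli, since the kernel has mass one in its second variable. -/
theorem eLpNorm_integral_kern_le (hη : IsBump Ω η) {σ : ℝ} (hσ : 0 < σ)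
    {ν : Measure (Euc d)} [SFinite ν] {h : Euc d → ℝ} (hh : AEStronglyMeasurable h ν) (S : Set (Euc d)) :
    eLpNorm (fun x => ∫ z, h z * kern η σ z x ∂ν) 1 (volume.restrict S) ≤ eLpNorm h 1 ν := by
  simp only [eLpNorm_one_eq_lintegral_enorm]
  calc ∫⁻ x in S, ‖∫ z, h z * kern η σ z x ∂ν‖ₑ
      ≤ ∫⁻ x, ‖∫ z, h z * kern η σ z x ∂ν‖ₑ := setLIntegral_le_lintegral _ _
    _ ≤ ∫⁻ x, ∫⁻ z, ‖h z * kern η σ z x‖ₑ ∂ν :=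
        lintegral_mono fun x => enorm_integral_le_lintegral_enorm _
    _ = ∫⁻ z, (∫⁻ x, ‖h z * kern η σ z x‖ₑ) ∂ν := by
        refine lintegral_lintegral_swap ?_
        refine AEStronglyMeasurable.enorm ?_
        exact hh.comp_snd.mul
          (((continuous_kern hη σ).comp continuous_swap).aestronglyMeasurable)
    _ = ∫⁻ z, ‖h z‖ₑ ∂ν := by
        refine lintegral_congr fun z => ?_
        simp only [enorm_mul]
        rw [lintegral_const_mul' _ _ enorm_ne_top, lintegral_kern hη hσ, mul_one]

/-- Approximate the extension of `h` by zero in `L¹` by a continuous compactly supported `g`.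
Smearing is an `L¹` contraction, so only `g` matters, and for `g` the convergence is uniform on `Ω`.
-/
theorem tendsto_smear (hΩ : IsCompact Ω) (hη : IsBump Ω η) {h : Euc d → ℝ}
    (hh : IntegrableOn h Ω) :
    Tendsto (fun σ => eLpNorm (smear Ω η σ h - h) 1 (volume.restrict Ω)) (𝓝[>] 0) (𝓝 0) := by
  rw [ENNReal.tendsto_nhds_zero]
  intro ε hε
  set H := Ω.indicator h with hH
  have hHi : Integrable H := hh.integrable_indicator hΩ.measurableSet
  obtain ⟨g, hgs, hgε, hgc, hgi⟩ := (memLp_one_iff_integrable.2 hHi).exists_hasCompactSupport_eLpNorm_sub_le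
    ENNReal.one_ne_top (ENNReal.div_pos hε.ne' (by simp : (3 : ℝ≥0∞) ≠ ⊤)).ne'
  rw [memLp_one_iff_integrable] at hgi
  -- For `0 < σ < 1` this is the smearing of `g`, in the substituted form that is continuous through
  -- `σ = 0`, where it equals `g`.
  let Q : ℝ → Euc d → ℝ := fun σ x =>
    (1 - σ)⁻¹ ^ d * ∫ y in Ω, η y • g ((1 - σ)⁻¹ • (x - σ • y))
  have hQ : ContinuousOn (Function.uncurry Q) (Iio 1 ×ˢ Ω) := by
    have hinv : ContinuousOn (fun p : ℝ × Euc d => (1 - p.1)⁻¹) (Iio (1 : ℝ) ×ˢ (univ : Set (Euc d))) :=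
      ContinuousOn.inv₀ (by fun_prop) fun p hp => (sub_pos.2 hp.1).ne'
    refine ContinuousOn.mono (ContinuousOn.mul (hinv.pow d) ?_) (prod_mono Subset.rfl (subset_univ _))
    refine continuousOn_integral_smul (P := ℝ × Euc d) hΩ
      (exists_compact_nhdsWithin_of_isOpen (isOpen_Iio.prod isOpen_univ)) hη.integrable.integrableOn
      (G := fun p y => g ((1 - p.1)⁻¹ • (p.2 - p.1 • y))) ?_
    have h1 : ContinuousOn (fun q : (ℝ × Euc d) × Euc d => (1 - q.1.1)⁻¹)
        ((Iio (1 : ℝ) ×ˢ univ) ×ˢ Ω) :=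
      hinv.comp (f := fun q : (ℝ × Euc d) × Euc d => q.1) continuousOn_fst
        fun q hq => ⟨hq.1.1, mem_univ _⟩
    have h2 : ContinuousOn (fun q : (ℝ × Euc d) × Euc d => q.1.2 - q.1.1 • q.2)
        ((Iio (1 : ℝ) ×ˢ univ) ×ˢ Ω) := by fun_prop
    exact hgc.comp_continuousOn (h1.smul h2)
  have hQ0 : Q 0 = g := by
    ext x
    simp only [Q, sub_zero, inv_one, one_pow, one_mul, zero_smul, one_smul]
    rw [hη.setIntegral_smul]
    simp only [smul_eq_mul]
    rw [integral_mul_const, hη.integral_eq_one, one_mul]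
  have hlim := tendsto_eLpNorm_of_continuousOn hΩ hQ (t := 0) (by simp)
  rw [nhdsWithin_eq_nhds.2 (isOpen_Iio.mem_nhds (by simp))] at hlim
  have hev := (hlim.mono_left (nhdsWithin_le_nhds (s := Ioi 0)))
  rw [ENNReal.tendsto_nhds_zero] at hev
  filter_upwards [hev (ε / 3) (ENNReal.div_pos hε.ne' (by simp)), self_mem_nhdsWithin,
    mem_nhdsWithin_of_mem_nhds (isOpen_Iio.mem_nhds (by simp : (0 : ℝ) < 1))] with σ h1 hσ hσ1
  have hσ0 : 0 < σ := hσ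
  rw [hQ0] at h1
  have hQσ : Q σ = fun x => ∫ z, g z * kern η σ z x := by
    ext x
    simp only [Q]
    rw [hη.setIntegral_smul, ← smul_eq_mul, ← integral_kern_left_smul η hσ0 hσ1 x]
    simp [mul_comm]
  have hsm : smear Ω η σ h = fun x => ∫ z, H z * kern η σ z x := by
    ext x
    rw [smear, ← integral_indicator hΩ.measurableSet]
    refine integral_congr_ae (Eventually.of_forall fun z => ?_)
    simp only [hH, indicator_mul_left]
  have hd : (smear Ω η σ h - h) =ᵐ[volume.restrict Ω]
      ((fun x => ∫ z, (H - g) z * kern η σ z x) + ((Q σ - g) + (g - H))) := by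
    filter_upwards [ae_restrict_mem hΩ.measurableSet] with x hx
    have e1 : H x = h x := by rw [hH, indicator_of_mem hx]
    have e2 : ∫ z, (H - g) z * kern η σ z x =
        (∫ z, H z * kern η σ z x) - ∫ z, g z * kern η σ z x := by
      simp only [Pi.sub_apply, sub_mul]
      exact integral_sub (integrable_mul_kern hη hΩ hσ0 hHi x)
        (integrable_mul_kern hη hΩ hσ0 hgi x)
    simp only [Pi.sub_apply, Pi.add_apply] at e2 ⊢
    rw [e2, hsm, hQσ, e1]
    ring
  have hQm : AEStronglyMeasurable (Q σ - g) (volume.restrict Ω) := by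
    refine AEStronglyMeasurable.sub ?_ hgc.aestronglyMeasurable
    exact (hQ.comp (f := fun x => (σ, x)) (by fun_prop) fun x hx => ⟨hσ1, hx⟩).aestronglyMeasurable
      hΩ.measurableSet
  have hPm : AEStronglyMeasurable (fun x => ∫ z, (H - g) z * kern η σ z x) (volume.restrict Ω) := by
    refine AEStronglyMeasurable.integral_prod_right' (f := fun p : Euc d × Euc d =>
      (H - g) p.2 * kern η σ p.2 p.1) ?_
    exact (hHi.sub hgi).aestronglyMeasurable.comp_snd.mul
      ((continuous_kern hη σ).comp continuous_swap).aestronglyMeasurable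
  have hgH : AEStronglyMeasurable (g - H) (volume.restrict Ω) :=
    (hgi.sub hHi).aestronglyMeasurable.restrict
  rw [eLpNorm_congr_ae hd]
  calc _ ≤ ε / 3 + (ε / 3 + ε / 3) := by
        refine (eLpNorm_add_le hPm (hQm.add hgH) le_rfl).trans (add_le_add ?_
          ((eLpNorm_add_le hQm hgH le_rfl).trans (add_le_add h1 ?_)))
        · exact (eLpNorm_integral_kern_le hη hσ0 (hHi.sub hgi).aestronglyMeasurable Ω).trans hgε
        · refine (eLpNorm_mono_measure _ Measure.restrict_le_self).trans ?_
          rw [← eLpNorm_neg, neg_sub]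
          exact hgε
    _ = ε := by rw [← add_assoc]; exact ENNReal.add_thirds ε

end Kernel

/-! ### The departing flow: densities, momenta and size of the energy. -/

section Departure

theorem integrable_mul_of_continuousOn {X Y : Type*} [TopologicalSpace X] [MeasurableSpace X]
    [BorelSpace X] [T2Space X] [SecondCountableTopology X] [TopologicalSpace Y] [MeasurableSpace Y]
    [BorelSpace Y] [T2Space Y] [SecondCountableTopology Y] {ν : Measure X} {ν' : Measure Y}
    [IsFiniteMeasureOnCompacts ν] [SFinite ν] [SFinite ν'] {K : Set X} {K' : Set Y}
    (hK : IsCompact K) (hK' : IsCompact K') {h : Y → ℝ} (hh : IntegrableOn h K' ν') {G : X → Y → ℝ}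
    (hG : ContinuousOn (Function.uncurry G) (K ×ˢ K')) :
    Integrable (fun p : X × Y => h p.2 * G p.1 p.2) ((ν.restrict K).prod (ν'.restrict K')) := by
  have : IsFiniteMeasure (ν.restrict K) := ⟨by simpa using hK.measure_lt_top⟩
  have h1 : Integrable (fun p : X × Y => h p.2) ((ν.restrict K).prod (ν'.restrict K')) :=
    Integrable.comp_snd hh _
  rw [Measure.prod_restrict] at h1 ⊢
  have := IntegrableOn.continuousOn_mul hG h1 (hK.prod hK')
  refine this.congr (Eventually.of_forall fun p => ?_)
  simp [Function.uncurry, mul_comm]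

variable {d : ℕ} {Ω : Set (Euc d)} {η : Euc d → ℝ}

/-- Fubini turns an Eulerian integral in `x` into an expectation over start points `z` and targets
`y`. By convexity the kernel of a point of `Ω` lives in `Ω`, so restricting `x` to `Ω` loses
nothing. -/
theorem integral_kern_pairing (hΩ : IsCompact Ω) (hc : Convex ℝ Ω) (hη : IsBump Ω η) {σ : ℝ}
    (hσ : 0 < σ) (hσ1 : σ ≤ 1) {h : Euc d → ℝ} (hh : IntegrableOn h Ω) {P : Euc d → Euc d → ℝ}
    (hP : ContinuousOn (Function.uncurry P) (Ω ×ˢ Ω)) :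
    ∫ x in Ω, ∫ z in Ω, h z * (kern η σ z x * P x z) =
      ∫ z in Ω, h z * ∫ y in Ω, η y * P ((1 - σ) • z + σ • y) z := by
  have hi := integrable_mul_of_continuousOn (ν := volume) hΩ hΩ hh (G := fun x z => kern η σ z x * P x z)
    (ContinuousOn.mul ((continuous_kern hη σ).comp continuous_swap).continuousOn hP)
  rw [integral_integral_swap hi]
  refine setIntegral_congr_fun hΩ.measurableSet fun z hz => ?_
  rw [integral_const_mul]
  congr 1
  rw [setIntegral_eq_integral_of_forall_compl_eq_zero, hη.setIntegral_mul]
  · exact integral_kern_smul η hσ z (fun x => P x z)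
  · intro x hx
    by_contra h'
    exact hx (mem_of_kern_ne_zero hc hη hσ hσ1 hz (left_ne_zero_of_mul h'))

theorem smear_nonneg (hη : IsBump Ω η) {σ : ℝ} (hσ : 0 < σ) {h : Euc d → ℝ}
    (h0 : ∀ᵐ x ∂(volume.restrict Ω), 0 ≤ h x) (x : Euc d) : 0 ≤ smear Ω η σ h x :=
  integral_nonneg_of_ae (by filter_upwards [h0] with z hz using mul_nonneg hz (kern_nonneg hη hσ _ _))

theorem continuous_smear (hΩ : IsCompact Ω) (hη : IsBump Ω η) (σ : ℝ) {h : Euc d → ℝ}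
    (hh : IntegrableOn h Ω) : Continuous (smear Ω η σ h) := by
  rw [← continuousOn_univ]
  exact continuousOn_integral_smul hΩ (exists_compact_nhdsWithin_of_isOpen isOpen_univ) hh
    (G := fun x z => kern η σ z x) ((continuous_kern hη σ).comp continuous_swap).continuousOn

/-- The mass remaining at time `t` when mass is removed with rate density `k`. -/
def timeWeight (k : ℝ → ℝ) (t : ℝ) : ℝ := 1 - ∫ u in (0 : ℝ)..t, k u

theorem hasDerivAt_timeWeight {k : ℝ → ℝ} (hk : Continuous k) (t : ℝ) :
    HasDerivAt (timeWeight k) (-k t) t :=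
  (hk.integral_hasStrictDerivAt 0 t).hasDerivAt.const_sub 1

theorem continuous_timeWeight {k : ℝ → ℝ} (hk : Continuous k) : Continuous (timeWeight k) :=
  continuous_iff_continuousAt.2 fun t => (hasDerivAt_timeWeight hk t).continuousAt

theorem timeWeight_zero (k : ℝ → ℝ) : timeWeight k 0 = 1 := by simp [timeWeight]

theorem timeWeight_eq_zero {k : ℝ → ℝ} {a b : ℝ} (hk : IsBump (Icc a b) k) (ha : 0 < a)
    {t : ℝ} (ht : 0 ≤ t) (hb : b ≤ t) : timeWeight k t = 0 := by
  rw [timeWeight, intervalIntegral.integral_of_le ht, setIntegral_eq_integral_of_forall_compl_eq_zero,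
    hk.integral_eq_one, sub_self]
  intro u hu
  refine hk.eq_zero fun hu' => hu ⟨ha.trans_le hu'.1, hu'.2.trans hb⟩

theorem timeWeight_nonneg {k : ℝ → ℝ} {K : Set ℝ} (hk : IsBump K k) {t : ℝ} (ht : 0 ≤ t) :
    0 ≤ timeWeight k t := by
  rw [timeWeight, intervalIntegral.integral_of_le ht, sub_nonneg, ← hk.integral_eq_one]
  exact setIntegral_le_integral hk.integrable (Eventually.of_forall hk.nonneg)

theorem timeWeight_le_one {k : ℝ → ℝ} {K : Set ℝ} (hk : IsBump K k) {t : ℝ} (ht : 0 ≤ t) :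
    timeWeight k t ≤ 1 := by
  rw [timeWeight, sub_le_self_iff]
  exact intervalIntegral.integral_nonneg ht fun u _ => hk.nonneg u

/-- A smooth function increasing from `0` at time `0` to `s` at time `s / 3`. -/
def ramp (s t : ℝ) : ℝ := s * Real.smoothTransition (3 / s * t)

theorem contDiff_smoothTransition : ContDiff ℝ 1 Real.smoothTransition := by
  exact_mod_cast Real.smoothTransition.contDiff (n := 1)

theorem hasDerivAt_ramp {s : ℝ} (hs : 0 < s) (t : ℝ) :
    HasDerivAt (ramp s) (3 * deriv Real.smoothTransition (3 / s * t)) t := by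
  have h1 : HasDerivAt (fun t : ℝ => 3 / s * t) (3 / s) t := by
    simpa using (hasDerivAt_id t).const_mul (3 / s)
  have h2 := ((contDiff_smoothTransition.differentiable (by norm_num)) (3 / s * t)).hasDerivAt
  refine ((h2.comp t h1).const_mul s).congr_deriv ?_
  field_simp

theorem continuous_ramp (s : ℝ) : Continuous (ramp s) := by
  have := Real.smoothTransition.continuous
  unfold ramp
  fun_prop

theorem ramp_pos {s t : ℝ} (hs : 0 < s) (ht : 0 < t) : 0 < ramp s t :=
  mul_pos hs (Real.smoothTransition.pos_of_pos (by positivity))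

theorem ramp_nonneg {s : ℝ} (hs : 0 < s) (t : ℝ) : 0 ≤ ramp s t :=
  mul_nonneg hs.le (Real.smoothTransition.nonneg _)

theorem ramp_le {s : ℝ} (hs : 0 < s) (t : ℝ) : ramp s t ≤ s := by
  simpa [ramp] using mul_le_mul_of_nonneg_left (Real.smoothTransition.le_one (3 / s * t)) hs.le

theorem ramp_zero (s : ℝ) : ramp s 0 = 0 := by simp [ramp]

theorem ramp_eq {s t : ℝ} (hs : 0 < s) (ht : s / 3 ≤ t) : ramp s t = s := by
  rw [ramp, Real.smoothTransition.one_of_one_le, mul_one]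
  rw [div_mul_eq_mul_div, le_div_iff₀ hs]; linarith

/-- The density of particles leaving `h`, moving along straight lines towards points distributed
according to `η`, and removed at rate `k`. -/
def departDensity (Ω : Set (Euc d)) (η : Euc d → ℝ) (k : ℝ → ℝ) (s : ℝ) (h : Euc d → ℝ) (t : ℝ)
    (x : Euc d) : ℝ :=
  if t = 0 then h x else timeWeight k t * smear Ω η (ramp s t) h x

/-- The momentum density belonging to `departDensity`. -/
def departMomentum (Ω : Set (Euc d)) (η : Euc d → ℝ) (k : ℝ → ℝ) (s : ℝ) (h : Euc d → ℝ)
    (p : ℝ × Euc d) : Euc d :=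
  (timeWeight k p.1 * (3 * deriv Real.smoothTransition (3 / s * p.1))) •
    ∫ z in Ω, h z • (kern η (ramp s p.1) z p.2 • ((ramp s p.1)⁻¹ • (p.2 - z)))

theorem continuousOn_departDensity (hΩ : IsCompact Ω) (hη : IsBump Ω η) {k : ℝ → ℝ}
    (hk : Continuous k) {s : ℝ} (hs : 0 < s) {h : Euc d → ℝ} (hh : IntegrableOn h Ω) :
    ContinuousOn (Function.uncurry (departDensity Ω η k s h)) (Ioi 0 ×ˢ univ) := by
  have h1 : ContinuousOn (fun p : ℝ × Euc d => timeWeight k p.1 * smear Ω η (ramp s p.1) h p.2)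
      (Ioi 0 ×ˢ univ) := by
    refine ((continuous_timeWeight hk).comp continuous_fst).continuousOn.mul ?_
    refine continuousOn_integral_smul (P := ℝ × Euc d) hΩ
      (exists_compact_nhdsWithin_of_isOpen (isOpen_Ioi.prod isOpen_univ)) hh
      (G := fun p z => kern η (ramp s p.1) z p.2) ?_
    have := continuous_ramp s
    exact (continuousOn_kern hη).comp
      (f := fun q : (ℝ × Euc d) × Euc d => (ramp s q.1.1, q.2, q.1.2)) (by fun_prop)
      fun q hq => ⟨ramp_pos hs hq.1.1, mem_univ _⟩
  refine h1.congr fun p hp => ?_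
  simp only [Function.uncurry, departDensity]
  rw [if_neg (ne_of_gt hp.1)]

theorem continuousOn_departMomentum (hΩ : IsCompact Ω) (hη : IsBump Ω η) {k : ℝ → ℝ}
    (hk : Continuous k) {s : ℝ} (hs : 0 < s) {h : Euc d → ℝ} (hh : IntegrableOn h Ω) :
    ContinuousOn (departMomentum Ω η k s h) (Ioi 0 ×ˢ univ) := by
  have hd : Continuous (deriv Real.smoothTransition) :=
    contDiff_smoothTransition.continuous_deriv le_rfl
  have hw := continuous_timeWeight hk
  have h1 : Continuous fun p : ℝ × Euc d =>
      timeWeight k p.1 * (3 * deriv Real.smoothTransition (3 / s * p.1)) := by fun_prop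
  refine h1.continuousOn.smul ?_
  refine continuousOn_integral_smul (P := ℝ × Euc d) hΩ
      (exists_compact_nhdsWithin_of_isOpen (isOpen_Ioi.prod isOpen_univ)) hh
      (G := fun p z => kern η (ramp s p.1) z p.2 • ((ramp s p.1)⁻¹ • (p.2 - z))) ?_
  have hr := continuous_ramp s
  have h2 : Continuous fun q : (ℝ × Euc d) × Euc d => q.1.2 - q.2 := by fun_prop
  have h3 : ContinuousOn (fun q : (ℝ × Euc d) × Euc d => (ramp s q.1.1)⁻¹)
      ((Ioi (0 : ℝ) ×ˢ univ) ×ˢ Ω) :=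
    ContinuousOn.inv₀ (by fun_prop) fun q hq => (ramp_pos hs hq.1.1).ne'
  have h4 : ContinuousOn (fun q : (ℝ × Euc d) × Euc d => kern η (ramp s q.1.1) q.2 q.1.2)
      ((Ioi (0 : ℝ) ×ˢ univ) ×ˢ Ω) :=
    (continuousOn_kern hη).comp
      (f := fun q : (ℝ × Euc d) × Euc d => (ramp s q.1.1, q.2, q.1.2)) (by fun_prop)
      fun q hq => ⟨ramp_pos hs hq.1.1, mem_univ _⟩
  exact h4.smul (h3.smul h2.continuousOn)

theorem departDensity_nonneg (hη : IsBump Ω η) {k : ℝ → ℝ} {K : Set ℝ} (hk : IsBump K k)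
    {s : ℝ} (hs : 0 < s) {h : Euc d → ℝ} (h0 : ∀ᵐ x ∂(volume.restrict Ω), 0 ≤ h x)
    {t : ℝ} (ht : 0 < t) (x : Euc d) : 0 ≤ departDensity Ω η k s h t x := by
  rw [departDensity, if_neg ht.ne']
  exact mul_nonneg (timeWeight_nonneg hk ht.le) (smear_nonneg hη (ramp_pos hs ht) h0 x)

/-- For `t > 0` everything is jointly continuous. At `t = 0` the kernel degenerates and the value is
set to `h` by hand; continuity there is the `L¹` convergence of `tendsto_smear` together with
`timeWeight k t → 1`. -/
theorem isDensityPath_departDensity (hΩ : IsCompact Ω) (hη : IsBump Ω η) {k : ℝ → ℝ} {K : Set ℝ}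
    (hk : IsBump K k) {s : ℝ} (hs : 0 < s) {h : Euc d → ℝ} (hh : IsDensity Ω h) :
    IsDensityPath Ω (departDensity Ω η k s h) where
  density t ht := by
    rcases ht.1.eq_or_lt with rfl | ht0
    · have : departDensity Ω η k s h 0 = h := by ext x; simp [departDensity]
      rwa [this]
    · refine ⟨?_, Eventually.of_forall (departDensity_nonneg hη hk hs hh.2 ht0)⟩
      refine ContinuousOn.integrableOn_compact hΩ ?_
      exact (continuousOn_departDensity hΩ hη hk.continuous hs hh.1).comp (f := fun x => (t, x))
        (Continuous.continuousOn (by fun_prop)) fun x _ => ⟨ht0, mem_univ _⟩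
  continuousOn := (continuousOn_departDensity hΩ hη hk.continuous hs hh.1).mono
    (prod_mono (fun t ht => ht.1) (subset_univ _))
  continuous_L1 t ht := by
    rcases ht.1.eq_or_lt with rfl | ht0
    · have e0 : departDensity Ω η k s h 0 = h := by ext x; simp [departDensity]
      rw [e0]
      refine Tendsto.mono_left ?_ (nhdsWithin_mono _ Icc_subset_Ici_self)
      rw [← Ioi_insert, nhdsWithin_insert, tendsto_sup]
      constructor
      · rw [tendsto_pure_left]
        intro S hS
        rw [e0, sub_self, eLpNorm_zero]
        exact mem_of_mem_nhds hS
      · have hw : Tendsto (timeWeight k) (𝓝[>] 0) (𝓝 1) := by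
          have := (continuous_timeWeight hk.continuous).tendsto 0
          rw [timeWeight_zero] at this
          exact this.mono_left nhdsWithin_le_nhds
        have hr : Tendsto (ramp s) (𝓝[>] 0) (𝓝[>] 0) := by
          refine tendsto_nhdsWithin_of_tendsto_nhds_of_eventually_within _ ?_ ?_
          · have := (continuous_ramp s).tendsto 0
            rw [ramp_zero] at this
            exact this.mono_left nhdsWithin_le_nhds
          · filter_upwards [self_mem_nhdsWithin] with t ht using ramp_pos hs ht
        have l1 := (tendsto_smear hΩ hη hh.1).comp hr
        have l2 : Tendsto (fun t => ‖timeWeight k t - 1‖ₑ) (𝓝[>] 0) (𝓝 0) := by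
          have := (continuous_enorm.tendsto (0 : ℝ)).comp (by simpa using hw.sub_const 1)
          simpa [Function.comp_def] using this
        have l3 : Tendsto (fun t => ‖timeWeight k t‖ₑ) (𝓝[>] 0) (𝓝 1) := by
          have := (continuous_enorm.tendsto (1 : ℝ)).comp hw
          simpa [Function.comp_def] using this
        have hfin : eLpNorm h 1 (volume.restrict Ω) ≠ ⊤ :=
          (memLp_one_iff_integrable.2 hh.1).eLpNorm_lt_top.ne
        have l4 := (ENNReal.Tendsto.mul l3 (Or.inl one_ne_zero) l1 (Or.inr ENNReal.one_ne_top)).add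
          (ENNReal.Tendsto.mul_const l2 (b := eLpNorm h 1 (volume.restrict Ω)) (Or.inr hfin))
        rw [mul_zero, zero_mul, add_zero] at l4
        refine tendsto_of_tendsto_of_tendsto_of_le_of_le' tendsto_const_nhds l4
          (Eventually.of_forall fun _ => zero_le) ?_
        filter_upwards [self_mem_nhdsWithin] with t ht
        have ht0 : 0 < t := ht
        have e : departDensity Ω η k s h t - h = timeWeight k t • (smear Ω η (ramp s t) h - h) +
            (timeWeight k t - 1) • h := by
          ext x
          simp [departDensity, ht0.ne']
          ring
        have m1 : AEStronglyMeasurable (smear Ω η (ramp s t) h - h) (volume.restrict Ω) :=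
          (continuous_smear hΩ hη _ hh.1).aestronglyMeasurable.sub hh.1.aestronglyMeasurable
        rw [e]
        refine (eLpNorm_add_le (m1.const_smul _) (hh.1.aestronglyMeasurable.const_smul _)
          le_rfl).trans ?_
        rw [eLpNorm_const_smul, eLpNorm_const_smul]
        rfl
    · have := tendsto_eLpNorm_of_continuousOn hΩ
        ((continuousOn_departDensity hΩ hη hk.continuous hs hh.1).mono
          (prod_mono Subset.rfl (subset_univ Ω))) (t := t) ht0
      rw [nhdsWithin_eq_nhds.2 (isOpen_Ioi.mem_nhds ht0)] at this
      exact this.mono_left nhdsWithin_le_nhds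

/-- The speed of the departing particles is bounded uniformly in `s`. -/
theorem exists_norm_departMomentum_le (hΩ : IsCompact Ω) (hη : IsBump Ω η) {h : Euc d → ℝ}
    (hh : IsDensity Ω h) :
    ∃ R : ℝ, 0 ≤ R ∧ ∀ s > 0, ∀ k, IsBump (Icc (s / 3) (2 * s / 3)) k → ∀ t > 0, ∀ x ∈ Ω,
      ‖departMomentum Ω η k s h (t, x)‖ ≤ R * departDensity Ω η k s h t x := by
  have hd : Continuous (deriv Real.smoothTransition) :=
    contDiff_smoothTransition.continuous_deriv le_rfl
  -- Only arguments `3 t / s` with `t < 2 s / 3` matter, since the weight vanishes later. The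
  -- distance is of order `s` and the time `s / 3`, so `s` cancels in the speed.
  obtain ⟨C, hC⟩ := (isCompact_Icc (a := (0 : ℝ)) (b := 3)).exists_bound_of_continuousOn
    hd.continuousOn
  refine ⟨3 * |C| * Metric.diam Ω, by positivity, fun s hs k hk t ht x _ => ?_⟩
  have hw0 := timeWeight_nonneg hk ht.le
  have hσ := ramp_pos hs ht
  have hdens : departDensity Ω η k s h t x = timeWeight k t * smear Ω η (ramp s t) h x := by
    rw [departDensity, if_neg ht.ne']
  rcases le_or_gt (2 * s / 3) t with hts | hts
  · have hw := timeWeight_eq_zero hk (by positivity) ht.le hts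
    simp [departMomentum, hdens, hw]
  · have h1 : |3 * deriv Real.smoothTransition (3 / s * t)| ≤ 3 * |C| := by
      rw [abs_mul, abs_of_pos (by norm_num : (0 : ℝ) < 3)]
      refine mul_le_mul_of_nonneg_left ((hC _ ⟨by positivity, ?_⟩).trans (le_abs_self _)) (by norm_num)
      rw [div_mul_eq_mul_div, div_le_iff₀ hs]
      linarith
    have h2 : ‖∫ z in Ω, h z • (kern η (ramp s t) z x • ((ramp s t)⁻¹ • (x - z)))‖ ≤
        Metric.diam Ω * smear Ω η (ramp s t) h x := by
      rw [smear, ← integral_const_mul]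
      refine norm_integral_le_of_norm_le ((integrable_mul_kern hη hΩ hσ hh.1 x).const_mul _) ?_
      filter_upwards [hh.2, ae_restrict_mem hΩ.measurableSet] with z hz hzΩ
      rw [norm_smul, norm_smul, Real.norm_of_nonneg hz,
        Real.norm_of_nonneg (kern_nonneg hη hσ _ _)]
      by_cases hk0 : kern η (ramp s t) z x = 0
      · simp [hk0]
      -- On the support of the kernel `x` is reached from `z` towards some `y ∈ Ω`, so `(x - z) /
      -- ramp` equals `y - z` and is bounded by the diameter.
      · obtain ⟨y, hy, rfl⟩ := exists_of_kern_ne_zero hη hσ hk0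
        have e : (ramp s t)⁻¹ • ((1 - ramp s t) • z + ramp s t • y - z) = y - z := by
          rw [show (1 - ramp s t) • z + ramp s t • y - z = ramp s t • (y - z) by
            rw [sub_smul, smul_sub, one_smul]; abel, inv_smul_smul₀ hσ.ne']
        rw [e, ← dist_eq_norm, mul_comm (Metric.diam Ω), ← mul_assoc]
        exact mul_le_mul_of_nonneg_left (Metric.dist_le_diam_of_mem hΩ.isBounded hy hzΩ)
          (mul_nonneg hz (kern_nonneg hη hσ _ _))
    rw [departMomentum, norm_smul, norm_mul, Real.norm_of_nonneg hw0, Real.norm_eq_abs, hdens]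
    calc timeWeight k t * |3 * deriv Real.smoothTransition (3 / s * t)| * _
        ≤ timeWeight k t * (3 * |C|) * (Metric.diam Ω * smear Ω η (ramp s t) h x) := by
          gcongr
      _ = _ := by ring

theorem departDensity_eq_zero {k : ℝ → ℝ} {s : ℝ} (hs : 0 < s)
    (hk : IsBump (Icc (s / 3) (2 * s / 3)) k) (h : Euc d → ℝ) {t : ℝ} (ht : s ≤ t) (x : Euc d) :
    departDensity Ω η k s h t x = 0 := by
  rw [departDensity, if_neg (by linarith), timeWeight_eq_zero hk (by positivity) (by linarith)
    (by linarith), zero_mul]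

/-- The mass never exceeds that of `h`, and nothing is left after time `s`. This is the source of
the factor `s` in the energy. -/
theorem lintegral_departDensity_le (hΩ : IsCompact Ω) (hη : IsBump Ω η) {k : ℝ → ℝ} {s : ℝ}
    (hs : 0 < s) (hk : IsBump (Icc (s / 3) (2 * s / 3)) k) {h : Euc d → ℝ} (hh : IsDensity Ω h) :
    ∫⁻ p in cylinder Ω, ENNReal.ofReal (departDensity Ω η k s h p.1 p.2) ≤
      ENNReal.ofReal s * eLpNorm h 1 (volume.restrict Ω) := by
  have hm := aestronglyMeasurable_of_continuousOn_Ioo hΩ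
    (isDensityPath_departDensity hΩ hη hk hs hh).continuousOn
  rw [volume_restrict_cylinder] at hm ⊢
  have hm' : AEMeasurable (fun p : ℝ × Euc d => ENNReal.ofReal (departDensity Ω η k s h p.1 p.2))
      ((volume.restrict (Icc (0 : ℝ) 1)).prod (volume.restrict Ω)) :=
    hm.aemeasurable.ennreal_ofReal
  rw [lintegral_prod _ hm']
  calc ∫⁻ t in Icc (0 : ℝ) 1, ∫⁻ x in Ω, ENNReal.ofReal (departDensity Ω η k s h t x)
      ≤ ∫⁻ t in Icc (0 : ℝ) 1, (Icc 0 s).indicator (fun _ => eLpNorm h 1 (volume.restrict Ω)) t := by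
        refine lintegral_mono_ae ?_
        filter_upwards [ae_restrict_mem measurableSet_Icc] with t ht
        by_cases hts : t ≤ s
        · rw [indicator_of_mem (show t ∈ Icc 0 s from ⟨ht.1, hts⟩)]
          rcases ht.1.eq_or_lt with rfl | ht0
          · rw [eLpNorm_one_eq_lintegral_enorm]
            refine lintegral_mono fun x => ?_
            simp only [departDensity, if_true]
            rw [Real.enorm_eq_ofReal_abs]
            exact ENNReal.ofReal_le_ofReal (le_abs_self _)
          · refine le_trans ?_ (eLpNorm_integral_kern_le hη (ramp_pos hs ht0)
              hh.1.aestronglyMeasurable Ω)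
            rw [eLpNorm_one_eq_lintegral_enorm]
            refine lintegral_mono fun x => ?_
            simp only
            rw [Real.enorm_eq_ofReal_abs]
            refine ENNReal.ofReal_le_ofReal ?_
            rw [departDensity, if_neg ht0.ne']
            have h0 := smear_nonneg hη (ramp_pos hs ht0) hh.2 x
            exact (mul_le_of_le_one_left h0 (timeWeight_le_one hk ht0.le)).trans (le_abs_self _)
        · simp [departDensity_eq_zero hs hk h (not_le.1 hts).le]
    _ ≤ ∫⁻ t, (Icc 0 s).indicator (fun _ => eLpNorm h 1 (volume.restrict Ω)) t :=
        setLIntegral_le_lintegral _ _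
    _ = ENNReal.ofReal s * eLpNorm h 1 (volume.restrict Ω) := by
        rw [lintegral_indicator measurableSet_Icc]
        simp [mul_comm]

end Departure

/-! ### The departing flow solves the continuity equation. -/

section DepartureWeak

variable {d : ℕ} {Ω : Set (Euc d)} {η : Euc d → ℝ}

/-- The position at time `t` of a particle travelling from `z` to `(1 - s) z + s y`. -/
def ray (s t : ℝ) (z y : Euc d) : Euc d := (1 - ramp s t) • z + ramp s t • y

theorem ray_mem (hc : Convex ℝ Ω) {s : ℝ} (hs : 0 < s) (hs1 : s < 1) (t : ℝ) {z y : Euc d}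
    (hz : z ∈ Ω) (hy : y ∈ Ω) : ray s t z y ∈ Ω :=
  hc hz hy (by linarith [ramp_le hs t]) (ramp_nonneg hs t) (by ring)

theorem hasDerivAt_ray {s : ℝ} (hs : 0 < s) (t : ℝ) (z y : Euc d) :
    HasDerivAt (fun t => ray s t z y)
      ((3 * deriv Real.smoothTransition (3 / s * t)) • (y - z)) t := by
  have h := hasDerivAt_ramp hs t
  refine (((h.const_sub 1).smul_const z).add (h.smul_const y)).congr_deriv ?_
  rw [neg_smul, smul_sub]; abel

/-- The derivative of `timeWeight k t * φ t (ray s t z y)` in `t`. -/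
def rayRate (Ω : Set (Euc d)) (φ : ℝ → Euc d → ℝ) (k : ℝ → ℝ) (s t : ℝ) (z y : Euc d) : ℝ :=
  timeWeight k t * (dt φ t (ray s t z y) + ⟪gradX Ω φ t (ray s t z y),
    (3 * deriv Real.smoothTransition (3 / s * t)) • (y - z)⟫) - k t * φ t (ray s t z y)

theorem continuousOn_rayRate (hc : Convex ℝ Ω) (hi : (interior Ω).Nonempty)
    {φ : ℝ → Euc d → ℝ} (hφ : IsC1 Ω φ) {k : ℝ → ℝ} (hk : Continuous k) {s : ℝ} (hs : 0 < s)
    (hs1 : s < 1) :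
    ContinuousOn (fun q : (ℝ × Euc d) × Euc d => rayRate Ω φ k s q.1.1 q.1.2 q.2)
      ((Icc 0 1 ×ˢ Ω) ×ˢ Ω) := by
  have hr := continuous_ramp s
  have hw := continuous_timeWeight hk
  have hd : Continuous (deriv Real.smoothTransition) :=
    contDiff_smoothTransition.continuous_deriv le_rfl
  have hg : Continuous fun q : (ℝ × Euc d) × Euc d => (q.1.1, ray s q.1.1 q.1.2 q.2) := by
    unfold ray; fun_prop
  have hm : MapsTo (fun q : (ℝ × Euc d) × Euc d => (q.1.1, ray s q.1.1 q.1.2 q.2))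
      ((Icc 0 1 ×ˢ Ω) ×ˢ Ω) (cylinder Ω) :=
    fun q hq => ⟨hq.1.1, ray_mem hc hs hs1 _ hq.1.2 hq.2⟩
  have c1 := (hφ.continuousOn_dt hc hi).comp hg.continuousOn hm
  have c2 := (hφ.continuousOn_gradX hc hi).comp hg.continuousOn hm
  have c3 := hφ.continuousOn.comp hg.continuousOn hm
  have c4 : Continuous fun q : (ℝ × Euc d) × Euc d =>
    (3 * deriv Real.smoothTransition (3 / s * q.1.1)) • (q.2 - q.1.2) := by fun_prop
  have c5 : Continuous fun q : (ℝ × Euc d) × Euc d => timeWeight k q.1.1 := by fun_prop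
  have c6 : Continuous fun q : (ℝ × Euc d) × Euc d => k q.1.1 := by fun_prop
  exact (c5.continuousOn.mul (c1.add (c2.inner c4.continuousOn))).sub (c6.continuousOn.mul c3)

/-- Fundamental theorem of calculus along one trajectory: at time `0` the weight is `1` and the
particle sits at `z`, at time `1` the weight is `0`. -/
theorem integral_rayRate (hc : Convex ℝ Ω) (hi : (interior Ω).Nonempty)
    {φ : ℝ → Euc d → ℝ} (hφ : IsC1 Ω φ) {s : ℝ} (hs : 0 < s)
    (hs1 : s < 1) {k : ℝ → ℝ} (hk : IsBump (Icc (s / 3) (2 * s / 3)) k) {z y : Euc d}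
    (hz : z ∈ Ω) (hy : y ∈ Ω) :
    ∫ t in Icc (0 : ℝ) 1, rayRate Ω φ k s t z y = - φ 0 z := by
  have hD : ∀ t ∈ Icc (0 : ℝ) 1, HasDerivWithinAt (fun t => timeWeight k t * φ t (ray s t z y))
      (rayRate Ω φ k s t z y) (Icc 0 1) t := by
    intro t ht
    have h1 := hφ.hasDerivWithinAt_comp hc hi ht (hasDerivAt_ray hs t z y).hasDerivWithinAt
      (fun u _ => ray_mem hc hs hs1 u hz hy)
    refine ((hasDerivAt_timeWeight hk.continuous t).hasDerivWithinAt.mul h1).congr_deriv ?_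
    rw [rayRate]; ring
  have hcont : ContinuousOn (fun t => rayRate Ω φ k s t z y) (Icc 0 1) :=
    (continuousOn_rayRate hc hi hφ hk.continuous hs hs1).comp (f := fun t => ((t, z), y))
      (by fun_prop) fun t ht => ⟨⟨ht, hz⟩, hy⟩
  rw [integral_Icc_eq_integral_Ioc, ← intervalIntegral.integral_of_le zero_le_one,
    intervalIntegral.integral_eq_sub_of_hasDerivAt_of_le zero_le_one
      (fun t ht => (hD t ht).continuousWithinAt)
      (fun t ht => (hD t (Ioo_subset_Icc_self ht)).hasDerivAt (Icc_mem_nhds ht.1 ht.2))]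
  · rw [timeWeight_zero, timeWeight_eq_zero hk (by positivity) zero_le_one (by linarith)]
    simp [ray, ramp_zero]
  · exact ContinuousOn.intervalIntegrable (by rwa [uIcc_of_le zero_le_one])

/-- Change from Eulerian to Lagrangian coordinates at a fixed time, by `integral_kern_pairing`. -/
theorem integral_slice_depart (hΩ : IsCompact Ω) (hc : Convex ℝ Ω) (hi : (interior Ω).Nonempty)
    (hη : IsBump Ω η)
    {φ : ℝ → Euc d → ℝ} (hφ : IsC1 Ω φ) {s : ℝ} (hs : 0 < s)
    (hs1 : s < 1) {k : ℝ → ℝ} (hk : IsBump (Icc (s / 3) (2 * s / 3)) k) {h : Euc d → ℝ}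
    (hh : IntegrableOn h Ω) {t : ℝ} (ht : t ∈ Ioc (0 : ℝ) 1) :
    ∫ x in Ω, (dt φ t x * departDensity Ω η k s h t x
        + ⟪gradX Ω φ t x, departMomentum Ω η k s h (t, x)⟫
        + φ t x * -(k t * smear Ω η s h x)) =
      ∫ z in Ω, h z * ∫ y in Ω, η y * rayRate Ω φ k s t z y := by
  have htI : t ∈ Icc (0 : ℝ) 1 := Ioc_subset_Icc_self ht
  have hσ := ramp_pos hs ht.1
  have hslice : ContinuousOn (fun p : Euc d × Euc d => (t, p.1)) (Ω ×ˢ Ω) := by fun_prop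
  have hm : MapsTo (fun p : Euc d × Euc d => (t, p.1)) (Ω ×ˢ Ω) (cylinder Ω) :=
    fun p hp => ⟨htI, hp.1⟩
  have c1 := (hφ.continuousOn_dt hc hi).comp hslice hm
  have c2 := (hφ.continuousOn_gradX hc hi).comp hslice hm
  have c3 := hφ.continuousOn.comp hslice hm
  have key := integral_kern_pairing hΩ hc hη hσ ((ramp_le hs t).trans hs1.le) hh
    (P := fun x z => timeWeight k t * (dt φ t x + ⟪gradX Ω φ t x,
      (3 * deriv Real.smoothTransition (3 / s * t)) • ((ramp s t)⁻¹ • (x - z))⟫) - k t * φ t x)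
    ((continuousOn_const.mul (c1.add (c2.inner (Continuous.continuousOn (by fun_prop))))).sub
      (continuousOn_const.mul c3))
  have e2 : ∀ z y : Euc d, (ramp s t)⁻¹ • ((1 - ramp s t) • z + ramp s t • y - z) = y - z := by
    intro z y
    rw [show (1 - ramp s t) • z + ramp s t • y - z = ramp s t • (y - z) by
      rw [sub_smul, smul_sub, one_smul]; abel, inv_smul_smul₀ hσ.ne']
  simp only [e2] at key
  refine Eq.trans ?_ key
  refine setIntegral_congr_fun hΩ.measurableSet fun x hx => ?_
  -- Absorption happens only for `t ≥ s / 3`, when the ramp has already reached `s`. Hence the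
  -- source is exactly a product of `k` and the smearing at scale `s`.
  have hks : k t * smear Ω η s h x = k t * smear Ω η (ramp s t) h x := by
    by_cases hk0 : k t = 0
    · simp [hk0]
    · rw [ramp_eq hs (hk.mem_of_ne_zero t hk0).1]
  have hi1 := integrable_mul_kern hη hΩ hσ hh x
  have hi2 : IntegrableOn (fun z => h z • (kern η (ramp s t) z x • ((ramp s t)⁻¹ • (x - z)))) Ω := by
    have hkc : Continuous fun z => kern η (ramp s t) z x • ((ramp s t)⁻¹ • (x - z)) :=
      ((continuous_kern hη _).comp (by fun_prop : Continuous fun z => (z, x))).smul (by fun_prop)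
    exact IntegrableOn.smul_continuousOn hh hkc.continuousOn hΩ
  have hi3 : IntegrableOn (fun z => h z * kern η (ramp s t) z x *
      ⟪gradX Ω φ t x, (ramp s t)⁻¹ • (x - z)⟫) Ω := by
    refine (hi2.const_inner (𝕜 := ℝ) (gradX Ω φ t x)).congr (Eventually.of_forall fun z => ?_)
    simp only [inner_smul_right]
    ring
  have hmom : ⟪gradX Ω φ t x, departMomentum Ω η k s h (t, x)⟫ =
      (timeWeight k t * (3 * deriv Real.smoothTransition (3 / s * t))) *
        ∫ z in Ω, h z * kern η (ramp s t) z x * ⟪gradX Ω φ t x, (ramp s t)⁻¹ • (x - z)⟫ := by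
    rw [departMomentum, inner_smul_right, ← integral_inner hi2]
    congr 1
    refine integral_congr_ae (Eventually.of_forall fun z => ?_)
    simp only [inner_smul_right]
    ring
  have hdens : departDensity Ω η k s h t x = timeWeight k t * smear Ω η (ramp s t) h x := by
    rw [departDensity, if_neg ht.1.ne']
  rw [hmom, hks, hdens]
  have expand : ∀ z, h z * (kern η (ramp s t) z x * (timeWeight k t * (dt φ t x +
      ⟪gradX Ω φ t x, (3 * deriv Real.smoothTransition (3 / s * t)) • ((ramp s t)⁻¹ • (x - z))⟫)
        - k t * φ t x)) = (timeWeight k t * dt φ t x - k t * φ t x) * (h z * kern η (ramp s t) z x) +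
      (timeWeight k t * (3 * deriv Real.smoothTransition (3 / s * t))) *
        (h z * kern η (ramp s t) z x * ⟪gradX Ω φ t x, (ramp s t)⁻¹ • (x - z)⟫) := by
    intro z
    rw [inner_smul_right _ _ (3 * _)]
    ring
  simp only [expand]
  rw [integral_add (hi1.const_mul _) (hi3.const_mul _), integral_const_mul, integral_const_mul,
    ← smear]
  ring

/-- The weak equation is the average over `z` and `y` of the identity along single trajectories in
`integral_rayRate`. -/
theorem momentumSolution_depart (hΩ : IsCompact Ω) (hc : Convex ℝ Ω) (hi : (interior Ω).Nonempty)
    (hη : IsBump Ω η) {s : ℝ} (hs : 0 < s)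
    (hs1 : s < 1) {k : ℝ → ℝ} (hk : IsBump (Icc (s / 3) (2 * s / 3)) k) {h : Euc d → ℝ}
    (hh : IsDensity Ω h) :
    MomentumSolution Ω (departDensity Ω η k s h) (departMomentum Ω η k s h)
      (fun p => -(k p.1 * smear Ω η s h p.2)) := by
  have hpath := isDensityPath_departDensity hΩ hη hk hs hh
  have hmc : ContinuousOn (departMomentum Ω η k s h) (Ioo (0 : ℝ) 1 ×ˢ Ω) :=
    (continuousOn_departMomentum hΩ hη hk.continuous hs hh.1).mono
      (prod_mono (fun t ht => ht.1) (subset_univ _))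
  have hmi : IntegrableOn (departMomentum Ω η k s h) (cylinder Ω) := by
    obtain ⟨R, -, hR⟩ := exists_norm_departMomentum_le hΩ hη hh
    refine ((hpath.integrableOn hΩ).const_mul R).mono'
      (aestronglyMeasurable_of_continuousOn_Ioo hΩ hmc) ?_
    rw [volume_restrict_cylinder_Ioo]
    filter_upwards [ae_restrict_mem (measurableSet_Ioo.prod hΩ.measurableSet)] with p hp
    exact hR s hs k hk p.1 hp.1.1 p.2 hp.2
  have hfc : Continuous (fun p : ℝ × Euc d => -(k p.1 * smear Ω η s h p.2)) := by
    have := hk.continuous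
    have := continuous_smear hΩ hη s hh.1
    fun_prop
  refine ⟨hpath, hmc, hmi, hfc, fun φ hφ => ?_⟩
  have e1 : ∫ x in Ω, φ 1 x * departDensity Ω η k s h 1 x = 0 := by
    simp [departDensity_eq_zero hs hk h hs1.le]
  have e0 : ∫ x in Ω, φ 0 x * departDensity Ω η k s h 0 x = ∫ x in Ω, h x * φ 0 x := by
    simp [departDensity, mul_comm]
  have hI := integrableOn_weak_integrand hΩ hc hi hφ (hpath.integrableOn hΩ) hmi
    (hfc.continuousOn.integrableOn_compact (isCompact_cylinder hΩ))
  rw [IntegrableOn, volume_restrict_cylinder] at hI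
  rw [e1, e0, zero_sub, volume_restrict_cylinder, integral_prod _ hI]
  have hJ := continuousOn_rayRate hc hi hφ hk.continuous hs hs1
  have hG : ContinuousOn (fun p : ℝ × Euc d => ∫ y in Ω, η y * rayRate Ω φ k s p.1 p.2 y)
      (Icc (0 : ℝ) 1 ×ˢ Ω) :=
    continuousOn_integral_smul (P := ℝ × Euc d) hΩ
      (exists_compact_nhdsWithin_of_isCompact (isCompact_cylinder hΩ)) hη.integrable.integrableOn
      (G := fun p y => rayRate Ω φ k s p.1 p.2 y) hJ
  have hslice : ∫ t in Icc (0 : ℝ) 1, ∫ x in Ω, (dt φ t x * departDensity Ω η k s h t x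
        + ⟪gradX Ω φ t x, departMomentum Ω η k s h (t, x)⟫
        + φ t x * -(k t * smear Ω η s h x)) =
      ∫ t in Icc (0 : ℝ) 1, ∫ z in Ω, h z * ∫ y in Ω, η y * rayRate Ω φ k s t z y := by
    rw [integral_Icc_eq_integral_Ioc, integral_Icc_eq_integral_Ioc]
    exact setIntegral_congr_fun measurableSet_Ioc fun t ht =>
      integral_slice_depart hΩ hc hi hη hφ hs hs1 hk hh.1 ht
  rw [hslice, integral_integral_swap (integrable_mul_of_continuousOn (ν := volume) isCompact_Icc hΩ hh.1
    (G := fun t z => ∫ y in Ω, η y * rayRate Ω φ k s t z y) hG), ← integral_neg]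
  refine setIntegral_congr_fun hΩ.measurableSet fun z hz => ?_
  rw [integral_const_mul, integral_integral_swap (integrable_mul_of_continuousOn (ν := volume) isCompact_Icc hΩ
    hη.integrable.integrableOn (G := fun t y => rayRate Ω φ k s t z y)
      (hJ.comp (f := fun p : ℝ × Euc d => ((p.1, z), p.2)) (by fun_prop)
        fun p hp => ⟨⟨hp.1, hz⟩, hp.2⟩))]
  rw [← mul_neg]
  congr 1
  have : ∫ y in Ω, ∫ t in Icc (0 : ℝ) 1, η y * rayRate Ω φ k s t z y =
      ∫ y in Ω, η y * (- φ 0 z) := by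
    refine setIntegral_congr_fun hΩ.measurableSet fun y hy => ?_
    rw [integral_const_mul, integral_rayRate hc hi hφ hs hs1 hk hz hy]
  rw [this, hη.setIntegral_mul, integral_mul_const, hη.integral_eq_one, one_mul]

/-- A path of total energy `O(s)` which starts at `h`, and is absorbed by a source at times in the
support of `k`. -/
theorem exists_departure (hΩ : IsCompact Ω) (hc : Convex ℝ Ω) (hi : (interior Ω).Nonempty)
    (hη : IsBump Ω η) {h : Euc d → ℝ} (hh : IsDensity Ω h) :
    ∃ C : ℝ≥0∞, C ≠ ⊤ ∧ ∀ s > 0, s < 1 → ∀ k, IsBump (Icc (s / 3) (2 * s / 3)) k →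
      ∃ (μ : ℝ → Euc d → ℝ) (m : ℝ × Euc d → Euc d) (e : ℝ × Euc d → ℝ),
        MomentumSolution Ω μ m (fun p => -(k p.1 * smear Ω η s h p.2)) ∧
        EnergyBound Ω μ m e ∧ μ 0 = h ∧ μ 1 = 0 ∧
        AEMeasurable (fun p => ENNReal.ofReal (e p)) (volume.restrict (cylinder Ω)) ∧
        ∫⁻ p in cylinder Ω, ENNReal.ofReal (e p) ≤ ENNReal.ofReal s * C := by
  obtain ⟨R, hR0, hR⟩ := exists_norm_departMomentum_le hΩ hη hh
  refine ⟨ENNReal.ofReal (R ^ 2) * eLpNorm h 1 (volume.restrict Ω),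
    ENNReal.mul_ne_top ENNReal.ofReal_ne_top (memLp_one_iff_integrable.2 hh.1).eLpNorm_lt_top.ne,
    fun s hs hs1 k hk => ⟨departDensity Ω η k s h, departMomentum Ω η k s h,
      fun p => R ^ 2 * departDensity Ω η k s h p.1 p.2,
      momentumSolution_depart hΩ hc hi hη hs hs1 hk hh, ?_, ?_, ?_, ?_, ?_⟩⟩
  · have h0 : ∀ p ∈ Ioo (0 : ℝ) 1 ×ˢ Ω, 0 ≤ departDensity Ω η k s h p.1 p.2 := fun p hp =>
      departDensity_nonneg hη hk hs hh.2 hp.1.1 p.2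
    refine ⟨h0, fun p hp => mul_nonneg (sq_nonneg R) (h0 p hp), fun p hp => ?_⟩
    have := pow_le_pow_left₀ (norm_nonneg _) (hR s hs k hk p.1 hp.1.1 p.2 hp.2) 2
    calc _ ≤ _ := this
      _ = _ := by ring
  · ext x; simp [departDensity]
  · ext x; simp [departDensity_eq_zero hs hk h hs1.le]
  · exact ((aestronglyMeasurable_of_continuousOn_Ioo hΩ
      (isDensityPath_departDensity hΩ hη hk hs hh).continuousOn).aemeasurable.const_mul
        (R ^ 2)).ennreal_ofReal
  · simp only [ENNReal.ofReal_mul (sq_nonneg R)]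
    rw [lintegral_const_mul' _ _ ENNReal.ofReal_ne_top, mul_left_comm]
    gcongr
    exact lintegral_departDensity_le hΩ hη hs hk hh

end DepartureWeak

/-! ### Hahn-Banach: extending the endpoint pairing from jets to all continuous triples. -/

section Extension

/-- A variant of the M. Riesz extension theorem for a convex set instead of a convex cone. -/
theorem exists_extension_nonneg_on_convex {V : Type*} [AddCommGroup V] [Module ℝ V] {S : Set V}
    (hS : Convex ℝ S) (f : V →ₗ.[ℝ] ℝ) (nonneg : ∀ x : f.domain, (x : V) ∈ S → 0 ≤ f x)
    (dense : ∀ y, ∃ x : f.domain, (x : V) + y ∈ S) :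
    ∃ g : V →ₗ[ℝ] ℝ, (∀ x : f.domain, g x = f x) ∧ ∀ x ∈ S, 0 ≤ g x := by
  -- The cone generated by `S`. Nonnegativity on `S` passes to it by scaling, and the Riesz theorem
  -- for cones applies.
  let K : PointedCone ℝ V :=
    { carrier := {y | y = 0 ∨ ∃ c : ℝ, 0 < c ∧ ∃ x ∈ S, y = c • x}
      zero_mem' := Or.inl rfl
      add_mem' := by
        rintro a b (rfl | ⟨c, hc, x, hx, rfl⟩) hb
        · simpa using hb
        · rcases hb with rfl | ⟨c', hc', x', hx', rfl⟩
          · exact Or.inr ⟨c, hc, x, hx, by simp⟩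
          · have hcc : 0 < c + c' := by positivity
            refine Or.inr ⟨c + c', hcc, (c / (c + c')) • x + (c' / (c + c')) • x',
              hS hx hx' (by positivity) (by positivity) (by field_simp), ?_⟩
            rw [smul_add, smul_smul, smul_smul, mul_div_cancel₀ _ hcc.ne',
              mul_div_cancel₀ _ hcc.ne']
      smul_mem' := by
        rintro ⟨c, hc⟩ y (rfl | ⟨c', hc', x, hx, rfl⟩)
        · exact Or.inl (smul_zero _)
        · rcases hc.eq_or_lt with rfl | hc0
          · exact Or.inl (zero_smul ℝ _)
          · exact Or.inr ⟨c * c', mul_pos hc0 hc', x, hx, smul_smul c c' x⟩ }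
  have hK : ∀ x ∈ S, x ∈ K := fun x hx => Or.inr ⟨1, one_pos, x, hx, (one_smul _ _).symm⟩
  have hf : ∀ x : f.domain, (x : V) ∈ K → 0 ≤ f x := by
    rintro x (hx | ⟨c, hc, y, hy, hx⟩)
    · have : x = 0 := Subtype.ext hx
      rw [this, LinearPMap.map_zero]
    · have h1 : ((c⁻¹ • x : f.domain) : V) = y := by
        rw [Submodule.coe_smul, hx, inv_smul_smul₀ hc.ne']
      have h2 := nonneg (c⁻¹ • x) (h1 ▸ hy)
      rw [LinearPMap.map_smul, smul_eq_mul] at h2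
      exact nonneg_of_mul_nonneg_right h2 (inv_pos.2 hc)
  obtain ⟨g, hg, hg'⟩ := riesz_extension K f hf fun y => (dense y).imp fun x hx => hK _ hx
  exact ⟨g, hg, fun x hx => hg' x (hK x hx)⟩

/-- Extension of a linear functional which is dominated on a convex epigraph. -/
theorem exists_extension_le_on_convex {W : Type*} [AddCommGroup W] [Module ℝ W]
    {S : Set (W × ℝ)} (hS : Convex ℝ S) (p : Submodule ℝ (W × ℝ)) (hp : ∀ r, ((0 : W), r) ∈ p)
    (l : W →ₗ[ℝ] ℝ) (hl : ∀ q ∈ p, q ∈ S → l q.1 ≤ q.2) (dense : ∀ y, ∃ q ∈ p, q + y ∈ S) :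
    ∃ L : W →ₗ[ℝ] ℝ, (∀ q ∈ p, L q.1 = l q.1) ∧ ∀ q ∈ S, L q.1 ≤ q.2 := by
  -- Domination becomes nonnegativity of `r - l w` on `S`. As `p` contains the vertical axis, any
  -- extension has the form `r - L w`.
  let F : W × ℝ →ₗ[ℝ] ℝ := LinearMap.snd ℝ W ℝ - l ∘ₗ LinearMap.fst ℝ W ℝ
  have hF : ∀ q, F q = q.2 - l q.1 := fun q => rfl
  obtain ⟨g, hg, hgS⟩ := exists_extension_nonneg_on_convex hS ⟨p, F.domRestrict p⟩
    (fun q hq => sub_nonneg.2 (hl q q.2 hq))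
    (fun y => let ⟨q, hq, h⟩ := dense y; ⟨⟨q, hq⟩, h⟩)
  have hg' : ∀ q ∈ p, g q = q.2 - l q.1 := fun q hq => hg ⟨q, hq⟩
  have hgL : ∀ w r, g (w, r) = r + g (w, 0) := by
    intro w r
    have h1 : (w, r) = (0, r) + (w, (0 : ℝ)) := by simp
    have h2 := hg' _ (hp r)
    rw [h1, map_add, h2]
    simp
  refine ⟨-(g ∘ₗ LinearMap.inl ℝ W ℝ), fun q hq => ?_, fun q hq => ?_⟩
  · have h1 := hgL q.1 q.2
    have h2 := hg' q hq
    simp only [LinearMap.neg_apply, LinearMap.comp_apply, LinearMap.inl_apply]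
    rw [Prod.mk.eta] at h1
    linarith
  · have h1 := hgL q.1 q.2
    have h2 := hgS q hq
    simp only [LinearMap.neg_apply, LinearMap.comp_apply, LinearMap.inl_apply]
    rw [Prod.mk.eta] at h1
    linarith

/-- A continuous version of `exists_extension_le_on_convex`. -/
theorem exists_continuous_extension_le_on_convex {W : Type*} [NormedAddCommGroup W]
    [NormedSpace ℝ W] {S : Set (W × ℝ)} (hS : Convex ℝ S) (p : Submodule ℝ (W × ℝ))
    (hp : ∀ r, ((0 : W), r) ∈ p) (l : W →ₗ[ℝ] ℝ) (hl : ∀ q ∈ p, q ∈ S → l q.1 ≤ q.2)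
    (dense : ∀ y, ∃ q ∈ p, q + y ∈ S)
    (hb : ∃ w₀ R, ∀ w : W, ‖w‖ ≤ 1 → (w - w₀, R) ∈ S) :
    ∃ L : W →L[ℝ] ℝ, (∀ q ∈ p, L q.1 = l q.1) ∧ ∀ q ∈ S, L q.1 ≤ q.2 := by
  obtain ⟨L, h1, h2⟩ := exists_extension_le_on_convex hS p hp l hl dense
  obtain ⟨w₀, R, hR⟩ := hb
  -- Since a translate of the unit ball lies in `S` at height `R`, `L` is bounded above on the ball,
  -- and by symmetry also below.
  have hC : ∀ w : W, ‖w‖ ≤ 1 → L w ≤ R + L w₀ := fun w hw => by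
    have := h2 _ (hR w hw)
    rw [map_sub] at this
    linarith
  refine ⟨L.mkContinuous ((R + L w₀) / 1) (L.bound_of_ball_bound' one_pos _ fun w hw => ?_), h1, h2⟩
  rw [mem_closedBall_zero_iff] at hw
  rw [Real.norm_eq_abs, abs_le]
  refine ⟨?_, hC w hw⟩
  have := hC (-w) (by rwa [norm_neg])
  rw [map_neg] at this
  linarith

variable {d : ℕ} {Ω : Set (Euc d)}

/-- Lebesgue measure on the cylinder as a subtype. -/
abbrev cylVol (Ω : Set (Euc d)) : Measure (cylinder Ω) :=
  (volume : Measure (ℝ × Euc d)).comap Subtype.val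

theorem isFiniteMeasure_cylVol (hΩ : IsCompact Ω) : IsFiniteMeasure (cylVol Ω) := ⟨by
  rw [comap_subtype_coe_apply (measurableSet_cylinder hΩ), image_univ, Subtype.range_coe]
  exact (isCompact_cylinder hΩ).measure_lt_top⟩

theorem integrable_cylVol_of_continuous (hΩ : IsCompact Ω) {F : Type*} [NormedAddCommGroup F]
    [SecondCountableTopology F] {g : cylinder Ω → F} (hg : Continuous g) :
    Integrable g (cylVol Ω) := by
  have : CompactSpace (cylinder Ω) := isCompact_iff_compactSpace.1 (isCompact_cylinder hΩ)
  have := isFiniteMeasure_cylVol hΩ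
  obtain ⟨C, hC⟩ := isCompact_univ.exists_bound_of_continuousOn hg.continuousOn
  exact Integrable.of_bound hg.aestronglyMeasurable C
    (Eventually.of_forall fun x => hC x (mem_univ x))

/-- The space of triples `(a, b, c)` in which `(∂ₜφ, ∇φ, φ)` lives. -/
abbrev JetSpace (Ω : Set (Euc d)) : Type :=
  C(cylinder Ω, ℝ) × C(cylinder Ω, Euc d) × C(cylinder Ω, ℝ)

/-- `w` is the triple `(∂ₜφ, ∇φ, φ)` on the cylinder. -/
def IsJet (φ : ℝ → Euc d → ℝ) (w : JetSpace Ω) : Prop :=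
  (∀ z : cylinder Ω, w.1 z = dt φ z.1.1 z.1.2) ∧
  (∀ z : cylinder Ω, w.2.1 z = gradX Ω φ z.1.1 z.1.2) ∧
  (∀ z : cylinder Ω, w.2.2 z = φ z.1.1 z.1.2)

theorem IsC1.jet_add (hc : Convex ℝ Ω) (hi : (interior Ω).Nonempty) {φ ψ : ℝ → Euc d → ℝ}
    (hφ : IsC1 Ω φ) (hψ : IsC1 Ω ψ) {w w' : JetSpace Ω} (hw : IsJet φ w) (hw' : IsJet ψ w') :
    IsC1 Ω (fun t x => φ t x + ψ t x) ∧ IsJet (fun t x => φ t x + ψ t x) (w + w') := by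
  refine ⟨ContDiffOn.add hφ hψ, fun z => ?_, fun z => ?_, fun z => ?_⟩
  · have h1 := hφ.hasFDerivWithinAt z.2
    have h2 := hψ.hasFDerivWithinAt z.2
    rw [dt_eq (φ := fun t x => φ t x + ψ t x) z.2.1 z.2.2 (h1.add h2)]
    simp only [Prod.fst_add, ContinuousMap.add_apply, hw.1 z, hw'.1 z]
    rw [dt_eq z.2.1 z.2.2 h1, dt_eq z.2.1 z.2.2 h2]
    rfl
  · have h1 := hφ.hasFDerivWithinAt z.2
    have h2 := hψ.hasFDerivWithinAt z.2
    rw [gradX_eq (φ := fun t x => φ t x + ψ t x) hc hi z.2.1 z.2.2 (h1.add h2)]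
    simp only [Prod.fst_add, Prod.snd_add, ContinuousMap.add_apply, hw.2.1 z, hw'.2.1 z]
    rw [gradX_eq hc hi z.2.1 z.2.2 h1, gradX_eq hc hi z.2.1 z.2.2 h2,
      ContinuousLinearMap.add_comp, map_add]
  · simp only [Prod.snd_add, ContinuousMap.add_apply, hw.2.2 z, hw'.2.2 z]

theorem IsC1.jet_smul (hc : Convex ℝ Ω) (hi : (interior Ω).Nonempty) {φ : ℝ → Euc d → ℝ}
    (hφ : IsC1 Ω φ) {w : JetSpace Ω} (hw : IsJet φ w) (r : ℝ) :
    IsC1 Ω (fun t x => r * φ t x) ∧ IsJet (fun t x => r * φ t x) (r • w) := by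
  refine ⟨contDiffOn_const.mul hφ, fun z => ?_, fun z => ?_, fun z => ?_⟩
  · have h1 := hφ.hasFDerivWithinAt z.2
    rw [dt_eq (φ := fun t x => r * φ t x) z.2.1 z.2.2 (h1.const_mul r)]
    simp only [Prod.smul_fst, ContinuousMap.smul_apply, hw.1 z]
    rw [dt_eq z.2.1 z.2.2 h1]
    rfl
  · have h1 := hφ.hasFDerivWithinAt z.2
    rw [gradX_eq (φ := fun t x => r * φ t x) hc hi z.2.1 z.2.2 (h1.const_mul r)]
    simp only [Prod.smul_fst, Prod.smul_snd, ContinuousMap.smul_apply, hw.2.1 z]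
    rw [gradX_eq hc hi z.2.1 z.2.2 h1, ContinuousLinearMap.smul_comp, map_smul]
  · simp only [Prod.smul_snd, ContinuousMap.smul_apply, hw.2.2 z, smul_eq_mul]

/-- These functions move the Hamilton-Jacobi inequality by an arbitrary constant without touching
the gradient; `r = 0` gives the zero subsolution. -/
theorem isC1_linear_time (hc : Convex ℝ Ω) (hi : (interior Ω).Nonempty) (r : ℝ) :
    IsC1 Ω (fun t _ => r * t) ∧ ∀ t ∈ Icc (0 : ℝ) 1, ∀ x ∈ Ω,
      dt (fun t (_ : Euc d) => r * t) t x = r ∧ gradX Ω (fun t (_ : Euc d) => r * t) t x = 0 := by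
  have h1 : ∀ z : ℝ × Euc d, HasFDerivWithinAt (Function.uncurry fun t (_ : Euc d) => r * t)
      (r • ContinuousLinearMap.fst ℝ ℝ (Euc d)) (cylinder Ω) z := fun z =>
    hasFDerivWithinAt_fst.const_mul r
  refine ⟨ContDiff.contDiffOn (contDiff_const.mul contDiff_fst), fun t ht x hx => ⟨?_, ?_⟩⟩
  · rw [dt_eq ht hx (h1 (t, x))]; simp
  · rw [gradX_eq hc hi ht hx (h1 (t, x)), LinearIsometryEquiv.map_eq_zero_iff]
    ext; simp

/-- The pairing with the endpoint densities, as a linear functional on `C([0,1] × Ω)`. -/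
theorem exists_endpoint_functional (hΩ : IsCompact Ω) {μ₀ μ₁ : Euc d → ℝ}
    (h₀ : IntegrableOn μ₀ Ω) (h₁ : IntegrableOn μ₁ Ω) :
    ∃ l : C(cylinder Ω, ℝ) →ₗ[ℝ] ℝ, ∀ (φ : ℝ → Euc d → ℝ) (c : C(cylinder Ω, ℝ)),
      (∀ z : cylinder Ω, c z = φ z.1.1 z.1.2) →
        l c = ∫ x in Ω, (φ 1 x * μ₁ x - φ 0 x * μ₀ x) := by
  -- Extension by zero off the cylinder; only values on the cylinder enter the integrals.
  let ex : C(cylinder Ω, ℝ) → ℝ → Euc d → ℝ := fun c t x =>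
    Function.extend Subtype.val c 0 (t, x)
  have hex : ∀ (c : C(cylinder Ω, ℝ)) (z : cylinder Ω), ex c z.1.1 z.1.2 = c z := fun c z =>
    Subtype.val_injective.extend_apply _ _ z
  have m0 : ∀ x ∈ Ω, ((0 : ℝ), x) ∈ cylinder Ω := fun x hx => ⟨by simp, hx⟩
  have m1 : ∀ x ∈ Ω, ((1 : ℝ), x) ∈ cylinder Ω := fun x hx => ⟨by simp, hx⟩
  have hcont : ∀ (c : C(cylinder Ω, ℝ)) (t : ℝ), t ∈ Icc (0 : ℝ) 1 → ContinuousOn (ex c t) Ω := by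
    intro c t ht
    rw [continuousOn_iff_continuous_domRestrict]
    have : Ω.domRestrict (ex c t) = fun x : Ω => c ⟨(t, x), ⟨ht, x.2⟩⟩ := by
      ext x; exact hex c ⟨(t, x), ⟨ht, x.2⟩⟩
    rw [this]
    fun_prop
  have hint : ∀ c : C(cylinder Ω, ℝ), IntegrableOn (fun x => ex c 1 x * μ₁ x - ex c 0 x * μ₀ x) Ω :=
    fun c => (h₁.continuousOn_mul (hcont c 1 (by simp)) hΩ).sub
      (h₀.continuousOn_mul (hcont c 0 (by simp)) hΩ)
  refine ⟨{ toFun := fun c => ∫ x in Ω, (ex c 1 x * μ₁ x - ex c 0 x * μ₀ x)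
            map_add' := fun c c' => ?_
            map_smul' := fun r c => ?_ }, fun φ c hφ => ?_⟩
  · rw [← integral_add (hint c) (hint c')]
    refine setIntegral_congr_fun hΩ.measurableSet fun x hx => ?_
    have e1 := hex (c + c') ⟨_, m1 x hx⟩
    have e2 := hex (c + c') ⟨_, m0 x hx⟩
    have e3 := hex c ⟨_, m1 x hx⟩
    have e4 := hex c ⟨_, m0 x hx⟩
    have e5 := hex c' ⟨_, m1 x hx⟩
    have e6 := hex c' ⟨_, m0 x hx⟩
    simp only [ContinuousMap.add_apply] at e1 e2
    simp only [e1, e2, e3, e4, e5, e6]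
    ring
  · rw [RingHom.id_apply, smul_eq_mul, ← integral_const_mul]
    refine setIntegral_congr_fun hΩ.measurableSet fun x hx => ?_
    have e1 := hex (r • c) ⟨_, m1 x hx⟩
    have e2 := hex (r • c) ⟨_, m0 x hx⟩
    have e3 := hex c ⟨_, m1 x hx⟩
    have e4 := hex c ⟨_, m0 x hx⟩
    simp only [ContinuousMap.smul_apply, smul_eq_mul] at e1 e2
    simp only [e1, e2, e3, e4]
    ring
  · refine setIntegral_congr_fun hΩ.measurableSet fun x hx => ?_
    have e3 := hex c ⟨_, m1 x hx⟩
    have e4 := hex c ⟨_, m0 x hx⟩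
    rw [hφ] at e3 e4
    simp only at e3 e4
    simp only [e3, e4]

theorem sq_norm_convex_comb_le {F : Type*} [NormedAddCommGroup F] [NormedSpace ℝ F] (u v : F)
    {r s : ℝ} (hr : 0 ≤ r) (hs : 0 ≤ s) (hrs : r + s = 1) :
    ‖r • u + s • v‖ ^ 2 ≤ r * ‖u‖ ^ 2 + s * ‖v‖ ^ 2 :=
  (convexOn_univ_norm.pow (fun _ _ => norm_nonneg _) 2).2 (mem_univ u) (mem_univ v) hr hs hrs

/-- The convex set of triples satisfying the Hamilton-Jacobi inequality, with a bound for the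
dual functional. -/
def dualSet (Ω : Set (Euc d)) (α D : ℝ) : Set (JetSpace Ω × ℝ) :=
  {p | (∀ z : cylinder Ω, p.1.1 z + 1 / 2 * ‖p.1.2.1 z‖ ^ 2 ≤ 0) ∧
    D + α / 2 * (∫ z : cylinder Ω, p.1.2.2 z ^ 2 ∂(cylVol Ω)) ≤ p.2}

theorem convex_dualSet (hΩ : IsCompact Ω) {α : ℝ} (hα : 0 < α) (D : ℝ) :
    Convex ℝ (dualSet Ω α D) := by
  have hK := isCompact_cylinder hΩ
  have hI : ∀ c : C(cylinder Ω, ℝ), Integrable (fun z => c z ^ 2) (cylVol Ω) := fun c =>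
    integrable_cylVol_of_continuous hΩ (c.continuous.pow 2)
  intro p hp q hq r s hr hs hrs
  refine ⟨fun z => ?_, ?_⟩
  · have h1 := hp.1 z
    have h2 := hq.1 z
    have h3 := sq_norm_convex_comb_le (p.1.2.1 z) (q.1.2.1 z) hr hs hrs
    simp only [Prod.fst_add, Prod.smul_fst, Prod.snd_add, Prod.smul_snd, ContinuousMap.add_apply,
      ContinuousMap.smul_apply, smul_eq_mul]
    nlinarith [mul_le_mul_of_nonneg_left h1 hr, mul_le_mul_of_nonneg_left h2 hs]
  · have h1 := hp.2
    have h2 := hq.2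
    have h3 : ∫ z : cylinder Ω, (r • p + s • q).1.2.2 z ^ 2 ∂(cylVol Ω) ≤
        r * (∫ z : cylinder Ω, p.1.2.2 z ^ 2 ∂(cylVol Ω)) + s * ∫ z : cylinder Ω, q.1.2.2 z ^ 2 ∂(cylVol Ω) := by
      rw [← integral_const_mul, ← integral_const_mul, ← integral_add ((hI _).const_mul _)
        ((hI _).const_mul _)]
      refine integral_mono (hI _) (((hI _).const_mul _).add ((hI _).const_mul _)) fun z => ?_
      have := sq_norm_convex_comb_le (p.1.2.2 z) (q.1.2.2 z) hr hs hrs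
      simpa using this
    have h4 := mul_le_mul_of_nonneg_left h3 (by positivity : 0 ≤ α / 2)
    have h5 := mul_le_mul_of_nonneg_left h1 hr
    have h6 := mul_le_mul_of_nonneg_left h2 hs
    have h7 : (r • p + s • q).2 = r * p.2 + s * q.2 := rfl
    have h8 : D = r * D + s * D := by rw [← add_mul, hrs, one_mul]
    rw [h7]
    nlinarith

/-- The subspace of all triples `(∂ₜφ, ∇φ, φ)` with `φ ∈ C¹`, times `ℝ`. -/
def jetSubmodule (hc : Convex ℝ Ω) (hi : (interior Ω).Nonempty) :
    Submodule ℝ (JetSpace Ω × ℝ) where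
  carrier := {q | ∃ φ, IsC1 Ω φ ∧ IsJet φ q.1}
  zero_mem' := by
    obtain ⟨h1, h2⟩ := isC1_linear_time hc hi 0
    refine ⟨_, h1, fun z => ?_, fun z => ?_, fun z => ?_⟩
    · rw [(h2 _ z.2.1 _ z.2.2).1]; rfl
    · rw [(h2 _ z.2.1 _ z.2.2).2]; rfl
    · exact (zero_mul _).symm
  add_mem' := by
    rintro q q' ⟨φ, h1, h2⟩ ⟨ψ, h3, h4⟩
    exact ⟨_, h1.jet_add hc hi h3 h2 h4⟩
  smul_mem' := by
    rintro r q ⟨φ, h1, h2⟩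
    exact ⟨_, h1.jet_smul hc hi h2 r⟩

/-- Adding the jet of `-C t` with `C = ‖a‖ + ½‖b‖²` forces the Hamilton-Jacobi inequality on any
triple, and the real component is free. This is the cofinality condition of the Riesz extension. -/
theorem exists_add_mem_dualSet (hc : Convex ℝ Ω) (hi : (interior Ω).Nonempty)
    [CompactSpace (cylinder Ω)] (α D : ℝ) (y : JetSpace Ω × ℝ) :
    ∃ q ∈ jetSubmodule hc hi, q + y ∈ dualSet Ω α D := by
  obtain ⟨w, r⟩ := y
  obtain ⟨C, hC⟩ : ∃ C, C = ‖w.1‖ + 1 / 2 * ‖w.2.1‖ ^ 2 := ⟨_, rfl⟩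
  obtain ⟨h1, h2⟩ := isC1_linear_time hc hi (-C)
  obtain ⟨w', hw1, hw'⟩ : ∃ w' : JetSpace Ω, (∀ z, w'.1 z = -C ∧ w'.2.1 z = 0) ∧
      IsJet (fun t _ => -C * t) w' :=
    ⟨(ContinuousMap.const _ (-C), 0, ⟨fun z => -C * z.1.1, by fun_prop⟩),
      fun z => ⟨rfl, rfl⟩, fun z => ((h2 _ z.2.1 _ z.2.2).1).symm,
      fun z => ((h2 _ z.2.1 _ z.2.2).2).symm, fun z => rfl⟩
  refine ⟨(w', D + α / 2 * (∫ z : cylinder Ω, (w' + w).2.2 z ^ 2 ∂(cylVol Ω)) - r),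
    ⟨_, h1, hw'⟩, fun z => ?_, ?_⟩
  · have a1 := (le_abs_self _).trans (w.1.norm_coe_le_norm z)
    have a2 : ‖w.2.1 z‖ ^ 2 ≤ ‖w.2.1‖ ^ 2 :=
      pow_le_pow_left₀ (norm_nonneg _) (w.2.1.norm_coe_le_norm z) 2
    simp only [Prod.fst_add, Prod.snd_add, ContinuousMap.add_apply, (hw1 z).1, (hw1 z).2, zero_add]
    linarith
  · simp only [Prod.mk_add_mk, sub_add_cancel, le_refl]

/-- The shift `(2, 0, 0)` suffices because `1 + ½ - 2 ≤ 0` on the unit ball. This interior point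
gives continuity of the extension. -/
theorem exists_sub_mem_dualSet (hΩ : IsCompact Ω) [CompactSpace (cylinder Ω)]
    {α : ℝ} (hα : 0 < α) (D : ℝ) :
    ∃ w₀ R, ∀ w : JetSpace Ω, ‖w‖ ≤ 1 → (w - w₀, R) ∈ dualSet Ω α D := by
  obtain ⟨w₀, hw₀⟩ : ∃ w₀ : JetSpace Ω, (∀ z, w₀.1 z = 2 ∧ w₀.2.1 z = 0 ∧ w₀.2.2 z = 0) :=
    ⟨(ContinuousMap.const _ 2, 0, 0), fun z => ⟨rfl, rfl, rfl⟩⟩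
  refine ⟨w₀, D + α / 2 * ∫ z : cylinder Ω, (1 : ℝ) ∂(cylVol Ω), fun w hw => ⟨fun z => ?_, ?_⟩⟩
  · have n1 : ‖w.1‖ ≤ 1 := (norm_fst_le w).trans hw
    have n2 : ‖w.2.1‖ ≤ 1 := (norm_fst_le w.2).trans ((norm_snd_le w).trans hw)
    have a1 := (le_abs_self _).trans ((w.1.norm_coe_le_norm z).trans n1)
    have a2 := (w.2.1.norm_coe_le_norm z).trans n2
    have a3 : ‖w.2.1 z‖ ^ 2 ≤ 1 := pow_le_one₀ (norm_nonneg _) a2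
    simp only [Prod.fst_sub, Prod.snd_sub, ContinuousMap.sub_apply, hw₀ z, sub_zero]
    linarith
  · have n3 : ‖w.2.2‖ ≤ 1 := (norm_snd_le w.2).trans ((norm_snd_le w).trans hw)
    have h2 : ∫ z : cylinder Ω, (w - w₀).2.2 z ^ 2 ∂(cylVol Ω) ≤
        ∫ z : cylinder Ω, (1 : ℝ) ∂(cylVol Ω) := by
      refine integral_mono (integrable_cylVol_of_continuous hΩ (by fun_prop))
        (integrable_cylVol_of_continuous hΩ (by fun_prop)) fun z => ?_
      have a2 := (w.2.2.norm_coe_le_norm z).trans n3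
      simp only [Prod.snd_sub, ContinuousMap.sub_apply, hw₀ z, sub_zero]
      rw [← sq_abs]
      exact pow_le_one₀ (abs_nonneg _) a2
    have h3 := mul_le_mul_of_nonneg_left h2 (by positivity : 0 ≤ α / 2)
    simp only
    linarith

/-- The Hahn-Banach theorem applied to the dual problem. -/
theorem exists_dual_functional (hΩ : IsCompact Ω) (hc : Convex ℝ Ω) (hi : (interior Ω).Nonempty)
    [CompactSpace (cylinder Ω)]
    {α : ℝ} (hα : 0 < α) {μ₀ μ₁ : Euc d → ℝ}
    (h₀ : IntegrableOn μ₀ Ω) (h₁ : IntegrableOn μ₁ Ω) {D : ℝ}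
    (hD : ∀ Φ, IsHJSubsolution Ω Φ → dualValue α Ω μ₀ μ₁ Φ ≤ D) :
    ∃ L : JetSpace Ω →L[ℝ] ℝ,
      (∀ φ w, IsC1 Ω φ → IsJet φ w → L w = ∫ x in Ω, (φ 1 x * μ₁ x - φ 0 x * μ₀ x)) ∧
      ∀ w : JetSpace Ω, (∀ z, w.1 z + 1 / 2 * ‖w.2.1 z‖ ^ 2 ≤ 0) →
        L w ≤ D + α / 2 * ∫ z : cylinder Ω, w.2.2 z ^ 2 ∂(cylVol Ω) := by
  obtain ⟨l, hl⟩ := exists_endpoint_functional hΩ h₀ h₁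
  obtain ⟨l', hl'⟩ : ∃ l' : JetSpace Ω →ₗ[ℝ] ℝ, ∀ w, l' w = l w.2.2 :=
    ⟨{ toFun := fun w => l w.2.2
       map_add' := fun w w' => l.map_add w.2.2 w'.2.2
       map_smul' := fun r w => l.map_smul r w.2.2 }, fun w => rfl⟩
  have hnn : ∀ q ∈ jetSubmodule hc hi, q ∈ dualSet Ω α D → l' q.1 ≤ q.2 := by
    rintro q ⟨φ, hφ, hq⟩ hqS
    rw [hl', hl φ _ hq.2.2]
    have h1 := hD φ ⟨hφ, fun t ht x hx => by
      have := hqS.1 ⟨(t, x), ht, hx⟩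
      rw [hq.1, hq.2.1] at this
      exact this⟩
    have h2 := hqS.2
    simp only [hq.2.2] at h2
    rw [integral_subtype_comap (measurableSet_cylinder hΩ)
      (fun z : ℝ × Euc d => φ z.1 z.2 ^ 2)] at h2
    rw [dualValue] at h1
    linarith
  have hz : ∀ r, ((0 : JetSpace Ω), r) ∈ jetSubmodule hc hi := fun r =>
    (jetSubmodule hc hi).zero_mem
  have hdense := exists_add_mem_dualSet hc hi α D
  have hconv := convex_dualSet hΩ hα D
  have hbd := exists_sub_mem_dualSet (Ω := Ω) hΩ hα D
  have hext := exists_continuous_extension_le_on_convex (W := JetSpace Ω) hconv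
    (jetSubmodule hc hi) hz l' hnn hdense hbd
  obtain ⟨L, hL1, hLS⟩ := hext
  refine ⟨L, fun φ w hφ hw => ?_, fun w hw =>
    hLS (w, D + α / 2 * ∫ z : cylinder Ω, w.2.2 z ^ 2 ∂(cylVol Ω)) ⟨hw, le_rfl⟩⟩
  rw [hL1 (w, 0) ⟨φ, hφ, hw⟩, hl', hl φ w.2.2 hw.2.2]

end Extension

/-! ### Averaging of test functions over noise in space-time. -/

section Averaging

variable {d : ℕ} {Ω : Set (Euc d)} {η : Euc d → ℝ} {k : ℝ → ℝ} {s : ℝ}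

/-- The density at `z` of `(1 - s) z' + ξ`, where the time component of `ξ` has density `k`, and
its space component is `s` times a variable of density `η`. -/
def spaceTimeKern (η : Euc d → ℝ) (k : ℝ → ℝ) (s : ℝ) (z z' : ℝ × Euc d) : ℝ :=
  k (z.1 - (1 - s) * z'.1) * kern η s z'.2 z.2

theorem continuous_spaceTimeKern (hη : IsBump Ω η) (hk : Continuous k) (s : ℝ) :
    Continuous fun p : (ℝ × Euc d) × (ℝ × Euc d) => spaceTimeKern η k s p.1 p.2 := by
  have h1 : Continuous fun p : (ℝ × Euc d) × (ℝ × Euc d) => kern η s p.2.2 p.1.2 :=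
    (continuous_kern hη s).comp
      (by fun_prop : Continuous fun p : (ℝ × Euc d) × (ℝ × Euc d) => (p.2.2, p.1.2))
  exact (hk.comp (by fun_prop)).mul h1

theorem spaceTimeKern_nonneg (hη : IsBump Ω η) {K : Set ℝ} (hk : IsBump K k) (hs : 0 < s)
    (z z' : ℝ × Euc d) : 0 ≤ spaceTimeKern η k s z z' :=
  mul_nonneg (hk.nonneg _) (kern_nonneg hη hs _ _)

theorem spaceTimeKern_add (η : Euc d → ℝ) (k : ℝ → ℝ) (s : ℝ) (z' ξ : ℝ × Euc d) :
    spaceTimeKern η k s ((1 - s) • z' + ξ) z' = spaceTimeKern η k s ξ 0 := by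
  simp [spaceTimeKern, kern]

/-- The noise lies in `s` times the cylinder, so `(1 - s) z' + ξ` is a convex combination of two
points of the cylinder. -/
theorem mem_image_of_spaceTimeKern_ne_zero (hη : IsBump Ω η) (hs : 0 < s)
    (hk : IsBump (Icc (s / 3) (2 * s / 3)) k) {ξ : ℝ × Euc d}
    (h : spaceTimeKern η k s ξ 0 ≠ 0) : ξ ∈ (fun z => s • z) '' cylinder Ω := by
  have h1 := hk.mem_of_ne_zero _ (left_ne_zero_of_mul h)
  obtain ⟨y, hy, hy'⟩ := exists_of_kern_ne_zero hη hs (right_ne_zero_of_mul h)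
  simp only [Prod.fst_zero, mul_zero, sub_zero] at h1
  refine ⟨(s⁻¹ * ξ.1, y), ⟨⟨?_, ?_⟩, hy⟩, ?_⟩
  · have : 0 ≤ ξ.1 := by linarith [h1.1]
    dsimp only; positivity
  · rw [← div_eq_inv_mul, div_le_one hs]; linarith [h1.2]
  · ext1
    · simp [hs.ne']
    · simpa using hy'.symm

theorem add_mem_cylinder (hc : Convex ℝ Ω) (hs : 0 < s) (hs1 : s < 1) {z' ξ : ℝ × Euc d}
    (hz : z' ∈ cylinder Ω) (hξ : ξ ∈ (fun z => s • z) '' cylinder Ω) :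
    (1 - s) • z' + ξ ∈ cylinder Ω := by
  obtain ⟨ζ, hζ, rfl⟩ := hξ
  exact convex_cylinder hc hz hζ (by linarith) hs.le (by ring)

theorem mem_cylinder_of_spaceTimeKern_ne_zero (hc : Convex ℝ Ω) (hη : IsBump Ω η) (hs : 0 < s)
    (hs1 : s < 1) (hk : IsBump (Icc (s / 3) (2 * s / 3)) k) {z z' : ℝ × Euc d}
    (hz' : z' ∈ cylinder Ω) (h : spaceTimeKern η k s z z' ≠ 0) : z ∈ cylinder Ω := by
  have e : z = (1 - s) • z' + (z - (1 - s) • z') := by abel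
  rw [e] at h ⊢
  rw [spaceTimeKern_add] at h
  exact add_mem_cylinder hc hs hs1 hz' (mem_image_of_spaceTimeKern_ne_zero hη hs hk h)

/-- The noise representation of averages. -/
theorem integral_spaceTimeKern_smul {F : Type*} [NormedAddCommGroup F] [NormedSpace ℝ F]
    (hc : Convex ℝ Ω) (hη : IsBump Ω η) (hs : 0 < s)
    (hs1 : s < 1) (hk : IsBump (Icc (s / 3) (2 * s / 3)) k) {z' : ℝ × Euc d}
    (hz' : z' ∈ cylinder Ω) (G : ℝ × Euc d → F) :
    ∫ z in cylinder Ω, spaceTimeKern η k s z z' • G z =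
      ∫ ξ in (fun z => s • z) '' cylinder Ω, spaceTimeKern η k s ξ 0 • G ((1 - s) • z' + ξ) := by
  rw [setIntegral_eq_integral_of_forall_compl_eq_zero,
    setIntegral_eq_integral_of_forall_compl_eq_zero]
  · have : (volume : Measure (ℝ × Euc d)).IsAddLeftInvariant := by
      rw [Measure.volume_eq_prod]; infer_instance
    rw [← integral_add_left_eq_self _ ((1 - s) • z')]
    simp only [spaceTimeKern_add]
  · intro ξ hξ
    by_contra h'
    exact hξ (mem_image_of_spaceTimeKern_ne_zero hη hs hk (left_ne_zero_of_smul h'))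
  · intro z hz
    by_contra h'
    exact hz (mem_cylinder_of_spaceTimeKern_ne_zero hc hη hs hs1 hk hz' (left_ne_zero_of_smul h'))

theorem integral_spaceTimeKern (hc : Convex ℝ Ω) (hη : IsBump Ω η) (hs : 0 < s)
    (hs1 : s < 1) (hk : IsBump (Icc (s / 3) (2 * s / 3)) k) {z' : ℝ × Euc d}
    (hz' : z' ∈ cylinder Ω) : ∫ z in cylinder Ω, spaceTimeKern η k s z z' = 1 := by
  rw [setIntegral_eq_integral_of_forall_compl_eq_zero]
  · simp only [spaceTimeKern]
    rw [Measure.volume_eq_prod, integral_prod_mul (fun t => k (t - (1 - s) * z'.1)),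
      integral_sub_right_eq_self k, hk.integral_eq_one, integral_kern hη hs, mul_one]
  · intro z hz
    by_contra h'
    exact hz (mem_cylinder_of_spaceTimeKern_ne_zero hc hη hs hs1 hk hz' h')

/-- The kernel is a probability density in `z`, not in `z'`: the contraction `z' ↦ (1 - s) z'` of a
`(d + 1)`-dimensional space leaves its Jacobian. This factor is the loss in the energy estimate and
tends to `1`. -/
theorem integral_spaceTimeKern_right (hη : IsBump Ω η) (hs : 0 < s)
    (hs1 : s < 1) {K : Set ℝ} (hk : IsBump K k) (z : ℝ × Euc d) :
    ∫ z', spaceTimeKern η k s z z' = (1 - s)⁻¹ ^ (d + 1) := by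
  have h1 : 0 < 1 - s := by linarith
  simp only [spaceTimeKern]
  rw [Measure.volume_eq_prod, integral_prod_mul (fun t' => k (z.1 - (1 - s) * t'))
    (fun x' => kern η s x' z.2), integral_kern_left hη hs hs1]
  have h2 := Measure.integral_comp_mul_left (fun u => k (z.1 - u)) (1 - s)
  rw [h2, integral_sub_left_eq_self k, hk.integral_eq_one, abs_of_pos (by positivity), smul_eq_mul,
    mul_one, pow_succ']

theorem setIntegral_spaceTimeKern_right_le (hη : IsBump Ω η) (hs : 0 < s)
    (hs1 : s < 1) {K : Set ℝ} (hk : IsBump K k) (z : ℝ × Euc d) :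
    ∫ z' in cylinder Ω, spaceTimeKern η k s z z' ≤ (1 - s)⁻¹ ^ (d + 1) := by
  have h1 : 0 < 1 - s := by linarith
  have h2 := integral_spaceTimeKern_right hη hs hs1 hk z
  rw [← h2]
  refine setIntegral_le_integral ?_
    (Eventually.of_forall fun z' => spaceTimeKern_nonneg hη hk hs z z')
  by_contra h'
  rw [integral_undef h'] at h2
  have : 0 < (1 - s)⁻¹ ^ (d + 1) := by positivity
  linarith

theorem integrableOn_spaceTimeKern_smul (hΩ : IsCompact Ω) (hη : IsBump Ω η) (hk : Continuous k)
    {F : Type*} [NormedAddCommGroup F] [NormedSpace ℝ F] {G : ℝ × Euc d → F}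
    (hG : ContinuousOn G (cylinder Ω)) (z' : ℝ × Euc d) :
    IntegrableOn (fun z => spaceTimeKern η k s z z' • G z) (cylinder Ω) :=
  ContinuousOn.integrableOn_compact (isCompact_cylinder hΩ)
    (((continuous_spaceTimeKern hη hk s).comp
      (by fun_prop : Continuous fun z : ℝ × Euc d => (z, z'))).continuousOn.smul hG)

/-- Jensen's inequality for the square, obtained from the nonnegativity of the variance. -/
theorem sq_norm_average_le {X F : Type*} [MeasurableSpace X] [NormedAddCommGroup F]
    [InnerProductSpace ℝ F] [CompleteSpace F] {ν : Measure X} {κ : X → ℝ} {b : X → F}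
    (h0 : ∀ x, 0 ≤ κ x) (h1 : ∫ x, κ x ∂ν = 1) (hb : Integrable (fun x => κ x • b x) ν)
    (hb2 : Integrable (fun x => κ x * ‖b x‖ ^ 2) ν) :
    ‖∫ x, κ x • b x ∂ν‖ ^ 2 ≤ ∫ x, κ x * ‖b x‖ ^ 2 ∂ν := by
  have hκ : Integrable κ ν := by
    by_contra h'
    rw [integral_undef h'] at h1
    exact zero_ne_one h1
  set c := ∫ x, κ x • b x ∂ν with hc
  have hi : Integrable (fun x => ⟪c, κ x • b x⟫) ν := hb.const_inner c
  have e : ∀ x, κ x * ‖b x - c‖ ^ 2 = κ x * ‖b x‖ ^ 2 - 2 * ⟪c, κ x • b x⟫ + κ x * ‖c‖ ^ 2 := by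
    intro x
    rw [norm_sub_sq_real, inner_smul_right, real_inner_comm]
    ring
  have h2 : 0 ≤ ∫ x, κ x * ‖b x - c‖ ^ 2 ∂ν :=
    integral_nonneg fun x => mul_nonneg (h0 x) (sq_nonneg _)
  simp only [e] at h2
  have h3 : Integrable (fun x => κ x * ‖b x‖ ^ 2 - 2 * ⟪c, κ x • b x⟫) ν :=
    hb2.sub (hi.const_mul 2)
  rw [integral_add h3 (hκ.mul_const _),
    integral_sub hb2 (hi.const_mul 2), integral_const_mul, integral_mul_const, h1,
    integral_inner hb, ← hc, real_inner_self_eq_norm_sq] at h2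
  linarith

/-- The average of `φ` against `spaceTimeKern`. -/
def average (Ω : Set (Euc d)) (η : Euc d → ℝ) (k : ℝ → ℝ) (s : ℝ) (φ : ℝ → Euc d → ℝ) (t : ℝ)
    (x : Euc d) : ℝ :=
  ∫ z in cylinder Ω, spaceTimeKern η k s z (t, x) * φ z.1 z.2

/-- In the noise representation the kernel no longer depends on `z'`, so the derivative falls on
`φ((1 - s) z' + ξ)` and brings out `1 - s`. The remainder is uniform in `ξ` because `Dφ` is
uniformly continuous on the compact cylinder. -/
theorem hasFDerivWithinAt_average (hΩ : IsCompact Ω) (hc : Convex ℝ Ω) (hi : (interior Ω).Nonempty)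
    (hη : IsBump Ω η) (hs : 0 < s) (hs1 : s < 1) (hk : IsBump (Icc (s / 3) (2 * s / 3)) k)
    {φ : ℝ → Euc d → ℝ} (hφ : IsC1 Ω φ) {z' : ℝ × Euc d} (hz' : z' ∈ cylinder Ω) :
    HasFDerivWithinAt (Function.uncurry (average Ω η k s φ))
      ((1 - s) • ∫ z in cylinder Ω, spaceTimeKern η k s z z' •
        fderivWithin ℝ (Function.uncurry φ) (cylinder Ω) z) (cylinder Ω) z' := by
  set Df := fderivWithin ℝ (Function.uncurry φ) (cylinder Ω) with hDf
  set N := (fun z : ℝ × Euc d => s • z) '' cylinder Ω with hN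
  set q : ℝ × Euc d → ℝ := fun ξ => spaceTimeKern η k s ξ 0 with hq
  have hs0 : 0 ≤ 1 - s := by linarith
  have hK := isCompact_cylinder hΩ
  have hNc : IsCompact N := hK.image (by fun_prop)
  have hDc : ContinuousOn Df (cylinder Ω) := hφ.continuousOn_fderivWithin hc hi
  have hqc : Continuous q := (continuous_spaceTimeKern hη hk.continuous s).comp
    (by fun_prop : Continuous fun z : ℝ × Euc d => (z, (0 : ℝ × Euc d)))
  have hq0 : ∀ ξ, 0 ≤ q ξ := fun ξ => spaceTimeKern_nonneg hη hk hs ξ 0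
  have hshift : ∀ y ∈ cylinder Ω, ContinuousOn (fun ξ => (1 - s) • y + ξ) N ∧
      MapsTo (fun ξ => (1 - s) • y + ξ) N (cylinder Ω) := fun y hy =>
    ⟨by fun_prop, fun ξ hξ => add_mem_cylinder hc hs hs1 hy hξ⟩
  have hav : ∀ y ∈ cylinder Ω, Function.uncurry (average Ω η k s φ) y =
      ∫ ξ in N, q ξ • Function.uncurry φ ((1 - s) • y + ξ) := fun y hy =>
    integral_spaceTimeKern_smul hc hη hs hs1 hk hy (Function.uncurry φ)
  have hi1 : ∀ y ∈ cylinder Ω,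
      IntegrableOn (fun ξ => q ξ • Function.uncurry φ ((1 - s) • y + ξ)) N := fun y hy =>
    ContinuousOn.integrableOn_compact hNc (hqc.continuousOn.smul
      (ContinuousOn.comp (ContDiffOn.continuousOn hφ) (hshift y hy).1 (hshift y hy).2))
  have hi2 : IntegrableOn (fun ξ => q ξ • Df ((1 - s) • z' + ξ)) N :=
    ContinuousOn.integrableOn_compact hNc (hqc.continuousOn.smul
      (hDc.comp (hshift z' hz').1 (hshift z' hz').2))
  have hi3 : ∀ v, IntegrableOn (fun ξ => q ξ • Df ((1 - s) • z' + ξ) v) N := fun v =>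
    (hi2.apply_continuousLinearMap v)
  have hq1 : ∫ ξ in N, q ξ = 1 := by
    have := integral_spaceTimeKern_smul hc hη hs hs1 hk hz' (fun _ => (1 : ℝ))
    simp only [smul_eq_mul, mul_one] at this
    rw [← this, integral_spaceTimeKern hc hη hs hs1 hk hz']
  rw [integral_spaceTimeKern_smul hc hη hs hs1 hk hz' Df]
  refine .of_isLittleO (Asymptotics.isLittleO_iff.2 fun ε hε => ?_)
  obtain ⟨δ, hδ, hδ'⟩ := Metric.uniformContinuousOn_iff.1
    (hK.uniformContinuousOn_of_continuous hDc) ε hε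
  filter_upwards [self_mem_nhdsWithin, mem_nhdsWithin_of_mem_nhds (Metric.ball_mem_nhds z' hδ)]
    with y hy hyδ
  have hpt : ∀ ξ ∈ N, ‖Function.uncurry φ ((1 - s) • y + ξ) - Function.uncurry φ ((1 - s) • z' + ξ)
      - Df ((1 - s) • z' + ξ) ((1 - s) • (y - z'))‖ ≤ ε * ‖y - z'‖ := by
    intro ξ hξ
    have m1 := (hshift z' hz').2 hξ
    have m2 := (hshift y hy).2 hξ
    have hle : ‖(1 - s) • (y - z')‖ ≤ ‖y - z'‖ := by
      rw [norm_smul, Real.norm_of_nonneg hs0]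
      exact mul_le_of_le_one_left (norm_nonneg _) (by linarith)
    have e : (1 - s) • y + ξ - ((1 - s) • z' + ξ) = (1 - s) • (y - z') := by
      rw [smul_sub]; abel
    have hd : dist ((1 - s) • y + ξ) ((1 - s) • z' + ξ) < δ := by
      rw [dist_eq_norm, e]
      exact hle.trans_lt (by rwa [← dist_eq_norm])
    -- Mean value inequality on the convex set cylinder intersected with a ball of radius `δ`, where
    -- `Dφ` varies by at most `ε`.
    have := Convex.norm_image_sub_le_of_norm_hasFDerivWithin_le' (𝕜 := ℝ)
      (s := cylinder Ω ∩ Metric.ball ((1 - s) • z' + ξ) δ) (f := Function.uncurry φ)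
      (f' := Df) (φ := Df ((1 - s) • z' + ξ)) (C := ε)
      (fun p hp => (hφ.hasFDerivWithinAt hp.1).mono inter_subset_left)
      (fun p hp => by
        rw [← dist_eq_norm]
        exact (hδ' p hp.1 _ m1 hp.2).le)
      ((convex_cylinder hc).inter (convex_ball _ _)) ⟨m1, Metric.mem_ball_self hδ⟩ ⟨m2, hd⟩
    rw [e] at this
    exact this.trans (mul_le_mul_of_nonneg_left hle hε.le)
  have hlin : ((1 - s) • ∫ ξ in N, q ξ • Df ((1 - s) • z' + ξ)) (y - z') =
      ∫ ξ in N, q ξ • Df ((1 - s) • z' + ξ) ((1 - s) • (y - z')) := by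
    rw [_root_.smul_apply, ContinuousLinearMap.integral_apply hi2,
      ← integral_smul]
    refine integral_congr_ae (Eventually.of_forall fun ξ => ?_)
    simp only [_root_.smul_apply, map_smul, smul_eq_mul]
    ring
  have hi4 : IntegrableOn (fun ξ => q ξ • Function.uncurry φ ((1 - s) • y + ξ) -
      q ξ • Function.uncurry φ ((1 - s) • z' + ξ)) N := (hi1 y hy).sub (hi1 z' hz')
  rw [hav y hy, hav z' hz', hlin, ← integral_sub (hi1 y hy) (hi1 z' hz'),
    ← integral_sub hi4 (hi3 _)]
  calc _ ≤ ∫ ξ in N, q ξ * (ε * ‖y - z'‖) := by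
        refine norm_integral_le_of_norm_le
          ((hqc.continuousOn.integrableOn_compact hNc).mul_const _) ?_
        filter_upwards [ae_restrict_mem hNc.measurableSet] with ξ hξ
        rw [← smul_sub, ← smul_sub, norm_smul, Real.norm_of_nonneg (hq0 ξ)]
        exact mul_le_mul_of_nonneg_left (hpt ξ hξ) (hq0 ξ)
    _ = ε * ‖y - z'‖ := by rw [integral_mul_const, hq1, one_mul]

theorem isC1_average (hΩ : IsCompact Ω) (hc : Convex ℝ Ω) (hi : (interior Ω).Nonempty)
    (hη : IsBump Ω η) (hs : 0 < s) (hs1 : s < 1) (hk : IsBump (Icc (s / 3) (2 * s / 3)) k)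
    {φ : ℝ → Euc d → ℝ} (hφ : IsC1 Ω φ) : IsC1 Ω (average Ω η k s φ) := by
  have hD := fun z' (hz' : z' ∈ cylinder Ω) =>
    hasFDerivWithinAt_average hΩ hc hi hη hs hs1 hk hφ hz'
  have hu := uniqueDiffOn_cylinder hc hi
  have hK := isCompact_cylinder hΩ
  rw [IsC1, show (1 : WithTop ℕ∞) = 0 + 1 from (zero_add 1).symm,
    contDiffOn_succ_iff_fderivWithin hu]
  refine ⟨fun z hz => (hD z hz).differentiableWithinAt, by simp, ?_⟩
  rw [contDiffOn_zero]
  refine ContinuousOn.congr ?_ fun z hz => (hD z hz).fderivWithin (hu z hz)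
  refine ContinuousOn.const_smul (g := fun z' => ∫ z in cylinder Ω, spaceTimeKern η k s z z' •
    fderivWithin ℝ (Function.uncurry φ) (cylinder Ω) z) ?_ (1 - s)
  have h1 : IntegrableOn (fun _ : ℝ × Euc d => (1 : ℝ)) (cylinder Ω) :=
    continuousOn_const.integrableOn_compact hK
  have hκ : ContinuousOn (fun p : (ℝ × Euc d) × (ℝ × Euc d) => spaceTimeKern η k s p.2 p.1)
      (cylinder Ω ×ˢ cylinder Ω) :=
    ((continuous_spaceTimeKern hη hk.continuous s).comp continuous_swap).continuousOn
  have hDf : ContinuousOn (fun p : (ℝ × Euc d) × (ℝ × Euc d) =>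
      fderivWithin ℝ (Function.uncurry φ) (cylinder Ω) p.2) (cylinder Ω ×ˢ cylinder Ω) :=
    (hφ.continuousOn_fderivWithin hc hi).comp continuousOn_snd fun p hp => hp.2
  have h2 := continuousOn_integral_smul (P := ℝ × Euc d) hK
    (exists_compact_nhdsWithin_of_isCompact hK) h1
    (G := fun z' z => spaceTimeKern η k s z z' • fderivWithin ℝ (Function.uncurry φ) (cylinder Ω) z)
    (hκ.smul hDf)
  simpa only [one_smul] using h2

theorem dt_average (hΩ : IsCompact Ω) (hc : Convex ℝ Ω) (hi : (interior Ω).Nonempty)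
    (hη : IsBump Ω η) (hs : 0 < s) (hs1 : s < 1) (hk : IsBump (Icc (s / 3) (2 * s / 3)) k)
    {φ : ℝ → Euc d → ℝ} (hφ : IsC1 Ω φ) {z' : ℝ × Euc d} (hz' : z' ∈ cylinder Ω) :
    dt (average Ω η k s φ) z'.1 z'.2 =
      ∫ z in cylinder Ω, spaceTimeKern η k s z z' * ((1 - s) * dt φ z.1 z.2) := by
  rw [dt_eq hz'.1 hz'.2 (hasFDerivWithinAt_average hΩ hc hi hη hs hs1 hk hφ hz'),
    _root_.smul_apply, ContinuousLinearMap.integral_apply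
      (integrableOn_spaceTimeKern_smul hΩ hη hk.continuous (hφ.continuousOn_fderivWithin hc hi) z'),
    ← integral_smul]
  refine setIntegral_congr_fun (measurableSet_cylinder hΩ) fun z hz => ?_
  rw [dt_eq hz.1 hz.2 (hφ.hasFDerivWithinAt hz)]
  simp only [_root_.smul_apply, smul_eq_mul]
  ring

theorem gradX_average (hΩ : IsCompact Ω) (hc : Convex ℝ Ω) (hi : (interior Ω).Nonempty)
    (hη : IsBump Ω η) (hs : 0 < s) (hs1 : s < 1) (hk : IsBump (Icc (s / 3) (2 * s / 3)) k)
    {φ : ℝ → Euc d → ℝ} (hφ : IsC1 Ω φ) {z' : ℝ × Euc d} (hz' : z' ∈ cylinder Ω) :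
    gradX Ω (average Ω η k s φ) z'.1 z'.2 =
      ∫ z in cylinder Ω, spaceTimeKern η k s z z' • ((1 - s) • gradX Ω φ z.1 z.2) := by
  refine ext_inner_left ℝ fun w => ?_
  have hgi : IntegrableOn (fun z => spaceTimeKern η k s z z' • ((1 - s) • gradX Ω φ z.1 z.2))
      (cylinder Ω) := integrableOn_spaceTimeKern_smul (s := s) hΩ hη hk.continuous
    ((hφ.continuousOn_gradX hc hi).const_smul (1 - s)) z'
  rw [real_inner_comm, inner_gradX_eq hc hi hz'.1 hz'.2
    (hasFDerivWithinAt_average hΩ hc hi hη hs hs1 hk hφ hz'), ← integral_inner hgi,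
    _root_.smul_apply, ContinuousLinearMap.integral_apply
      (integrableOn_spaceTimeKern_smul hΩ hη hk.continuous (hφ.continuousOn_fderivWithin hc hi) z'),
    ← integral_smul]
  refine setIntegral_congr_fun (measurableSet_cylinder hΩ) fun z hz => ?_
  have h1 := inner_gradX_eq hc hi hz.1 hz.2 (hφ.hasFDerivWithinAt hz) w
  simp only [_root_.smul_apply, smul_eq_mul, inner_smul_right]
  rw [real_inner_comm, h1]
  ring

/-- By Fubini, averaging the test function at an endpoint turns the endpoint density into a source
spread over space-time. -/
theorem integral_average_endpoint (hΩ : IsCompact Ω)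
    (hη : IsBump Ω η) (hk : Continuous k)
    {φ : ℝ → Euc d → ℝ} (hφ : IsC1 Ω φ) {h : Euc d → ℝ} (hh : IntegrableOn h Ω) (t' : ℝ) :
    ∫ x in Ω, average Ω η k s φ t' x * h x =
      ∫ z in cylinder Ω, φ z.1 z.2 * (k (z.1 - (1 - s) * t') * smear Ω η s h z.2) := by
  have hG : ContinuousOn (Function.uncurry fun (z : ℝ × Euc d) (x : Euc d) =>
      spaceTimeKern η k s z (t', x) * φ z.1 z.2) (cylinder Ω ×ˢ Ω) := by
    refine ContinuousOn.mul ?_ (hφ.continuousOn.comp continuousOn_fst fun p hp => hp.1)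
    exact ((continuous_spaceTimeKern hη hk s).comp
      (by fun_prop : Continuous fun p : (ℝ × Euc d) × Euc d => (p.1, (t', p.2)))).continuousOn
  have hsw := integral_integral_swap (f := fun z x =>
      h x * (spaceTimeKern η k s z (t', x) * φ z.1 z.2))
    (integrable_mul_of_continuousOn (ν := volume) (isCompact_cylinder hΩ) hΩ hh hG)
  calc _ = ∫ x in Ω, ∫ z in cylinder Ω, h x * (spaceTimeKern η k s z (t', x) * φ z.1 z.2) := by
        refine integral_congr_ae (Eventually.of_forall fun x => ?_)
        simp only [average]
        rw [integral_const_mul, mul_comm]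
    _ = _ := by
        rw [← hsw]
        refine integral_congr_ae (Eventually.of_forall fun z => ?_)
        simp only [spaceTimeKern, smear]
        rw [← integral_const_mul, ← integral_const_mul]
        refine integral_congr_ae (Eventually.of_forall fun x => ?_)
        simp only
        ring

end Averaging

/-! ### Continuous densities representing the functional on averaged triples. -/

section Representation

/-- A continuous functional on `C(X, F)`, restricted to the functions generated by a continuous
kernel `κ`, is given by a continuous function. -/
theorem exists_kernel_representation {X Z F : Type*} [TopologicalSpace X] [CompactSpace X]
    [TopologicalSpace Z] [MeasurableSpace Z] [OpensMeasurableSpace Z] [T2Space Z]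
    [TopologicalSpace.PseudoMetrizableSpace Z] [NormedAddCommGroup F]
    [InnerProductSpace ℝ F] [FiniteDimensional ℝ F] (L : C(X, F) →L[ℝ] ℝ) {κ : Z → X → ℝ}
    (hκ : Continuous (Function.uncurry κ)) :
    ∃ m : Z → F, Continuous m ∧
      (∀ (z : Z) (e : F) (w : C(X, F)), (∀ x, w x = κ z x • e) → L w = ⟪e, m z⟫) ∧
      ∀ (ν : Measure Z) [IsFiniteMeasureOnCompacts ν] (S : Set Z) (a : Z → F), IsCompact S →
        ContinuousOn a S → ∃ w : C(X, F), (∀ x, w x = ∫ z in S, κ z x • a z ∂ν) ∧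
          L w = ∫ z in S, ⟪a z, m z⟫ ∂ν := by
  have hcompl : CompleteSpace F := FiniteDimensional.complete ℝ F
  -- Currying makes `(z, e) ↦ κ z · e` continuous into `C(X, F)`. So `L ∘ J` is continuous in `z`,
  -- linear in `e`, and is represented in an orthonormal basis.
  let J : C(Z × F, C(X, F)) := ContinuousMap.curry
    ⟨fun p : (Z × F) × X => κ p.1.1 p.2 • p.1.2,
      (hκ.comp (by fun_prop : Continuous fun p : (Z × F) × X => (p.1.1, p.2))).smul (by fun_prop)⟩
  have hJ : ∀ z e x, J (z, e) x = κ z x • e := fun z e x => rfl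
  let b := stdOrthonormalBasis ℝ F
  have hrep : ∀ z e, L (J (z, e)) = ⟪e, ∑ i, L (J (z, b i)) • b i⟫ := by
    intro z e
    have h1 : J (z, e) = ∑ i, ⟪b i, e⟫ • J (z, b i) := by
      ext1 x
      rw [ContinuousMap.sum_apply]
      simp only [ContinuousMap.smul_apply, hJ]
      conv_lhs => rw [← b.sum_repr' e, Finset.smul_sum]
      exact Finset.sum_congr rfl fun i _ => smul_comm _ _ _
    rw [h1, map_sum, inner_sum]
    refine Finset.sum_congr rfl fun i _ => ?_
    rw [map_smul, inner_smul_right, smul_eq_mul, mul_comm, real_inner_comm]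
  refine ⟨fun z => ∑ i, L (J (z, b i)) • b i, ?_, fun z e w hw => ?_, fun ν _ S a hS ha => ?_⟩
  · refine continuous_finsetSum _ fun i _ => Continuous.smul ?_ continuous_const
    exact L.continuous.comp (J.continuous.comp (by fun_prop))
  · rw [← hrep]
    congr 1
    ext1 x
    rw [hw, hJ]
  -- The averaged function is a Bochner integral in `C(X, F)`, which commutes both with `L` and with
  -- point evaluations.
  · have hg : IntegrableOn (fun z => J (z, a z)) S ν :=
      ContinuousOn.integrableOn_compact hS
        (J.continuous.comp_continuousOn (continuousOn_id.prodMk ha))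
    refine ⟨∫ z in S, J (z, a z) ∂ν, fun x => ?_, ?_⟩
    · exact ((ContinuousMap.evalCLM ℝ x).integral_comp_comm hg).symm
    · rw [← L.integral_comp_comm hg]
      exact integral_congr_ae (Eventually.of_forall fun z => hrep z (a z))

theorem ContinuousLinearMap.exists_sum_of_prod {A B C : Type*} [NormedAddCommGroup A]
    [NormedSpace ℝ A] [NormedAddCommGroup B] [NormedSpace ℝ B] [NormedAddCommGroup C]
    [NormedSpace ℝ C] (L : A × B × C →L[ℝ] ℝ) :
    ∃ (L₁ : A →L[ℝ] ℝ) (L₂ : B →L[ℝ] ℝ) (L₃ : C →L[ℝ] ℝ),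
      ∀ w, L w = L₁ w.1 + L₂ w.2.1 + L₃ w.2.2 := by
  refine ⟨L.comp (.inl ℝ A (B × C)), (L.comp (.inr ℝ A (B × C))).comp (.inl ℝ B C),
    (L.comp (.inr ℝ A (B × C))).comp (.inr ℝ B C), fun w => ?_⟩
  simp only [ContinuousLinearMap.comp_apply, ContinuousLinearMap.inl_apply,
    ContinuousLinearMap.inr_apply, ← map_add]
  simp

variable {d : ℕ} {Ω : Set (Euc d)} {η : Euc d → ℝ} {k : ℝ → ℝ} {s : ℝ}

/-- A triple of fields represents a functional on the jets generated by `spaceTimeKern`. -/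
structure Represents (η : Euc d → ℝ) (k : ℝ → ℝ) (s : ℝ) (L : JetSpace Ω → ℝ)
    (μ : ℝ × Euc d → ℝ) (m : ℝ × Euc d → Euc d) (f : ℝ × Euc d → ℝ) : Prop where
  continuous_density : Continuous μ
  continuous_momentum : Continuous m
  continuous_source : Continuous f
  exists_point : ∀ z (a : ℝ) (b : Euc d) (c : ℝ), ∃ w : JetSpace Ω,
    (∀ z' : cylinder Ω, w.1 z' = spaceTimeKern η k s z z' * a) ∧
    (∀ z' : cylinder Ω, w.2.1 z' = spaceTimeKern η k s z z' • b) ∧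
    (∀ z' : cylinder Ω, w.2.2 z' = spaceTimeKern η k s z z' * c) ∧
    L w = a * μ z + ⟪b, m z⟫ + c * f z
  exists_integral : ∀ (a : ℝ × Euc d → ℝ) (b : ℝ × Euc d → Euc d) (c : ℝ × Euc d → ℝ),
    ContinuousOn a (cylinder Ω) → ContinuousOn b (cylinder Ω) → ContinuousOn c (cylinder Ω) →
    ∃ w : JetSpace Ω,
      (∀ z' : cylinder Ω, w.1 z' = ∫ z in cylinder Ω, spaceTimeKern η k s z z' * a z) ∧
      (∀ z' : cylinder Ω, w.2.1 z' = ∫ z in cylinder Ω, spaceTimeKern η k s z z' • b z) ∧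
      (∀ z' : cylinder Ω, w.2.2 z' = ∫ z in cylinder Ω, spaceTimeKern η k s z z' * c z) ∧
      L w = ∫ z in cylinder Ω, (a z * μ z + ⟪b z, m z⟫ + c z * f z)

theorem exists_represents (hΩ : IsCompact Ω) [CompactSpace (cylinder Ω)] (hη : IsBump Ω η)
    (hk : Continuous k) (s : ℝ) (L : JetSpace Ω →L[ℝ] ℝ) :
    ∃ μ m f, Represents η k s L μ m f := by
  have hK := isCompact_cylinder hΩ
  have hκ : Continuous (Function.uncurry fun (z : ℝ × Euc d) (z' : cylinder Ω) =>
      spaceTimeKern η k s z z') :=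
    (continuous_spaceTimeKern hη hk s).comp
      (by fun_prop : Continuous fun p : (ℝ × Euc d) × cylinder Ω => (p.1, (p.2 : ℝ × Euc d)))
  have hκ1 : ∀ z, Continuous fun z' : cylinder Ω => spaceTimeKern η k s z z' := fun z =>
    hκ.comp (by fun_prop : Continuous fun z' : cylinder Ω => (z, z'))
  obtain ⟨L₁, L₂, L₃, hL⟩ := ContinuousLinearMap.exists_sum_of_prod L
  obtain ⟨μ, hμ, hμ1, hμ2⟩ := exists_kernel_representation L₁ hκ
  obtain ⟨m, hm, hm1, hm2⟩ := exists_kernel_representation L₂ hκ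
  obtain ⟨f, hf, hf1, hf2⟩ := exists_kernel_representation L₃ hκ
  have hcomm : ∀ x y : ℝ, ⟪x, y⟫ = x * y := fun x y => by simp [mul_comm]
  refine ⟨μ, m, f, hμ, hm, hf, fun z a b c => ?_, fun a b c ha hb hc => ?_⟩
  · refine ⟨(⟨fun z' => spaceTimeKern η k s z z' * a, (hκ1 z).mul continuous_const⟩,
      ⟨fun z' => spaceTimeKern η k s z z' • b, (hκ1 z).smul continuous_const⟩,
      ⟨fun z' => spaceTimeKern η k s z z' * c, (hκ1 z).mul continuous_const⟩),
      fun _ => rfl, fun _ => rfl, fun _ => rfl, ?_⟩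
    rw [hL, hμ1 z a _ fun _ => rfl, hm1 z b _ fun _ => rfl, hf1 z c _ fun _ => rfl, hcomm, hcomm]
  · obtain ⟨w1, e1, l1⟩ := hμ2 volume _ a hK ha
    obtain ⟨w2, e2, l2⟩ := hm2 volume _ b hK hb
    obtain ⟨w3, e3, l3⟩ := hf2 volume _ c hK hc
    refine ⟨(w1, w2, w3), e1, e2, e3, ?_⟩
    rw [hL, l1, l2, l3]
    simp only [hcomm]
    have i1 : IntegrableOn (fun z => a z * μ z) (cylinder Ω) :=
      (ha.mul hμ.continuousOn).integrableOn_compact hK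
    have i2 : IntegrableOn (fun z => ⟪b z, m z⟫) (cylinder Ω) :=
      (hb.inner hm.continuousOn).integrableOn_compact hK
    have i3 : IntegrableOn (fun z => c z * f z) (cylinder Ω) :=
      (hc.mul hf.continuousOn).integrableOn_compact hK
    have i4 : IntegrableOn (fun z => a z * μ z + ⟪b z, m z⟫) (cylinder Ω) := i1.add i2
    rw [integral_add i4 i3, integral_add i1 i2]

/-- The bound of a functional on the jets of subsolutions. -/
def IsDualBound (α D : ℝ) (L : JetSpace Ω → ℝ) : Prop :=
  ∀ w : JetSpace Ω, (∀ z, w.1 z + 1 / 2 * ‖w.2.1 z‖ ^ 2 ≤ 0) →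
    L w ≤ D + α / 2 * ∫ z : cylinder Ω, w.2.2 z ^ 2 ∂(cylVol Ω)

theorem nonpos_of_forall_mul_le {x D : ℝ} (h : ∀ r > 0, r * x ≤ D) : x ≤ 0 := by
  by_contra! hx
  have h1 := h ((|D| + 1) / x) (by positivity)
  rw [div_mul_cancel₀ _ hx.ne'] at h1
  linarith [le_abs_self D]

variable {α D : ℝ} {L : JetSpace Ω → ℝ} {μ f : ℝ × Euc d → ℝ} {m : ℝ × Euc d → Euc d}

/-- The triple `(-r κ, 0, 0)` satisfies the Hamilton-Jacobi inequality for every `r > 0`, so `-r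
μ(z) ≤ D` for all such `r`. -/
theorem Represents.density_nonneg (hη : IsBump Ω η) (hs : 0 < s) {K : Set ℝ} (hk : IsBump K k)
    (hr : Represents η k s L μ m f) (hL : IsDualBound α D L) (z : ℝ × Euc d) : 0 ≤ μ z := by
  rw [← neg_nonpos]
  refine nonpos_of_forall_mul_le (D := D) fun r hr0 => ?_
  obtain ⟨w, h1, h2, h3, h4⟩ := hr.exists_point z (-r) 0 0
  have h5 := hL w fun z' => by
    have := spaceTimeKern_nonneg hη hk hs z z'
    rw [h1, h2]
    simp only [smul_zero, norm_zero]
    nlinarith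
  rw [h4] at h5
  simp only [h3] at h5
  simp only [inner_zero_left, mul_zero, zero_mul, add_zero, ne_eq, OfNat.ofNat_ne_zero,
    not_false_eq_true, zero_pow, integral_zero] at h5
  linarith

/-- Test with momentum component `r κ m(z)`. If `κ ≤ M`, a density component `-½ r² M ‖m(z)‖² κ`
pays for it; as `μ(z) = 0` this costs nothing, and `r ‖m(z)‖² ≤ D` for all `r > 0`. -/
theorem Represents.momentum_eq_zero (hΩ : IsCompact Ω) (hη : IsBump Ω η) (hs : 0 < s) {K : Set ℝ}
    (hk : IsBump K k) (hr : Represents η k s L μ m f) (hL : IsDualBound α D L) {z : ℝ × Euc d}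
    (hz : μ z = 0) : m z = 0 := by
  obtain ⟨M, hM⟩ := (isCompact_cylinder hΩ).exists_bound_of_continuousOn
    ((continuous_spaceTimeKern hη hk.continuous s).comp
      (by fun_prop : Continuous fun z' : ℝ × Euc d => (z, z'))).continuousOn
  have key : ‖m z‖ ^ 2 ≤ 0 := by
    refine nonpos_of_forall_mul_le (D := D) fun r hr0 => ?_
    obtain ⟨w, h1, h2, h3, h4⟩ := hr.exists_point z (-(1 / 2 * r ^ 2 * M * ‖m z‖ ^ 2)) (r • m z) 0
    have h5 := hL w fun z' => by
      have e1 := spaceTimeKern_nonneg hη hk hs z z'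
      have e2 := (le_abs_self _).trans (hM z' z'.2)
      simp only [Function.comp_apply] at e2
      rw [h1, h2, norm_smul, norm_smul, Real.norm_of_nonneg e1, Real.norm_of_nonneg hr0.le]
      have e3 : 0 ≤ spaceTimeKern η k s z z' * (M - spaceTimeKern η k s z z') :=
        mul_nonneg e1 (by linarith)
      have e4 : 0 ≤ r ^ 2 * ‖m z‖ ^ 2 := by positivity
      nlinarith [mul_nonneg e3 e4]
    rw [h4, hz, real_inner_smul_left, real_inner_self_eq_norm_sq] at h5
    simp only [h3] at h5
    simp only [mul_zero, zero_mul, add_zero, zero_add, ne_eq, OfNat.ofNat_ne_zero,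
      not_false_eq_true, zero_pow, integral_zero] at h5
    exact h5
  have : ‖m z‖ = 0 := by nlinarith [norm_nonneg (m z)]
  exact norm_eq_zero.1 this

/-- Evaluate `L` on the average of `(-½‖b‖², b, c)`. Jensen in the middle component keeps the
Hamilton-Jacobi inequality; Jensen and Fubini in the last one produce the Jacobian factor. -/
theorem Represents.integral_le (hΩ : IsCompact Ω) (hc : Convex ℝ Ω) (hη : IsBump Ω η)
    (hs : 0 < s) (hs1 : s < 1) (hk : IsBump (Icc (s / 3) (2 * s / 3)) k)
    (hr : Represents η k s L μ m f) (hα : 0 < α) (hL : IsDualBound α D L)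
    {b : ℝ × Euc d → Euc d} {c : ℝ × Euc d → ℝ} (hb : Continuous b) (hcc : Continuous c) :
    ∫ z in cylinder Ω, (-(1 / 2 * ‖b z‖ ^ 2) * μ z + ⟪b z, m z⟫ + c z * f z) ≤
      D + α / 2 * (1 - s)⁻¹ ^ (d + 1) * ∫ z in cylinder Ω, c z ^ 2 := by
  have hK := isCompact_cylinder hΩ
  have hint : ∀ {g : ℝ × Euc d → ℝ}, Continuous g → ∀ z', IntegrableOn (fun z =>
      spaceTimeKern η k s z z' * g z) (cylinder Ω) := fun {g} hg z' =>
    integrableOn_spaceTimeKern_smul hΩ hη hk.continuous hg.continuousOn z'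
  obtain ⟨w, h1, h2, h3, h4⟩ := hr.exists_integral (fun z => -(1 / 2 * ‖b z‖ ^ 2)) b c
    (by fun_prop) hb.continuousOn hcc.continuousOn
  rw [← h4]
  refine (hL w fun z' => ?_).trans ?_
  · have := sq_norm_average_le (ν := volume.restrict (cylinder Ω))
      (fun z => spaceTimeKern_nonneg hη hk hs z z')
      (integral_spaceTimeKern hc hη hs hs1 hk z'.2)
      (integrableOn_spaceTimeKern_smul hΩ hη hk.continuous hb.continuousOn _)
      (hint (hb.norm.pow 2) _)
    rw [h1, h2]
    have e : ∫ z in cylinder Ω, spaceTimeKern η k s z z' * -(1 / 2 * ‖b z‖ ^ 2) =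
        -(1 / 2) * ∫ z in cylinder Ω, spaceTimeKern η k s z z' * ‖b z‖ ^ 2 := by
      rw [← integral_const_mul]
      congr 1 with z
      ring
    rw [e]
    linarith
  · have hG : ContinuousOn (Function.uncurry fun z' z : ℝ × Euc d =>
        spaceTimeKern η k s z z' * c z ^ 2) (cylinder Ω ×ˢ cylinder Ω) :=
      (((continuous_spaceTimeKern hη hk.continuous s).comp continuous_swap).mul
        ((hcc.comp continuous_snd).pow 2)).continuousOn
    have hsw : Integrable (Function.uncurry fun z' z : ℝ × Euc d =>
        spaceTimeKern η k s z z' * c z ^ 2)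
        ((volume.restrict (cylinder Ω)).prod (volume.restrict (cylinder Ω))) := by
      have := integrable_mul_of_continuousOn (ν := volume) (ν' := volume) hK hK
        (continuousOn_const.integrableOn_compact hK : IntegrableOn (fun _ => (1 : ℝ)) _) hG
      simp only [one_mul] at this
      exact this
    have e1 : ∫ z' : cylinder Ω, w.2.2 z' ^ 2 ∂(cylVol Ω) =
        ∫ z' in cylinder Ω, (∫ z in cylinder Ω, spaceTimeKern η k s z z' * c z) ^ 2 := by
      simp only [h3]
      exact integral_subtype_comap (measurableSet_cylinder hΩ) fun z' : ℝ × Euc d =>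
        (∫ z in cylinder Ω, spaceTimeKern η k s z z' * c z) ^ 2
    have e2 : ∫ z' in cylinder Ω, (∫ z in cylinder Ω, spaceTimeKern η k s z z' * c z) ^ 2 ≤
        ∫ z' in cylinder Ω, ∫ z in cylinder Ω, spaceTimeKern η k s z z' * c z ^ 2 := by
      refine integral_mono_of_nonneg (Eventually.of_forall fun z' => sq_nonneg _)
        hsw.integral_prod_left ?_
      filter_upwards [ae_restrict_mem (measurableSet_cylinder hΩ)] with z' hz'
      have := sq_norm_average_le (ν := volume.restrict (cylinder Ω)) (b := c)
        (fun z => spaceTimeKern_nonneg hη hk hs z z')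
        (integral_spaceTimeKern hc hη hs hs1 hk hz') (hint hcc _) (hint (hcc.norm.pow 2) _)
      simpa only [Real.norm_eq_abs, sq_abs, smul_eq_mul] using this
    have e3 : ∫ z in cylinder Ω, ∫ z' in cylinder Ω, spaceTimeKern η k s z z' * c z ^ 2 ≤
        (1 - s)⁻¹ ^ (d + 1) * ∫ z in cylinder Ω, c z ^ 2 := by
      rw [← integral_const_mul]
      refine integral_mono_of_nonneg (Eventually.of_forall fun z => integral_nonneg fun z' =>
        mul_nonneg (spaceTimeKern_nonneg hη hk hs z z') (sq_nonneg _))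
        ((continuous_const.mul (hcc.pow 2)).continuousOn.integrableOn_compact hK)
        (Eventually.of_forall fun z => ?_)
      simp only [integral_mul_const]
      exact mul_le_mul_of_nonneg_right (setIntegral_spaceTimeKern_right_le hη hs hs1 hk z)
        (sq_nonneg _)
    rw [integral_integral_swap hsw] at e2
    rw [e1]
    have := mul_le_mul_of_nonneg_left (e2.trans e3) (half_pos hα).le
    linarith

end Representation

/-! ### Energy bound and continuity equation for the regularized fields. -/

section Interior

variable {d : ℕ} {Ω : Set (Euc d)} {η : Euc d → ℝ} {k : ℝ → ℝ} {s α D : ℝ} {L : JetSpace Ω → ℝ}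
  {μ f : ℝ × Euc d → ℝ} {m : ℝ × Euc d → Euc d}

/-- Monotone convergence. The hypothesis `hgh` makes the approximations vanish where `h = 0`,
matching the convention `0 / 0 = 0`. -/
theorem tendsto_lintegral_div_add {X : Type*} [MeasurableSpace X] {ν : Measure X} {g h : X → ℝ}
    (hg : Measurable g) (hh : Measurable h) (hg0 : ∀ x, 0 ≤ g x) (hh0 : ∀ x, 0 ≤ h x)
    (hgh : ∀ x, h x = 0 → g x = 0) :
    Tendsto (fun n : ℕ => ∫⁻ x, ENNReal.ofReal (g x / (h x + 1 / (n + 1))) ∂ν) atTop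
      (𝓝 (∫⁻ x, ENNReal.ofReal (g x / h x) ∂ν)) := by
  refine lintegral_tendsto_of_tendsto_of_monotone (fun n => ?_)
    (Eventually.of_forall fun x n n' hn => ?_) (Eventually.of_forall fun x => ?_)
  · exact (ENNReal.measurable_ofReal.comp (hg.div (hh.add_const _))).aemeasurable
  · have h1 : (0 : ℝ) < 1 / (n' + 1) := by positivity
    have h2 : (1 : ℝ) / (n' + 1) ≤ 1 / (n + 1) := one_div_le_one_div_of_le (by positivity)
      (by exact_mod_cast Nat.succ_le_succ hn)
    exact ENNReal.ofReal_le_ofReal (div_le_div_of_nonneg_left (hg0 x)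
      (by linarith [hh0 x]) (by linarith))
  · refine ENNReal.tendsto_ofReal ?_
    rcases eq_or_ne (h x) 0 with h0 | h0
    · simp [hgh x h0]
    · refine tendsto_const_nhds.div ?_ h0
      simpa using tendsto_const_nhds.add (tendsto_one_div_add_atTop_nhds_zero_nat (𝕜 := ℝ))

/-- The optimal test fields are `b = m / μ` and `c = f / β` with `β = α (1 - s)⁻¹ ^ (d + 1)`. To
stay continuous, `μ` is replaced by `μ + ε` in the quotient, and `ε → 0` at the end. -/
theorem Represents.lintegral_energy_le (hΩ : IsCompact Ω) (hc : Convex ℝ Ω) (hη : IsBump Ω η)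
    (hs : 0 < s) (hs1 : s < 1) (hk : IsBump (Icc (s / 3) (2 * s / 3)) k)
    (hr : Represents η k s L μ m f) (hα : 0 < α) (hL : IsDualBound α D L) :
    (∫⁻ z in cylinder Ω, ENNReal.ofReal (‖m z‖ ^ 2 / μ z)) +
      ENNReal.ofReal (1 / (α * (1 - s)⁻¹ ^ (d + 1))) *
        ∫⁻ z in cylinder Ω, ENNReal.ofReal (|f z| ^ 2) ≤ ENNReal.ofReal (2 * D) := by
  have hK := isCompact_cylinder hΩ
  set β := α * (1 - s)⁻¹ ^ (d + 1) with hβ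
  have hβ0 : 0 < β := by
    have : 0 < 1 - s := by linarith
    positivity
  have hμ := hr.density_nonneg hη hs hk hL
  have hlim := tendsto_lintegral_div_add (ν := volume.restrict (cylinder Ω))
    (g := fun z => ‖m z‖ ^ 2) (h := μ) (hr.continuous_momentum.norm.pow 2).measurable
    hr.continuous_density.measurable (fun z => sq_nonneg _) hμ
    (fun z hz => by simp [hr.momentum_eq_zero hΩ hη hs hk hL hz])
  refine le_of_tendsto (hlim.add_const _) (Eventually.of_forall fun n => ?_)
  set ε : ℝ := 1 / (n + 1) with hε
  have hε0 : 0 < ε := by positivity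
  have hpos : ∀ z, 0 < μ z + ε := fun z => by linarith [hμ z]
  have hinv : Continuous fun z => (μ z + ε)⁻¹ :=
    (hr.continuous_density.add continuous_const).inv₀ fun z => (hpos z).ne'
  have hb : Continuous fun z => (μ z + ε)⁻¹ • m z := hinv.smul hr.continuous_momentum
  have hcc : Continuous fun z => β⁻¹ * f z := continuous_const.mul hr.continuous_source
  have h1 := hr.integral_le hΩ hc hη hs hs1 hk hα hL hb hcc
  have i1 : IntegrableOn (fun z => ‖m z‖ ^ 2 / (μ z + ε)) (cylinder Ω) := by
    refine ContinuousOn.integrableOn_compact hK (Continuous.continuousOn ?_)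
    simp only [div_eq_mul_inv]
    exact (hr.continuous_momentum.norm.pow 2).mul hinv
  have i2 : IntegrableOn (fun z => |f z| ^ 2) (cylinder Ω) :=
    (hr.continuous_source.abs.pow 2).continuousOn.integrableOn_compact hK
  have i3 : IntegrableOn (fun z => -(1 / 2 * ‖(μ z + ε)⁻¹ • m z‖ ^ 2) * μ z +
      ⟪(μ z + ε)⁻¹ • m z, m z⟫ + β⁻¹ * f z * f z) (cylinder Ω) :=
    ((((continuous_const.mul (hb.norm.pow 2)).neg.mul
      hr.continuous_density).add (hb.inner hr.continuous_momentum)).add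
        (hcc.mul hr.continuous_source)).continuousOn.integrableOn_compact hK
  have h2 : ∫ z in cylinder Ω, (1 / 2 * (‖m z‖ ^ 2 / (μ z + ε)) + β⁻¹ * |f z| ^ 2) ≤
      ∫ z in cylinder Ω, (-(1 / 2 * ‖(μ z + ε)⁻¹ • m z‖ ^ 2) * μ z +
        ⟪(μ z + ε)⁻¹ • m z, m z⟫ + β⁻¹ * f z * f z) := by
    refine integral_mono ((i1.const_mul _).add (i2.const_mul _)) i3 fun z => ?_
    simp only
    rw [norm_smul, real_inner_smul_left, real_inner_self_eq_norm_sq, sq_abs, Real.norm_of_nonneg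
      (inv_nonneg.2 (hpos z).le)]
    have e1 : (μ z + ε)⁻¹ * μ z ≤ 1 := by
      rw [inv_mul_le_one₀ (hpos z)]; linarith
    have e2 : 0 ≤ (μ z + ε)⁻¹ * ‖m z‖ ^ 2 :=
      mul_nonneg (inv_nonneg.2 (hpos z).le) (sq_nonneg _)
    rw [div_eq_mul_inv (‖m z‖ ^ 2)]
    nlinarith [mul_nonneg e2 (sub_nonneg.2 e1)]
  have h3 : ∫ z in cylinder Ω, (β⁻¹ * f z) ^ 2 = β⁻¹ ^ 2 * ∫ z in cylinder Ω, |f z| ^ 2 := by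
    rw [← integral_const_mul]
    congr 1 with z
    rw [sq_abs, mul_pow]
  rw [integral_add (i1.const_mul _) (i2.const_mul _), integral_const_mul, integral_const_mul] at h2
  rw [h3] at h1
  have h4 : α / 2 * (1 - s)⁻¹ ^ (d + 1) * (β⁻¹ ^ 2 * ∫ z in cylinder Ω, |f z| ^ 2) =
      1 / 2 * (β⁻¹ * ∫ z in cylinder Ω, |f z| ^ 2) := by
    have : α / 2 * (1 - s)⁻¹ ^ (d + 1) = 1 / 2 * β := by rw [hβ]; ring
    rw [this]
    field_simp
  rw [h4] at h1
  have j1 : 0 ≤ ∫ z in cylinder Ω, ‖m z‖ ^ 2 / (μ z + ε) :=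
    integral_nonneg fun z => div_nonneg (sq_nonneg _) (hpos z).le
  have j2 : 0 ≤ ∫ z in cylinder Ω, |f z| ^ 2 := integral_nonneg fun z => sq_nonneg _
  rw [← ofReal_integral_eq_lintegral_ofReal i1
      (Eventually.of_forall fun z => div_nonneg (sq_nonneg _) (hpos z).le),
    ← ofReal_integral_eq_lintegral_ofReal i2 (Eventually.of_forall fun z => sq_nonneg _),
    ← ENNReal.ofReal_mul (by positivity), ← ENNReal.ofReal_add j1 (by positivity), one_div]
  exact ENNReal.ofReal_le_ofReal (by linarith)

/-- The time noise lies in `[s / 3, 2 s / 3]`, so `(1 - s) t'` plus noise never equals `0` or `1`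
for `t' ∈ [0, 1]`. The kernel vanishes and `L` is evaluated at zero. -/
theorem Represents.density_eq_zero (hs : 0 < s) (hs1 : s < 1)
    (hk : IsBump (Icc (s / 3) (2 * s / 3)) k)
    (hr : Represents η k s L μ m f) (hL0 : L 0 = 0) {z : ℝ × Euc d} (hz : z.1 = 0 ∨ z.1 = 1) :
    μ z = 0 := by
  obtain ⟨w, h1, h2, h3, h4⟩ := hr.exists_point z 1 0 0
  have hκ : ∀ z' : cylinder Ω, spaceTimeKern η k s z z' = 0 := by
    intro z'
    by_contra h
    have h5 := hk.mem_of_ne_zero _ (left_ne_zero_of_mul h)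
    have h6 : 0 ≤ (1 - s) * z'.1.1 := mul_nonneg (by linarith) z'.2.1.1
    have h7 : (1 - s) * z'.1.1 ≤ 1 - s := mul_le_of_le_one_right (by linarith) z'.2.1.2
    rcases hz with hz | hz <;> rw [hz] at h5
    · linarith [h5.1]
    · linarith [h5.2]
  have hw : w = 0 := by
    refine Prod.ext (ContinuousMap.ext fun z' => ?_) (Prod.ext (ContinuousMap.ext fun z' => ?_)
      (ContinuousMap.ext fun z' => ?_))
    · rw [h1, hκ]; simp
    · rw [h2, hκ]; simp
    · rw [h3, hκ]; simp
  rw [hw, hL0] at h4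
  simpa using h4.symm

/-- Evaluate `L` in two ways on the jet of the averaged test function: by its densities, and by the
endpoint pairing, whose data become smeared sources. The factors `1 - s` are the chain rule. -/
theorem Represents.integral_jet_eq (hΩ : IsCompact Ω) (hc : Convex ℝ Ω)
    (hi : (interior Ω).Nonempty) (hη : IsBump Ω η)
    (hs : 0 < s) (hs1 : s < 1) (hk : IsBump (Icc (s / 3) (2 * s / 3)) k)
    (hr : Represents η k s L μ m f)
    {μ₀ μ₁ : Euc d → ℝ} (h₀ : IntegrableOn μ₀ Ω) (h₁ : IntegrableOn μ₁ Ω)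
    (hjet : ∀ φ w, IsC1 Ω φ → IsJet φ w → L w = ∫ x in Ω, (φ 1 x * μ₁ x - φ 0 x * μ₀ x))
    {φ : ℝ → Euc d → ℝ} (hφ : IsC1 Ω φ) :
    ∫ z in cylinder Ω, ((1 - s) * dt φ z.1 z.2 * μ z + ⟪(1 - s) • gradX Ω φ z.1 z.2, m z⟫ +
        φ z.1 z.2 * f z) =
      (∫ z in cylinder Ω, φ z.1 z.2 * (k (z.1 - (1 - s)) * smear Ω η s μ₁ z.2)) -
        ∫ z in cylinder Ω, φ z.1 z.2 * (k z.1 * smear Ω η s μ₀ z.2) := by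
  have hφa := isC1_average hΩ hc hi hη hs hs1 hk hφ
  obtain ⟨w, e1, e2, e3, e4⟩ := hr.exists_integral (fun z => (1 - s) * dt φ z.1 z.2)
    (fun z => (1 - s) • gradX Ω φ z.1 z.2) (fun z => φ z.1 z.2)
    (continuousOn_const.mul (hφ.continuousOn_dt hc hi))
    ((hφ.continuousOn_gradX hc hi).const_smul (1 - s)) hφ.continuousOn
  rw [hjet _ w hφa ⟨fun z' => by rw [e1, dt_average hΩ hc hi hη hs hs1 hk hφ z'.2],
    fun z' => by rw [e2, gradX_average hΩ hc hi hη hs hs1 hk hφ z'.2], fun z' => by rw [e3]; rfl⟩]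
    at e4
  have hslice : ∀ t ∈ Icc (0 : ℝ) 1, ContinuousOn (average Ω η k s φ t) Ω := fun t ht =>
    hφa.continuousOn.comp (f := fun x => (t, x)) (by fun_prop) fun x hx => ⟨ht, hx⟩
  rw [integral_sub (h₁.continuousOn_mul (hslice 1 ⟨zero_le_one, le_rfl⟩) hΩ)
      (h₀.continuousOn_mul (hslice 0 ⟨le_rfl, zero_le_one⟩) hΩ),
    integral_average_endpoint hΩ hη hk.continuous hφ h₁,
    integral_average_endpoint hΩ hη hk.continuous hφ h₀] at e4
  simp only [mul_one, mul_zero, sub_zero] at e4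
  exact e4.symm

/-- The chain-rule factor is absorbed into density and momentum but not into the source. Endpoint
terms vanish, so the smeared data must be carried by the source. -/
theorem Represents.momentumSolution (hΩ : IsCompact Ω) (hc : Convex ℝ Ω)
    (hi : (interior Ω).Nonempty) (hη : IsBump Ω η)
    (hs : 0 < s) (hs1 : s < 1) (hk : IsBump (Icc (s / 3) (2 * s / 3)) k)
    (hr : Represents η k s L μ m f) (hL : IsDualBound α D L) (hL0 : L 0 = 0)
    {μ₀ μ₁ : Euc d → ℝ} (h₀ : IntegrableOn μ₀ Ω) (h₁ : IntegrableOn μ₁ Ω)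
    (hjet : ∀ φ w, IsC1 Ω φ → IsJet φ w → L w = ∫ x in Ω, (φ 1 x * μ₁ x - φ 0 x * μ₀ x)) :
    MomentumSolution Ω (fun t x => (1 - s) * μ (t, x)) (fun z => (1 - s) • m z)
      (fun z => f z + k z.1 * smear Ω η s μ₀ z.2 - k (z.1 - (1 - s)) * smear Ω η s μ₁ z.2) := by
  have hK := isCompact_cylinder hΩ
  have hs0 : 0 ≤ 1 - s := by linarith
  have hμ := hr.density_nonneg hη hs hk hL
  have hμc : Continuous (Function.uncurry fun t x => (1 - s) * μ (t, x)) :=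
    continuous_const.mul (hr.continuous_density.comp (by fun_prop))
  have hmc : Continuous fun z => (1 - s) • m z := by
    have := hr.continuous_momentum
    fun_prop
  have hkc := hk.continuous
  have s0 := continuous_smear hΩ hη s h₀
  have s1 := continuous_smear hΩ hη s h₁
  have c0 : Continuous fun z : ℝ × Euc d => k z.1 * smear Ω η s μ₀ z.2 := by fun_prop
  have c1 : Continuous fun z : ℝ × Euc d => k (z.1 - (1 - s)) * smear Ω η s μ₁ z.2 := by fun_prop
  refine ⟨⟨fun t _ => ⟨?_, Eventually.of_forall fun x => mul_nonneg hs0 (hμ _)⟩,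
    hμc.continuousOn, fun t ht => tendsto_eLpNorm_of_continuousOn hΩ hμc.continuousOn ht⟩,
    hmc.continuousOn, hmc.continuousOn.integrableOn_compact hK, (hr.continuous_source.add c0).sub c1,
    fun φ hφ => ?_⟩
  · exact (hμc.comp (by fun_prop :
      Continuous fun x : Euc d => (t, x))).continuousOn.integrableOn_compact hΩ
  have e4 := hr.integral_jet_eq hΩ hc hi hη hs hs1 hk h₀ h₁ hjet hφ
  have i0 : IntegrableOn (fun z : ℝ × Euc d => φ z.1 z.2 * (k z.1 * smear Ω η s μ₀ z.2))
      (cylinder Ω) := (hφ.continuousOn.mul c0.continuousOn).integrableOn_compact hK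
  have i1 : IntegrableOn (fun z : ℝ × Euc d => φ z.1 z.2 *
      (k (z.1 - (1 - s)) * smear Ω η s μ₁ z.2)) (cylinder Ω) :=
    (hφ.continuousOn.mul c1.continuousOn).integrableOn_compact hK
  have g1 : ContinuousOn (fun z : ℝ × Euc d => (1 - s) * dt φ z.1 z.2) (cylinder Ω) :=
    continuousOn_const.mul (hφ.continuousOn_dt hc hi)
  have g2 : ContinuousOn (fun z : ℝ × Euc d => (1 - s) • gradX Ω φ z.1 z.2) (cylinder Ω) :=
    (hφ.continuousOn_gradX hc hi).const_smul (1 - s)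
  have g3 : ContinuousOn (fun z : ℝ × Euc d => (1 - s) * dt φ z.1 z.2 * μ z +
      ⟪(1 - s) • gradX Ω φ z.1 z.2, m z⟫ + φ z.1 z.2 * f z) (cylinder Ω) :=
    ((g1.mul hr.continuous_density.continuousOn).add
      (g2.inner hr.continuous_momentum.continuousOn)).add
      (hφ.continuousOn.mul hr.continuous_source.continuousOn)
  have i2 := g3.integrableOn_compact (μ := volume) hK
  have e5 : ∀ z : ℝ × Euc d, dt φ z.1 z.2 * ((1 - s) * μ (z.1, z.2)) +
      ⟪gradX Ω φ z.1 z.2, (1 - s) • m z⟫ + φ z.1 z.2 * (f z + k z.1 * smear Ω η s μ₀ z.2 -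
        k (z.1 - (1 - s)) * smear Ω η s μ₁ z.2) =
      ((1 - s) * dt φ z.1 z.2 * μ z + ⟪(1 - s) • gradX Ω φ z.1 z.2, m z⟫ + φ z.1 z.2 * f z) +
      φ z.1 z.2 * (k z.1 * smear Ω η s μ₀ z.2) -
      φ z.1 z.2 * (k (z.1 - (1 - s)) * smear Ω η s μ₁ z.2) := fun z => by
    rw [real_inner_smul_left, real_inner_smul_right]
    ring
  have i3 : IntegrableOn (fun z : ℝ × Euc d => ((1 - s) * dt φ z.1 z.2 * μ z +
      ⟪(1 - s) • gradX Ω φ z.1 z.2, m z⟫ + φ z.1 z.2 * f z) +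
      φ z.1 z.2 * (k z.1 * smear Ω η s μ₀ z.2)) (cylinder Ω) := i2.add i0
  have z0 : ∀ x, μ (0, x) = 0 := fun x => hr.density_eq_zero hs hs1 hk hL0 (Or.inl rfl)
  have z1 : ∀ x, μ (1, x) = 0 := fun x => hr.density_eq_zero hs hs1 hk hL0 (Or.inr rfl)
  rw [integral_congr_ae (Eventually.of_forall e5), integral_sub i3 i1, integral_add i2 i0, e4]
  simp only [z0, z1, mul_zero, integral_zero]
  ring

theorem Represents.energyBound (hΩ : IsCompact Ω) (hη : IsBump Ω η) (hs : 0 < s) (hs1 : s < 1)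
    {K : Set ℝ} (hk : IsBump K k) (hr : Represents η k s L μ m f) (hL : IsDualBound α D L) :
    EnergyBound Ω (fun t x => (1 - s) * μ (t, x)) (fun z => (1 - s) • m z)
      (fun z => ‖m z‖ ^ 2 / μ z) := by
  have hμ := hr.density_nonneg hη hs hk hL
  have hs0 : 0 < 1 - s := by linarith
  refine ⟨fun z _ => mul_nonneg hs0.le (hμ _), fun z _ => div_nonneg (sq_nonneg _) (hμ _),
    fun z _ => ?_⟩
  rcases eq_or_ne (μ z) 0 with h0 | h0
  · simp [hr.momentum_eq_zero hΩ hη hs hk hL h0]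
  · have e : (1 - s) * μ (z.1, z.2) * (‖m z‖ ^ 2 / μ z) = (1 - s) * ‖m z‖ ^ 2 := by
      rw [Prod.mk.eta]; field_simp
    rw [e, norm_smul, Real.norm_of_nonneg hs0.le, mul_pow]
    exact mul_le_mul_of_nonneg_right (by nlinarith) (sq_nonneg _)

end Interior

/-! ### Boundary layers, the limit of vanishing regularization, and strong duality. -/

section Duality

variable {d : ℕ} {Ω : Set (Euc d)} {η : Euc d → ℝ} {α : ℝ} {μ₀ μ₁ : Euc d → ℝ}

/-- Cheap removal of `μ₀` near time `0` and creation of `μ₁` near time `1`. -/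
theorem exists_boundary_layer (hΩ : IsCompact Ω) (hc : Convex ℝ Ω) (hi : (interior Ω).Nonempty)
    (hη : IsBump Ω η) (h₀ : IsDensity Ω μ₀) (h₁ : IsDensity Ω μ₁) :
    ∃ C : ℝ≥0∞, C ≠ ⊤ ∧ ∀ s > 0, s < 1 → ∀ k, IsBump (Icc (s / 3) (2 * s / 3)) k →
      ∃ (μ : ℝ → Euc d → ℝ) (m : ℝ × Euc d → Euc d) (e : ℝ × Euc d → ℝ),
        MomentumSolution Ω μ m (fun z => -(k z.1 * smear Ω η s μ₀ z.2) +
          k (z.1 - (1 - s)) * smear Ω η s μ₁ z.2) ∧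
        EnergyBound Ω μ m e ∧ μ 0 = μ₀ ∧ μ 1 = μ₁ ∧
        AEMeasurable (fun p => ENNReal.ofReal (e p)) (volume.restrict (cylinder Ω)) ∧
        ∫⁻ p in cylinder Ω, ENNReal.ofReal (e p) ≤ ENNReal.ofReal s * C := by
  obtain ⟨C, hC, H⟩ := exists_departure hΩ hc hi hη h₀
  obtain ⟨C', hC', H'⟩ := exists_departure hΩ hc hi hη h₁
  refine ⟨C + C', ENNReal.add_ne_top.2 ⟨hC, hC'⟩, fun s hs hs1 k hk => ?_⟩
  -- The reflected rate: after time reversal `k (s - (1 - t))` becomes `k (t - (1 - s))`, exactly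
  -- the source that the regularization creates near time `1`.
  have hk' : IsBump (Icc (s / 3) (2 * s / 3)) fun u => k (s - u) :=
    { continuous := hk.continuous.comp (by fun_prop)
      nonneg := fun u => hk.nonneg _
      mem_of_ne_zero := fun u hu => by
        have := hk.mem_of_ne_zero _ hu
        constructor <;> linarith [this.1, this.2]
      integral_eq_one := by rw [integral_sub_left_eq_self k volume s, hk.integral_eq_one] }
  obtain ⟨μ, m, e, h1, h2, h3, h4, h5, h6⟩ := H s hs hs1 k hk
  obtain ⟨μ', m', e', h1', h2', h3', h4', h5', h6'⟩ := H' s hs hs1 _ hk'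
  have hT := measurePreserving_timeReversal (Ω := Ω)
  have hm : AEMeasurable (fun p : ℝ × Euc d => ENNReal.ofReal (e' (1 - p.1, p.2)))
      (volume.restrict (cylinder Ω)) := h5'.comp_quasiMeasurePreserving hT.quasiMeasurePreserving
  have hle : ∀ p : ℝ × Euc d, ENNReal.ofReal (e p + e' (1 - p.1, p.2)) ≤
      ENNReal.ofReal (e p) + ENNReal.ofReal (e' (1 - p.1, p.2)) := fun p => ENNReal.ofReal_add_le
  have hI : ∀ᵐ p ∂(volume.restrict (cylinder Ω)), p ∈ Ioo (0 : ℝ) 1 ×ˢ Ω := by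
    rw [volume_restrict_cylinder_Ioo]
    exact ae_restrict_mem (measurableSet_Ioo.prod hΩ.measurableSet)
  refine ⟨_, _, _, ?_, h2.add h2'.timeReversal, ?_, ?_, ?_, ?_⟩
  · convert h1.add hΩ hc hi (h1'.timeReversal hΩ) using 2 with z
    simp only [neg_neg]
    congr 3
    ring
  · simp [h3, h4']
  · simp [h4, h3']
  · refine (h5.add hm).congr ?_
    filter_upwards [hI] with p hp
    exact (ENNReal.ofReal_add (h2.nonneg p hp) (h2'.timeReversal.nonneg p hp)).symm
  · calc _ ≤ ∫⁻ p in cylinder Ω, (ENNReal.ofReal (e p) +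
          ENNReal.ofReal (e' (1 - p.1, p.2))) := lintegral_mono hle
      _ = (∫⁻ p in cylinder Ω, ENNReal.ofReal (e p)) +
          ∫⁻ p in cylinder Ω, ENNReal.ofReal (e' p) := by
        rw [lintegral_add_left' h5]
        congr 1
        exact hT.lintegral_comp_emb (UnnormalizedOT.timeReversal (d := d)).measurableEmbedding
          fun p => ENNReal.ofReal (e' p)
      _ ≤ _ := by rw [mul_add]; exact add_le_add h6 h6'

/-- The boundary layer with `s = 1/2` already joins `μ₀` to `μ₁`, and its source is continuous on a
compact set. -/
theorem UW2sq_ne_top (hΩ : IsCompact Ω) (hc : Convex ℝ Ω) (hi : (interior Ω).Nonempty)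
    (h₀ : IsDensity Ω μ₀) (h₁ : IsDensity Ω μ₁) (α : ℝ) : UW2sq α Ω μ₀ μ₁ ≠ ⊤ := by
  obtain ⟨η, hη⟩ := exists_isBump hi
  obtain ⟨k, hk⟩ : ∃ k, IsBump (Icc ((1 / 2 : ℝ) / 3) (2 * (1 / 2) / 3)) k :=
    exists_isBump (by rw [interior_Icc]; exact nonempty_Ioo.2 (by norm_num))
  obtain ⟨C, hC, H⟩ := exists_boundary_layer hΩ hc hi hη h₀ h₁
  obtain ⟨μ, m, e, h1, h2, h3, h4, h5, h6⟩ := H (1 / 2) (by norm_num) (by norm_num) k hk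
  refine ne_top_of_le_ne_top (ENNReal.add_ne_top.2 ⟨ne_top_of_le_ne_top
    (ENNReal.mul_ne_top ENNReal.ofReal_ne_top hC) h6, ENNReal.mul_ne_top ENNReal.ofReal_ne_top ?_⟩)
    (h1.UW2sq_le hΩ h2 α (h3 ▸ .rfl) (h4 ▸ .rfl))
  exact Integrable.lintegral_lt_top
    ((h1.continuous_source.abs.pow 2).continuousOn.integrableOn_compact (isCompact_cylinder hΩ))
    |>.ne

/-- For each `s` the boundary layer plus the regularized solution is admissible with source `f` and
cost at most `s C + (1 - s)⁻¹ ^ (d + 1) · 2D`; here `C` does not depend on `s`. -/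
theorem UW2sq_le_of_dualValue_le (hΩ : IsCompact Ω) (hc : Convex ℝ Ω) (hi : (interior Ω).Nonempty)
    (hα : 0 < α) (h₀ : IsDensity Ω μ₀) (h₁ : IsDensity Ω μ₁) {D : ℝ}
    (hD : ∀ Φ, IsHJSubsolution Ω Φ → dualValue α Ω μ₀ μ₁ Φ ≤ D) :
    UW2sq α Ω μ₀ μ₁ ≤ ENNReal.ofReal (2 * D) := by
  have : CompactSpace (cylinder Ω) := isCompact_iff_compactSpace.1 (isCompact_cylinder hΩ)
  obtain ⟨η, hη'⟩ := exists_isBump hi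
  obtain ⟨L, hjet, hL⟩ := exists_dual_functional hΩ hc hi hα h₀.1 h₁.1 hD
  obtain ⟨C, hC, H⟩ := exists_boundary_layer hΩ hc hi hη' h₀ h₁
  have hmain : ∀ s ∈ Ioo (0 : ℝ) 1, UW2sq α Ω μ₀ μ₁ ≤
      ENNReal.ofReal s * C + ENNReal.ofReal ((1 - s)⁻¹ ^ (d + 1)) * ENNReal.ofReal (2 * D) := by
    rintro s ⟨hs, hs1⟩
    obtain ⟨k, hk⟩ : ∃ k, IsBump (Icc (s / 3) (2 * s / 3)) k :=
      exists_isBump (by rw [interior_Icc]; exact nonempty_Ioo.2 (by linarith))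
    obtain ⟨μ, m, e, h1, h2, h3, h4, h5, h6⟩ := H s hs hs1 k hk
    obtain ⟨μ', m', f, hr⟩ := exists_represents hΩ hη' hk.continuous s L
    have hL0 : L 0 = 0 := map_zero L
    have hs0 : 0 < 1 - s := by linarith
    set q := (1 - s)⁻¹ ^ (d + 1) with hq
    have hq1 : 1 ≤ q := one_le_pow₀ ((one_le_inv₀ hs0).2 (by linarith))
    have h7 := h1.add hΩ hc hi (hr.momentumSolution hΩ hc hi hη' hs hs1 hk hL hL0 h₀.1 h₁.1 hjet)
    have h8 := h7.UW2sq_le hΩ (h2.add (hr.energyBound hΩ hη' hs hs1 hk hL)) α (μ₀ := μ₀) (μ₁ := μ₁)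
      (Eventually.of_forall fun x => by
        simp [h3, hr.density_eq_zero hs hs1 hk hL0 (z := (0, x)) (Or.inl rfl)])
      (Eventually.of_forall fun x => by
        simp [h4, hr.density_eq_zero hs hs1 hk hL0 (z := (1, x)) (Or.inr rfl)])
    have h9 := hr.lintegral_energy_le hΩ hc hη' hs hs1 hk hα hL
    have hf : ∀ z : ℝ × Euc d, -(k z.1 * smear Ω η s μ₀ z.2) +
        k (z.1 - (1 - s)) * smear Ω η s μ₁ z.2 + (f z + k z.1 * smear Ω η s μ₀ z.2 -
          k (z.1 - (1 - s)) * smear Ω η s μ₁ z.2) = f z := fun z => by ring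
    simp only [hf] at h8
    refine h8.trans ?_
    have e1 : ∫⁻ z in cylinder Ω, ENNReal.ofReal (e z + ‖m' z‖ ^ 2 / μ' z) ≤
        ENNReal.ofReal s * C +
          ENNReal.ofReal q * ∫⁻ z in cylinder Ω, ENNReal.ofReal (‖m' z‖ ^ 2 / μ' z) := by
      calc _ ≤ ∫⁻ z in cylinder Ω, (ENNReal.ofReal (e z) + ENNReal.ofReal (‖m' z‖ ^ 2 / μ' z)) :=
            lintegral_mono fun z => ENNReal.ofReal_add_le
        _ ≤ _ := by
          rw [lintegral_add_left' h5]
          exact add_le_add h6 (le_mul_of_one_le_left zero_le (ENNReal.one_le_ofReal.2 hq1))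
    -- The energy estimate controls the source only with weight `1 / (α q)`; the factor `q` is
    -- pulled out of the whole cost.
    have e2 : ENNReal.ofReal (1 / α) = ENNReal.ofReal q * ENNReal.ofReal (1 / (α * q)) := by
      rw [← ENNReal.ofReal_mul (by positivity)]
      congr 1
      field_simp
    calc _ ≤ _ := add_le_add_left e1 _
      _ = ENNReal.ofReal s * C + ENNReal.ofReal q *
          ((∫⁻ z in cylinder Ω, ENNReal.ofReal (‖m' z‖ ^ 2 / μ' z)) +
            ENNReal.ofReal (1 / (α * q)) * ∫⁻ z in cylinder Ω, ENNReal.ofReal (|f z| ^ 2)) := by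
        rw [e2]; ring
      _ ≤ _ := by gcongr
  have hlim : Tendsto (fun s : ℝ => ENNReal.ofReal s * C +
      ENNReal.ofReal ((1 - s)⁻¹ ^ (d + 1)) * ENNReal.ofReal (2 * D)) (𝓝[>] 0)
      (𝓝 (ENNReal.ofReal (2 * D))) := by
    have t1 : Tendsto (fun s : ℝ => ENNReal.ofReal s * C) (𝓝 0) (𝓝 (ENNReal.ofReal 0 * C)) :=
      ENNReal.Tendsto.mul_const (ENNReal.tendsto_ofReal tendsto_id) (Or.inr hC)
    have t2 : Tendsto (fun s : ℝ => (1 - s)⁻¹ ^ (d + 1)) (𝓝 0) (𝓝 ((1 - 0)⁻¹ ^ (d + 1))) :=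
      ((tendsto_const_nhds.sub tendsto_id).inv₀ (by norm_num)).pow _
    have t3 := t1.add (ENNReal.Tendsto.mul_const (ENNReal.tendsto_ofReal t2)
      (b := ENNReal.ofReal (2 * D)) (Or.inr ENNReal.ofReal_ne_top))
    simp only [ENNReal.ofReal_zero, zero_mul, sub_zero, inv_one, one_pow, ENNReal.ofReal_one,
      one_mul, zero_add] at t3
    exact t3.mono_left nhdsWithin_le_nhds
  refine ge_of_tendsto hlim ?_
  filter_upwards [Ioo_mem_nhdsGT (zero_lt_one' ℝ)] with s hs using hmain s hs

theorem dualValue_le_half_UW2_sq (hΩ : IsCompact Ω) (hc : Convex ℝ Ω) (hi : (interior Ω).Nonempty)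
    (hα : 0 < α) (htop : UW2sq α Ω μ₀ μ₁ ≠ ⊤) {Φ : ℝ → Euc d → ℝ} (hΦ : IsHJSubsolution Ω Φ) :
    dualValue α Ω μ₀ μ₁ Φ ≤ 1 / 2 * UW2 α Ω μ₀ μ₁ ^ 2 := by
  rw [UW2, Real.sq_sqrt ENNReal.toReal_nonneg]
  -- Comparing in `ℝ≥0∞` lets the infimum absorb triples of infinite cost; a negative dual value is
  -- truncated to `0`, harmlessly.
  have h1 : ENNReal.ofReal (2 * dualValue α Ω μ₀ μ₁ Φ) ≤ UW2sq α Ω μ₀ μ₁ := by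
    refine le_sInf ?_
    rintro _ ⟨v, μ, f, h, rfl⟩
    by_cases hcost : cost α Ω v μ f = ⊤
    · rw [hcost]; exact le_top
    · refine ENNReal.ofReal_le_of_le_toReal ?_
      linarith [dualValue_le_half_cost hΩ hc hi hα h hcost hΦ]
  have h2 := ENNReal.toReal_mono htop h1
  have h3 : 2 * dualValue α Ω μ₀ μ₁ Φ ≤ (ENNReal.ofReal (2 * dualValue α Ω μ₀ μ₁ Φ)).toReal := by
    rw [ENNReal.toReal_ofReal']; exact le_max_left _ _
  linarith

theorem half_UW2_sq_le (hΩ : IsCompact Ω) (hc : Convex ℝ Ω) (hi : (interior Ω).Nonempty)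
    (hα : 0 < α) (h₀ : IsDensity Ω μ₀) (h₁ : IsDensity Ω μ₁) {D : ℝ}
    (hD : ∀ Φ, IsHJSubsolution Ω Φ → dualValue α Ω μ₀ μ₁ Φ ≤ D) :
    1 / 2 * UW2 α Ω μ₀ μ₁ ^ 2 ≤ D := by
  -- The zero subsolution has dual value `0`; without this, `ENNReal.ofReal (2 * D)` could not be
  -- converted back.
  have hD0 : 0 ≤ D := by
    obtain ⟨h1, h2⟩ := isC1_linear_time hc hi 0
    have := hD _ ⟨h1, fun t ht x hx => by rw [(h2 t ht x hx).1, (h2 t ht x hx).2]; simp⟩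
    simpa [dualValue] using this
  have h1 := ENNReal.toReal_mono ENNReal.ofReal_ne_top
    (UW2sq_le_of_dualValue_le hΩ hc hi hα h₀ h₁ hD)
  rw [ENNReal.toReal_ofReal (by positivity)] at h1
  rw [UW2, Real.sq_sqrt ENNReal.toReal_nonneg]
  linarith

end Duality

end UnnormalizedOT

end

theorem mainTheorem1 {d : ℕ} (Ω : Set (EuclideanSpace ℝ (Fin d)))
    (hΩ_compact : IsCompact Ω) (hΩ_convex : Convex ℝ Ω) (hΩ_interior : (interior Ω).Nonempty)
    (α : ℝ) (hα : 0 < α)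
    (μ₀ μ₁ : EuclideanSpace ℝ (Fin d) → ℝ)
    (hμ₀ : UnnormalizedOT.IsDensity Ω μ₀) (hμ₁ : UnnormalizedOT.IsDensity Ω μ₁) :
    UnnormalizedOT.UW2sq α Ω μ₀ μ₁ ≠ ⊤ ∧
      IsLUB {r : ℝ | ∃ Φ : ℝ → EuclideanSpace ℝ (Fin d) → ℝ,
          UnnormalizedOT.IsHJSubsolution Ω Φ ∧
            r = UnnormalizedOT.dualValue α Ω μ₀ μ₁ Φ}
        (1 / 2 * UnnormalizedOT.UW2 α Ω μ₀ μ₁ ^ 2) := by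
  have htop := UnnormalizedOT.UW2sq_ne_top hΩ_compact hΩ_convex hΩ_interior hμ₀ hμ₁ α
  refine ⟨htop, ?_, fun D hD => UnnormalizedOT.half_UW2_sq_le hΩ_compact hΩ_convex hΩ_interior hα
    hμ₀ hμ₁ fun Φ hΦ => hD ⟨Φ, hΦ, rfl⟩⟩
  rintro _ ⟨Φ, hΦ, rfl⟩
  exact UnnormalizedOT.dualValue_le_half_UW2_sq hΩ_compact hΩ_convex hΩ_interior hα htop hΦ
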